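/- **Conventions.** Matrices have entries in a field $F$. For an $n\times n$ matrix $A$: - the *left triangular part* $\mathrm{Left}(A)$ keeps the entries $A_{i,j}$ with $i+j\le n$ and replaces the others by $0$; - the *left quasiseparable order* of $A$ is $s=\max_{1\le k\le n-1}\operatorname{rank}(A_{1..k,\,1..n-k})$ (it depends only on $\mathrm{Left}(A)$, and is $0$ if $n\le 1$); - the *quasiseparable orders* of $M$ are $r_L=\max_{1\le k\le n-1}\operatorname{rank}(M_{k+1..n,\,1..k})$ and $r_U=\max_{1\le k\le n-1}\operatorname{rank}(M_{1..k,\,k+1..n})$; - the *rank profile matrix* $\mathcal R_A$ of an $m\times n$ matrix $A$ of rank $r$ is the unique $m\times n$ matrix with exactly $r$ non-zero entries, all equal to one and on distinct rows and columns, each of whose leading submatrices has the same rank as the corresponding leading submatrix of $A$; - a *PLUQ decomposition* of an $m\times n$ matrix $A$ of rank $r$ is $A=PLUQ$ with permutation matrices $P,Q$, an $m\times r$ unit lower triangular $L$ and an $r\times n$ upper triangular $U$; it *reveals the rank profile matrix* if $\mathcal R_A=P\begin{bmatrix}I_r&0\\0&0\end{bmatrix}Q$; - $J_n$ is the $n\times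 n$ unit antidiagonal matrix. **Cost model.** Algorithms are algebraic computation trees over a base field $k$. They may use constants of $k$ and run over any field $F\supseteq k$. Each arithmetic operation and each test "$x=0$?" counts as one field operation. Constants, copies, permutations and index manipulations are free. **Algorithm LT-RPM** (input: an $n\times n$ matrix $A$). If $n\le 1$, return the zero matrix. Otherwise split $A=\begin{bmatrix}A_1&A_2\\A_3&*\end{bmatrix}$ with $A_3$ of size $\lfloor n/2\rfloor\times\lfloor n/2\rfloor$. Compute a PLUQ decomposition $A_1=P_1\begin{bmatrix}L_1\\M_1\end{bmatrix}\begin{bmatrix}U_1&V_1\end{bmatrix}Q_1$ revealing the rank profile matrix, with $L_1,U_1$ of size $r_1=\operatorname{rank}A_1$, and set $\mathcal R_1=P_1\begin{bmatrix}I_{r_1}&0\\0&0\end{bmatrix}Q_1$. Set $$\begin{bmatrix}B_1\\B_2\end{bmatrix}=P_1^TA_2,\quad \begin{bmatrix}C_1&C_2\end{bmatrix}=A_3Q_1^T,\quad D=L_1^{-1}B_1,\quad E=C_1U_1^{-1},\quad F=B_2-M_1D,\quad G=C_2-EV_1,$$ $$H=P_1\begin{bmatrix}0\\F\end{bmatrix},\qquad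 I=\begin{bmatrix}0&G\end{bmatrix}Q_1 .$$ Call the algorithm on $H$ and $I$, obtaining $\mathcal R_2$ and $\mathcal R_3$, and return $\begin{bmatrix}\mathcal R_1&\mathcal R_2\\\mathcal R_3&0\end{bmatrix}$, given as the list of the positions of its ones. The algorithm calls four subroutines: the PLUQ decomposition, the solvers $L_1^{-1}B_1$ and $C_1U_1^{-1}$, and the product-subtraction $B-XY$. **Algorithm QS-order** (input: an $n\times n$ matrix $A$). Run LT-RPM on $A$. For every position $(i,j)$ returned, mark row $i$ and column $j$. Start from $s=r=0$; for $i=1,\dots,n-1$: if row $i$ is marked, increase $r$ by $1$; if column $n-i+1$ is marked, decrease $r$ by $1$; then replace $s$ by $\max(s,r)$. Return $s$. **Theorem.** Let $k$ be a field and $2<\omega\le 3$, and assume that two $n\times n$ matrices can be multiplied in $O(n^\omega)$ field operations (by algorithms over $k$, valid over every field containing $k$, with one constant in the $O$). 1. *(Correctness.)* With any correct subroutines over a field $F\supseteq k$, for every $n\times n$ matrix $A$ over $F$ the rank profile matrix $\mathcal R_A$ exists and is unique, and LT-RPM returns $\mathrm{Left}(\mathcal R_A)$. 2. *(Cost.)*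 Suppose the subroutines are correct and have, for some constant $c$, the following costs: - at most $c\,mn\max(1,r)^{\omega-2}$ for the PLUQ decomposition of an $m\times n$ matrix of rank $r$; - at most $c\max(r,m)\,r^{\omega-1}$ for solving an $r\times r$ triangular system with $m$ right-hand sides; - at most $c\,(m+r)(n+r)\max(1,r)^{\omega-2}$ for $B-XY$ with $X$ of size $m\times r$ and $Y$ of size $r\times n$. Then LT-RPM uses at most $C\,n^2\max(1,s)^{\omega-2}$ field operations on every $n\times n$ matrix $A$ of left quasiseparable order $s$, that is $O(n^2s^{\omega-2})$ for $s\ge 1$. Here $C$ depends only on $c$, $\omega$ and $k$. In particular the bound depends on $s$ and not on $\operatorname{rank}A$. 3. *(Subroutines.)* Correct subroutines with these costs exist, with one constant $c$ valid over all fields $F\supseteq k$. 4. *(QS-order.)* With any correct subroutines, QS-order returns the left quasiseparable order of its input; after the call of LT-RPM it performs no field operation and $O(n)$ elementary steps. 5. *(Quasiseparable orders.)* Let $M$ be a dense $n\times n$ matrix, and let $L$ and $U$ be its lower and upper triangular parts (with or without the diagonal). With any correct subroutines, QS-order run on $J_nL$ and on $UJ_n$ returns $r_L$ and $r_U$ respectively.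 The left quasiseparable orders of $J_nL$ and $UJ_n$ are $r_L$ and $r_U$, so that these orders govern the costs in item 2. -/

import Mathlib

universe u

/-! ## Leading ranks, quasiseparable orders, rank profile matrix

Rows and columns are indexed from `0` in the code. -/

/-- Rank of the leading `a × b` submatrix (first `a` rows, first `b` columns). -/
noncomputable def leadingRank {F : Type u} [Field F] {m n : ℕ}
    (A : Matrix (Fin m) (Fin n) F) (a b : ℕ) : ℕ :=
  (A.submatrix (fun x : {x : Fin m // x.1 < a} => x.1)
    (fun y : {y : Fin n // y.1 < b} => y.1)).rank

/-- Left quasiseparable order: the maximal rank of a leading `p × (n - p)` submatrix,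
`1 ≤ p ≤ n - 1`. -/
noncomputable def leftQSOrder {F : Type u} [Field F] {n : ℕ}
    (A : Matrix (Fin n) (Fin n) F) : ℕ :=
  (Finset.Icc 1 (n - 1)).sup fun p => leadingRank A p (n - p)

/-- Lower quasiseparable order `r_L`: the maximal rank of the blocks with rows `p+1, …, n` and
columns `1, …, p` (numbered from `1`), `1 ≤ p ≤ n - 1`. -/
noncomputable def lowerQSOrder {F : Type u} [Field F] {n : ℕ}
    (M : Matrix (Fin n) (Fin n) F) : ℕ :=
  (Finset.Icc 1 (n - 1)).sup fun p =>
    (M.submatrix (fun x : {x : Fin n // p ≤ x.1} => x.1)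
      (fun y : {y : Fin n // y.1 < p} => y.1)).rank

/-- Upper quasiseparable order `r_U`: the maximal rank of the blocks with rows `1, …, p` and
columns `p+1, …, n` (numbered from `1`), `1 ≤ p ≤ n - 1`. -/
noncomputable def upperQSOrder {F : Type u} [Field F] {n : ℕ}
    (M : Matrix (Fin n) (Fin n) F) : ℕ :=
  (Finset.Icc 1 (n - 1)).sup fun p =>
    (M.submatrix (fun x : {x : Fin n // x.1 < p} => x.1)
      (fun y : {y : Fin n // p ≤ y.1} => y.1)).rank

/-- The left triangular part: numbered from `1`, the entries with `i + j ≤ n` are kept. -/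
def leftPart {F : Type u} [Field F] {n : ℕ} (A : Matrix (Fin n) (Fin n) F) :
    Matrix (Fin n) (Fin n) F :=
  Matrix.of fun i j => if (i.1 + 1) + (j.1 + 1) ≤ n then A i j else 0

/-- The unit antidiagonal matrix `J_n`. -/
def antidiag (F : Type u) [Field F] (n : ℕ) : Matrix (Fin n) (Fin n) F :=
  Matrix.of fun i j => if j = Fin.rev i then 1 else 0

/-- `R` is the rank profile matrix of `A`: it has `rank A` non-zero entries, all equal to one, on
distinct rows and columns, and its leading submatrices have the same ranks as those of `A`. -/
structure IsRankProfileMatrix {F : Type u} [Field F] {m n : ℕ}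
    (A R : Matrix (Fin m) (Fin n) F) : Prop where
  zero_or_one : ∀ i j, R i j = 0 ∨ R i j = 1
  distinct_cols : ∀ i j j', R i j ≠ 0 → R i j' ≠ 0 → j = j'
  distinct_rows : ∀ i i' j, R i j ≠ 0 → R i' j ≠ 0 → i = i'
  card_eq : {p : Fin m × Fin n | R p.1 p.2 ≠ 0}.ncard = A.rank
  leading_eq : ∀ a b, a ≤ m → b ≤ n → leadingRank R a b = leadingRank A a b

/-- The compact form of a 0-1 matrix: the list, without repetition, of the positions of its
ones. -/
def IsPivotList {F : Type u} [Field F] {m n : ℕ} (l : List (ℕ × ℕ))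
    (R : Matrix (Fin m) (Fin n) F) : Prop :=
  l.Nodup ∧ (∀ p ∈ l, p.1 < m ∧ p.2 < n) ∧
    ∀ (i : Fin m) (j : Fin n), R i j = if (i.1, j.1) ∈ l then 1 else 0

/-! ## The computation model

Algebraic computation trees.  A program never sees a field element: it only handles addresses of
memory cells.  It may load a constant of the base field `k`, apply an arithmetic operation to two
cells (the result goes to a new cell, whose address is passed on), and branch on whether a cell is
zero.  Programs can be run over every field `F` that contains `k`. -/

inductive FieldOp
  | add | sub | mul | div

def FieldOp.eval {F : Type u} [Field F] : FieldOp → F → F → F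
  | .add, x, y => x + y
  | .sub, x, y => x - y
  | .mul, x, y => x * y
  | .div, x, y => x / y

inductive Prog (k : Type u) (α : Type) : Type u
  | ret (a : α) : Prog k α
  | lit (c : k) (next : ℕ → Prog k α) : Prog k α
  | op (o : FieldOp) (x y : ℕ) (next : ℕ → Prog k α) : Prog k α
  | test (x : ℕ) (next : Bool → Prog k α) : Prog k α

namespace Prog

def bind {k : Type u} {α β : Type} : Prog k α → (α → Prog k β) → Prog k β
  | ret a, f => f a
  | lit c next, f => lit c fun x => (next x).bind f
  | op o x y next, f => op o x y fun z => (next z).bind f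
  | test x next, f => test x fun b => (next b).bind f

instance {k : Type u} : Monad (Prog k) where
  pure := ret
  bind := bind

/-- Load a constant into a new cell and return its address. -/
def const {k : Type u} (c : k) : Prog k ℕ := lit c ret

open Classical in
/-- Run a program on a memory; the outcome is the returned data and the final memory.
New cells are appended at the end of the memory. -/
noncomputable def exec {k F : Type u} [Field k] [Field F] [Algebra k F] {α : Type} :
    Prog k α → List F → α × List F
  | ret a, μ => (a, μ)
  | lit c next, μ => (next μ.length).exec (μ ++ [algebraMap k F c])
  | op o x y next, μ => (next μ.length).exec (μ ++ [o.eval (μ.getD x 0) (μ.getD y 0)])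
  | test x next, μ => (next (decide (μ.getD x 0 = 0))).exec μ

open Classical in
/-- The number of field operations of a run: every arithmetic operation and every zero test
costs one. -/
noncomputable def cost {k F : Type u} [Field k] [Field F] [Algebra k F] {α : Type} :
    Prog k α → List F → ℕ
  | ret _, _ => 0
  | lit c next, μ => (next μ.length).cost (μ ++ [algebraMap k F c])
  | op o x y next, μ => (next μ.length).cost (μ ++ [o.eval (μ.getD x 0) (μ.getD y 0)]) + 1
  | test x next, μ => (next (decide (μ.getD x 0 = 0))).cost μ + 1

/-- The data returned by a run. -/
noncomputable def val {k F : Type u} [Field k] [Field F] [Algebra k F] {α : Type}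
    (p : Prog k α) (μ : List F) : α := (p.exec μ).1

/-- The memory after a run. -/
noncomputable def mem {k F : Type u} [Field k] [Field F] [Algebra k F] {α : Type}
    (p : Prog k α) (μ : List F) : List F := (p.exec μ).2

end Prog

/-- A matrix stored in memory: the addresses of its entries. -/
abbrev AddrMatrix (m n : ℕ) : Type := Matrix (Fin m) (Fin n) ℕ

namespace AddrMatrix

/-- All addresses lie in the memory. -/
def Valid {F : Type u} {m n : ℕ} (X : AddrMatrix m n) (μ : List F) : Prop :=
  ∀ i j, X i j < μ.length

/-- The matrix of field elements that is stored at the given addresses. -/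
def load {F : Type u} [Field F] {m n : ℕ} (X : AddrMatrix m n) (μ : List F) :
    Matrix (Fin m) (Fin n) F :=
  Matrix.of fun i j => μ.getD (X i j) 0

end AddrMatrix

/-- Two `n × n` matrices can be multiplied in `O(n ^ ω)` field operations, by algorithms with
constants in `k` that work over every field containing `k`. -/
def MatMulExponent (k : Type u) [Field k] (ω : ℝ) : Prop :=
  ∃ (C : ℝ) (mm : ∀ n : ℕ, AddrMatrix n n → AddrMatrix n n → Prog k (AddrMatrix n n)),
    ∀ (F : Type u) [Field F] [Algebra k F] (n : ℕ) (X Y : AddrMatrix n n) (μ : List F),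
      X.Valid μ → Y.Valid μ →
        ((mm n X Y).val μ).Valid ((mm n X Y).mem μ) ∧
        ((mm n X Y).val μ).load ((mm n X Y).mem μ) = X.load μ * Y.load μ ∧
        ((mm n X Y).cost μ : ℝ) ≤ C * (n : ℝ) ^ ω

/-! ## The subroutines of the algorithm -/

/-- The output `(r, P, L, U, Q)` of a PLUQ decomposition routine. -/
structure PLUQ (m n : ℕ) where
  r : ℕ
  r_le_rows : r ≤ m
  r_le_cols : r ≤ n
  P : Equiv.Perm (Fin m)
  Q : Equiv.Perm (Fin n)
  L : AddrMatrix m r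
  U : AddrMatrix r n

/-- The `m × n` matrix with the identity of order `r` as its top left block, zero elsewhere. -/
def idBlock (F : Type u) [Field F] (m n r : ℕ) : Matrix (Fin m) (Fin n) F :=
  Matrix.of fun i j => if i.1 = j.1 ∧ i.1 < r then 1 else 0

/-- `f`, read in the memory `μ`, is a PLUQ decomposition of `A` that reveals its rank profile
matrix. -/
structure PLUQ.Decomposes {F : Type u} [Field F] {m n : ℕ} (f : PLUQ m n) (μ : List F)
    (A : Matrix (Fin m) (Fin n) F) : Prop where
  valid_L : f.L.Valid μ
  valid_U : f.U.Valid μ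
  r_eq_rank : f.r = A.rank
  L_diag : ∀ (i : Fin m) (t : Fin f.r), i.1 = t.1 → f.L.load μ i t = 1
  L_upper : ∀ (i : Fin m) (t : Fin f.r), i.1 < t.1 → f.L.load μ i t = 0
  U_lower : ∀ (t : Fin f.r) (j : Fin n), j.1 < t.1 → f.U.load μ t j = 0
  eq_mul : A = f.P.permMatrix F * f.L.load μ * f.U.load μ * f.Q.permMatrix F
  reveals : IsRankProfileMatrix A (f.P.permMatrix F * idBlock F m n f.r * f.Q.permMatrix F)

/-- Routines for: a PLUQ decomposition; `L⁻¹ * B`; `C * U⁻¹`; `B - X * Y`. -/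
structure Subroutines (k : Type u) where
  pluq : ∀ m n : ℕ, AddrMatrix m n → Prog k (PLUQ m n)
  lowerSolve : ∀ r n : ℕ, AddrMatrix r r → AddrMatrix r n → Prog k (AddrMatrix r n)
  upperSolve : ∀ m r : ℕ, AddrMatrix m r → AddrMatrix r r → Prog k (AddrMatrix m r)
  subMul : ∀ m r n : ℕ, AddrMatrix m n → AddrMatrix m r → AddrMatrix r n →
    Prog k (AddrMatrix m n)

namespace Subroutines

/-- The routines meet their specifications over the field `F`. -/
structure CorrectOver {k : Type u} [Field k] (S : Subroutines k) (F : Type u) [Field F]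
    [Algebra k F] : Prop where
  pluq_spec : ∀ (m n : ℕ) (A : AddrMatrix m n) (μ : List F), A.Valid μ →
    ((S.pluq m n A).val μ).Decomposes ((S.pluq m n A).mem μ) (A.load μ)
  lowerSolve_spec : ∀ (r n : ℕ) (L : AddrMatrix r r) (B : AddrMatrix r n) (μ : List F),
    L.Valid μ → B.Valid μ →
    (∀ i, L.load μ i i = 1) → (∀ i j, i < j → L.load μ i j = 0) →
      ((S.lowerSolve r n L B).val μ).Valid ((S.lowerSolve r n L B).mem μ) ∧
      ((S.lowerSolve r n L B).val μ).load ((S.lowerSolve r n L B).mem μ) =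
        (L.load μ)⁻¹ * B.load μ
  upperSolve_spec : ∀ (m r : ℕ) (C : AddrMatrix m r) (U : AddrMatrix r r) (μ : List F),
    C.Valid μ → U.Valid μ →
    (∀ i, U.load μ i i ≠ 0) → (∀ i j, j < i → U.load μ i j = 0) →
      ((S.upperSolve m r C U).val μ).Valid ((S.upperSolve m r C U).mem μ) ∧
      ((S.upperSolve m r C U).val μ).load ((S.upperSolve m r C U).mem μ) =
        C.load μ * (U.load μ)⁻¹
  subMul_spec : ∀ (m r n : ℕ) (B : AddrMatrix m n) (X : AddrMatrix m r) (Y : AddrMatrix r n)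
    (μ : List F), B.Valid μ → X.Valid μ → Y.Valid μ →
      ((S.subMul m r n B X Y).val μ).Valid ((S.subMul m r n B X Y).mem μ) ∧
      ((S.subMul m r n B X Y).val μ).load ((S.subMul m r n B X Y).mem μ) =
        B.load μ - X.load μ * Y.load μ

/-- The routines run over `F` within the costs of fast rank-sensitive elimination, with constant
`c`: `m n r^(ω-2)` for the PLUQ decomposition of an `m × n` matrix of rank `r` (read as `m n` if
`r = 0`, since the zero tests are counted), and the corresponding costs for triangular solving and
for the product. -/
structure CostOver {k : Type u} [Field k] (S : Subroutines k) (F : Type u) [Field F]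
    [Algebra k F] (ω c : ℝ) : Prop where
  pluq_cost : ∀ (m n : ℕ) (A : AddrMatrix m n) (μ : List F), A.Valid μ →
    ((S.pluq m n A).cost μ : ℝ) ≤
      c * m * n * (max 1 ((A.load μ).rank : ℝ)) ^ (ω - 2)
  lowerSolve_cost : ∀ (r n : ℕ) (L : AddrMatrix r r) (B : AddrMatrix r n) (μ : List F),
    L.Valid μ → B.Valid μ →
    (∀ i, L.load μ i i = 1) → (∀ i j, i < j → L.load μ i j = 0) →
      ((S.lowerSolve r n L B).cost μ : ℝ) ≤ c * max (r : ℝ) n * (r : ℝ) ^ (ω - 1)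
  upperSolve_cost : ∀ (m r : ℕ) (C : AddrMatrix m r) (U : AddrMatrix r r) (μ : List F),
    C.Valid μ → U.Valid μ →
    (∀ i, U.load μ i i ≠ 0) → (∀ i j, j < i → U.load μ i j = 0) →
      ((S.upperSolve m r C U).cost μ : ℝ) ≤ c * max (r : ℝ) m * (r : ℝ) ^ (ω - 1)
  subMul_cost : ∀ (m r n : ℕ) (B : AddrMatrix m n) (X : AddrMatrix m r) (Y : AddrMatrix r n)
    (μ : List F), B.Valid μ → X.Valid μ → Y.Valid μ →
      ((S.subMul m r n B X Y).cost μ : ℝ) ≤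
        c * (m + r) * (n + r) * (max 1 (r : ℝ)) ^ (ω - 2)

end Subroutines

/-! ## Algorithm LT-RPM -/

/-- Algorithm LT-RPM.  The matrix is split into `[A₁ A₂; A₃ *]` with `A₃` of size
`⌊n/2⌋ × ⌊n/2⌋`; `A₁` is decomposed, the other two blocks are updated, and the algorithm calls
itself on `H` and `I`.  The 0-1 matrix that it computes is returned in compact form. -/
def ltRPM {k : Type u} [Field k] (S : Subroutines k) (n : ℕ) (A : AddrMatrix n n) :
    Prog k (List (ℕ × ℕ)) :=
  if hn : n ≤ 1 then pure []
  else do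
    let A₁ : AddrMatrix (n - n / 2) (n / 2) :=
      fun i j => A ⟨i.1, by omega⟩ ⟨j.1, by omega⟩
    let A₂ : AddrMatrix (n - n / 2) (n - n / 2) :=
      fun i j => A ⟨i.1, by omega⟩ ⟨n / 2 + j.1, by omega⟩
    let A₃ : AddrMatrix (n / 2) (n / 2) :=
      fun i j => A ⟨(n - n / 2) + i.1, by omega⟩ ⟨j.1, by omega⟩
    let f ← S.pluq (n - n / 2) (n / 2) A₁
    have hr := f.r_le_rows
    have hc := f.r_le_cols
    let L₁ : AddrMatrix f.r f.r := fun i j => f.L ⟨i.1, by omega⟩ j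
    let M₁ : AddrMatrix (n - n / 2 - f.r) f.r := fun i j => f.L ⟨f.r + i.1, by omega⟩ j
    let U₁ : AddrMatrix f.r f.r := fun i j => f.U i ⟨j.1, by omega⟩
    let V₁ : AddrMatrix f.r (n / 2 - f.r) := fun i j => f.U i ⟨f.r + j.1, by omega⟩
    let R₁ : List (ℕ × ℕ) := List.ofFn fun t : Fin f.r =>
      ((f.P.symm ⟨t.1, by omega⟩).1, (f.Q ⟨t.1, by omega⟩).1)
    -- `[B₁; B₂] = P₁ᵀ A₂` and `[C₁ C₂] = A₃ Q₁ᵀ`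
    let B₁ : AddrMatrix f.r (n - n / 2) := fun t j => A₂ (f.P.symm ⟨t.1, by omega⟩) j
    let B₂ : AddrMatrix (n - n / 2 - f.r) (n - n / 2) :=
      fun t j => A₂ (f.P.symm ⟨f.r + t.1, by omega⟩) j
    let C₁ : AddrMatrix (n / 2) f.r := fun i t => A₃ i (f.Q ⟨t.1, by omega⟩)
    let C₂ : AddrMatrix (n / 2) (n / 2 - f.r) := fun i t => A₃ i (f.Q ⟨f.r + t.1, by omega⟩)
    let D ← S.lowerSolve f.r (n - n / 2) L₁ B₁
    let E ← S.upperSolve (n / 2) f.r C₁ U₁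
    let F ← S.subMul (n - n / 2 - f.r) f.r (n - n / 2) B₂ M₁ D
    let G ← S.subMul (n / 2) f.r (n / 2 - f.r) C₂ E V₁
    let z ← Prog.const 0
    -- `H = P₁ [0; F]` and `I = [0 G] Q₁`
    let H : AddrMatrix (n - n / 2) (n - n / 2) := fun i j =>
      if h : f.r ≤ (f.P i).1 then F ⟨(f.P i).1 - f.r, by omega⟩ j else z
    let I : AddrMatrix (n / 2) (n / 2) := fun i j =>
      if h : f.r ≤ (f.Q.symm j).1 then G i ⟨(f.Q.symm j).1 - f.r, by omega⟩ else z
    let R₂ ← ltRPM S (n - n / 2) H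
    let R₃ ← ltRPM S (n / 2) I
    pure (R₁ ++ R₂.map (fun p => (p.1, n / 2 + p.2)) ++
      R₃.map (fun p => ((n - n / 2) + p.1, p.2)))
termination_by n
decreasing_by all_goals omega

/-! ## Algorithm QS-order -/

/-- The state of the scan: the two Boolean arrays, the two counters, and the number of
elementary steps made so far. -/
structure ScanState where
  rows : ℕ → Bool
  cols : ℕ → Bool
  s : ℤ
  r : ℤ
  steps : ℕ

/-- Initialization: two arrays of length `n` and two counters. -/
def scanInit (n : ℕ) : ScanState :=
  { rows := fun _ => false, cols := fun _ => false, s := 0, r := 0, steps := 2 * n + 2 }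

/-- Body of the first loop, for the pivot `p`: two assignments. -/
def scanMark (st : ScanState) (p : ℕ × ℕ) : ScanState :=
  { st with
    rows := Function.update st.rows p.1 true
    cols := Function.update st.cols p.2 true
    steps := st.steps + 2 }

/-- Body of the second loop, for the row `i` (numbered from `0`): two tests, at most two updates
of `r`, one update of `s`. -/
def scanStep (n : ℕ) (st : ScanState) (i : ℕ) : ScanState :=
  let r₁ := if st.rows i then st.r + 1 else st.r
  let r₂ := if st.cols (n - 1 - i) then r₁ - 1 else r₁
  { st with s := max st.s r₂, r := r₂, steps := st.steps + 5 }

/-- The scan of a list of pivots. -/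
def scan (n : ℕ) (l : List (ℕ × ℕ)) : ScanState :=
  (List.range (n - 1)).foldl (scanStep n) (l.foldl scanMark (scanInit n))

/-- Algorithm QS-order: LT-RPM followed by the scan.  Returns the computed order and the number of
steps of the scan. -/
def qsOrder {k : Type u} [Field k] (S : Subroutines k) (n : ℕ) (A : AddrMatrix n n) :
    Prog k (ℤ × ℕ) := do
  let l ← ltRPM S n A
  pure ((scan n l).s, (scan n l).steps)

/-!
Extend every matrix by zero to an array indexed by `ℕ × ℕ`, and call `(i, j)` a pivot if the mixed
second difference of the ranks of the leading blocks is `1` there: the rank profile matrix is the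
indicator of the pivots. Let `A₁` have size `m × d`. Elimination satisfies
`rank A[..p, ..d + q] = rank A[..p, ..d] + rank H[..p, ..q]`, and symmetrically below `A₁` for `I`,
because a row of `A₁` is a combination of the pivot rows above it. The first summand does not
depend on `q`, so the pivots of `A` to the right of `A₁` are those of `H`; it is nonnegative, so
the left quasiseparable order of `H` is at most that of `A`. One elimination thus costs
`O(n ^ 2 s ^ (ω - 2))`, and the two recursive calls have total area at most `2 / 3 * n ^ 2`, so the
costs of the levels form a geometric series. In QS-order, the counter `r` after step `p` is the
number of pivots in the leading `p × (n - p)` block, that is, its rank.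

The subroutines come from matrix multiplication by splitting into blocks: rectangular products into
square ones, triangular systems and decompositions into halves.
-/

section LinearAlgebra

open Matrix Module

variable {F : Type*} [Field F]

theorem mulVec_injective_of_leading {R ι τ : Type*} [Ring R] [NoZeroDivisors R] [LinearOrder ι]
    [Fintype τ] {C : Matrix ι τ R} {ρ : τ → ι} (hρ : Function.Injective ρ)
    (zero_above : ∀ i t, i < ρ t → C i t = 0) (ne_zero : ∀ t, C (ρ t) t ≠ 0) :
    Function.Injective C.mulVec := by
  classical
  suffices h : ∀ x, C *ᵥ x = 0 → x = 0 by
    intro x y hxy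
    exact sub_eq_zero.mp (h _ (by rw [Matrix.mulVec_sub, sub_eq_zero]; exact hxy))
  intro x hx
  by_contra hne
  obtain ⟨s, hs⟩ := Function.ne_iff.mp hne
  obtain ⟨t, ht, hmin⟩ := Finset.exists_min_image (Finset.univ.filter fun t => x t ≠ 0) ρ
    ⟨s, by simpa using hs⟩
  have hrow : C (ρ t) t * x t = 0 := by
    rw [← show (C *ᵥ x) (ρ t) = 0 from congrFun hx _, Matrix.mulVec, dotProduct,
      Finset.sum_eq_single t _ (by simp)]
    intro s _ hst
    by_cases hxs : x s = 0
    · rw [hxs, mul_zero]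
    · rw [zero_above _ _ ((hmin s (by simpa using hxs)).lt_of_ne fun h => hst (hρ h.symm)),
        zero_mul]
  exact mul_ne_zero (ne_zero t) (by simpa using ht) hrow

theorem rank_mul_eq_card_of_injective {ι κ τ : Type*} [Finite ι] [Fintype κ] [Fintype τ]
    {C : Matrix ι τ F} {U : Matrix τ κ F} (hC : Function.Injective C.mulVec)
    (hU : Function.Injective Uᵀ.mulVec) : (C * U).rank = Fintype.card τ := by
  have hUr : U.rank = Fintype.card τ := by
    rw [← rank_transpose, rank, LinearMap.finrank_range_of_inj hU, finrank_fintype_fun_eq_card]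
  rw [← hUr, rank, mulVecLin_mul, LinearMap.range_comp,
    ← LinearEquiv.finrank_eq (Submodule.equivMapOfInjective C.mulVecLin hC _), rank]

theorem finrank_range_eq_of_ker_eq {V W W' : Type*} [AddCommGroup V] [Module F V]
    [AddCommGroup W] [Module F W] [AddCommGroup W'] [Module F W'] {f : V →ₗ[F] W} {g : V →ₗ[F] W'}
    (h : f.ker = g.ker) : finrank F f.range = finrank F g.range := by
  rw [← f.quotKerEquivRange.finrank_eq, ← g.quotKerEquivRange.finrank_eq, h]

theorem finrank_submodule_prod {V W : Type*} [AddCommGroup V] [Module F V] [AddCommGroup W]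
    [Module F W] (p : Submodule F V) (q : Submodule F W) [FiniteDimensional F p]
    [FiniteDimensional F q] : finrank F (p.prod q) = finrank F p + finrank F q := by
  have hinj : Function.Injective (p.subtype.prodMap q.subtype) :=
    p.subtype_injective.prodMap q.subtype_injective
  rw [← finrank_prod, ← LinearMap.finrank_range_of_inj hinj, LinearMap.range_prodMap,
    p.range_subtype, q.range_subtype]

/-- A matrix and its pivot rows next to the Schur complement have the same kernel, because the
relations hold in particular on the pivot rows. -/
theorem rank_fromCols_eq_card_add_rank {ι ν κ τ : Type*} [Finite ι] [Fintype ν] [Fintype κ]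
    [Fintype τ] {A : Matrix ι ν F} {B H : Matrix ι κ F} {C : Matrix ι τ F} {g : τ → ι}
    (hA : A = C * A.submatrix g id) (hB : B = C * B.submatrix g id + H)
    (hli : LinearIndependent F (A.submatrix g id).row) :
    (fromCols A B).rank = Fintype.card τ + H.rank := by
  let S : Matrix τ (ν ⊕ κ) F := fromCols (A.submatrix g id) (B.submatrix g id)
  let Φ : (ν ⊕ κ → F) →ₗ[F] (τ → F) × (ι → F) :=
    S.mulVecLin.prod (H.mulVecLin ∘ₗ LinearMap.funLeft F F Sum.inr)
  have hmul (v : ν ⊕ κ → F) : fromCols A B *ᵥ v = C *ᵥ (S *ᵥ v) + H *ᵥ (v ∘ Sum.inr) := by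
    simp only [S, fromCols_mulVec, mulVec_add, mulVec_mulVec]
    conv_lhs => rw [hA, hB, add_mulVec, ← add_assoc]
  have hpivot (v : ν ⊕ κ → F) : S *ᵥ v = (fromCols A B *ᵥ v) ∘ g := by
    simp only [S, fromCols_mulVec]
    rfl
  have hker : (fromCols A B).mulVecLin.ker = Φ.ker := by
    ext v
    have hΦ : Φ v = 0 ↔ S *ᵥ v = 0 ∧ H *ᵥ (v ∘ Sum.inr) = 0 := Prod.ext_iff
    rw [LinearMap.mem_ker, LinearMap.mem_ker, hΦ, mulVecLin_apply]
    constructor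
    · intro h
      have hS : S *ᵥ v = 0 := by rw [hpivot, h]; rfl
      exact ⟨hS, by simpa only [hS, mulVec_zero, zero_add, h] using (hmul v).symm⟩
    · rintro ⟨hS, hH⟩
      rw [hmul, hS, hH, mulVec_zero, add_zero]
  have hsurj : (A.submatrix g id).mulVecLin.range = ⊤ :=
    Submodule.eq_top_of_finrank_eq
      (hli.rank_matrix.trans (finrank_fintype_fun_eq_card F).symm)
  have hrange : Φ.range = (⊤ : Submodule F (τ → F)).prod H.mulVecLin.range := by
    ext ⟨x, y⟩
    constructor
    · rintro ⟨v, hv⟩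
      exact ⟨trivial, v ∘ Sum.inr, congrArg Prod.snd hv⟩
    · rintro ⟨-, w, rfl⟩
      obtain ⟨v, hv⟩ : ∃ v, A.submatrix g id *ᵥ v = x - B.submatrix g id *ᵥ w :=
        LinearMap.range_eq_top.mp hsurj _
      refine ⟨Sum.elim v w, Prod.ext ?_ rfl⟩
      exact (fromCols_mulVec_sumElim ..).trans (by rw [hv, sub_add_cancel])
  rw [rank, finrank_range_eq_of_ker_eq hker, hrange, finrank_submodule_prod, finrank_top,
    finrank_fintype_fun_eq_card, rank]

theorem span_image_Iio_eq_of_finrank_succ {V : Type*} [AddCommGroup V] [Module F V] {v : ℕ → V}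
    {S : Set ℕ} {a : ℕ} (h : ∀ i < a, i ∉ S → finrank F (Submodule.span F (v '' Set.Iio (i + 1))) =
      finrank F (Submodule.span F (v '' Set.Iio i))) :
    Submodule.span F (v '' Set.Iio a) = Submodule.span F (v '' (S ∩ Set.Iio a)) := by
  refine le_antisymm ?_ (Submodule.span_mono (Set.image_mono Set.inter_subset_right))
  induction a with
  | zero => simp
  | succ a ih =>
    have hprev : Submodule.span F (v '' Set.Iio a) ≤
        Submodule.span F (v '' (S ∩ Set.Iio (a + 1))) :=
      (ih fun i hi => h i (hi.trans (Nat.lt_succ_self a))).trans (Submodule.span_mono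
        (Set.image_mono (Set.inter_subset_inter_right S (Set.Iio_subset_Iio a.le_succ))))
    by_cases ha : a ∈ S
    · have hIio : Set.Iio (a + 1) = insert a (Set.Iio a) := Order.Iio_succ_eq_insert a
      rw [hIio, Set.image_insert_eq, Submodule.span_insert, sup_le_iff, ← hIio]
      exact ⟨Submodule.span_mono (Set.singleton_subset_iff.mpr
        (Set.mem_image_of_mem v ⟨ha, Nat.lt_succ_self a⟩)), hprev⟩
    · have := FiniteDimensional.span_of_finite F ((Set.finite_Iio (a + 1)).image v)
      rwa [← Submodule.eq_of_le_of_finrank_eq (Submodule.span_mono (Set.image_mono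
        (Set.Iio_subset_Iio a.le_succ))) (h a a.lt_succ_self ha).symm]

end LinearAlgebra

section BlockRank

variable {F : Type*} [Field F]

/-- The rank of the leading `a × b` block of a doubly infinite array. Arrays indexed by `ℕ` spare
the casts between the index types of a matrix and of its blocks. -/
noncomputable def blockRank (f : ℕ → ℕ → F) (a b : ℕ) : ℕ :=
  (Matrix.of fun (i : Fin a) (j : Fin b) => f i j).rank

theorem blockRank_congr {f g : ℕ → ℕ → F} {a b : ℕ} (h : ∀ i < a, ∀ j < b, f i j = g i j) :
    blockRank f a b = blockRank g a b :=
  congrArg Matrix.rank (Matrix.ext fun i j => h i i.2 j j.2)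

theorem blockRank_swap (f : ℕ → ℕ → F) (a b : ℕ) :
    blockRank (fun i j => f j i) a b = blockRank f b a :=
  Matrix.rank_transpose (Matrix.of fun (i : Fin b) (j : Fin a) => f i j)

theorem blockRank_eq_finrank_span (f : ℕ → ℕ → F) (a n : ℕ) :
    blockRank f a n = Module.finrank F
      (Submodule.span F ((fun i (j : Fin n) => f i j) '' Set.Iio a)) := by
  have hrows : Set.range (Matrix.of fun (i : Fin a) (j : Fin n) => f i j).row =
      (fun i (j : Fin n) => f i j) '' Set.Iio a := by
    ext x
    constructor
    · rintro ⟨i, rfl⟩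
      exact ⟨i, i.2, rfl⟩
    · rintro ⟨i, hi, rfl⟩
      exact ⟨⟨i, hi⟩, rfl⟩
  rw [blockRank, Matrix.rank_eq_finrank_span_row, hrows]

/-- The second difference of the leading ranks at `(i, j)` is one: the rank profile matrix has a
one there. This makes sense without a rank profile matrix, and only involves the leading blocks
up to `(i, j)`. -/
def PivotAt (f : ℕ → ℕ → F) (i j : ℕ) : Prop :=
  blockRank f (i + 1) (j + 1) + blockRank f i j =
    blockRank f i (j + 1) + blockRank f (i + 1) j + 1

theorem pivotAt_swap {f : ℕ → ℕ → F} {i j : ℕ} :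
    PivotAt (fun i j => f j i) i j ↔ PivotAt f j i := by
  simp only [PivotAt, blockRank_swap, Nat.add_comm (blockRank f j (i + 1))]

/-- The positions `(ρ t, γ t)` are the ones of the rank profile matrix of the leading `m × n`
block: on distinct rows and columns, and each leading block has as many of them as its rank. -/
structure IsPivotFamily {τ : Type*} (f : ℕ → ℕ → F) (m n : ℕ) (ρ γ : τ → ℕ) : Prop where
  row_lt : ∀ t, ρ t < m
  col_lt : ∀ t, γ t < n
  row_injective : Function.Injective ρ
  col_injective : Function.Injective γ
  blockRank_eq : ∀ a ≤ m, ∀ b ≤ n, blockRank f a b = Nat.card {t // ρ t < a ∧ γ t < b}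

namespace IsPivotFamily

variable {τ : Type*} {f g : ℕ → ℕ → F} {m n : ℕ} {ρ γ : τ → ℕ}

theorem congr (hf : IsPivotFamily f m n ρ γ) (hfg : ∀ i < m, ∀ j < n, f i j = g i j) :
    IsPivotFamily g m n ρ γ where
  __ := hf
  blockRank_eq a ha b hb := by
    rw [← hf.blockRank_eq a ha b hb]
    exact (blockRank_congr fun i hi j hj => hfg i (by omega) j (by omega)).symm

theorem swap (hf : IsPivotFamily f m n ρ γ) :
    IsPivotFamily (fun i j => f j i) n m γ ρ where
  row_lt := hf.col_lt
  col_lt := hf.row_lt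
  row_injective := hf.col_injective
  col_injective := hf.row_injective
  blockRank_eq a ha b hb := by
    simp only [blockRank_swap, hf.blockRank_eq b hb a ha, and_comm]

theorem blockRank_rows (hf : IsPivotFamily f m n ρ γ) {a : ℕ} (ha : a ≤ m) :
    blockRank f a n = Nat.card {t // ρ t < a} := by
  simp only [hf.blockRank_eq a ha n le_rfl, hf.col_lt, and_true]

theorem blockRank_full (hf : IsPivotFamily f m n ρ γ) : blockRank f m n = Nat.card τ := by
  rw [hf.blockRank_rows le_rfl]
  exact Nat.card_congr (Equiv.subtypeUnivEquiv hf.row_lt)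

theorem blockRank_row_succ (hf : IsPivotFamily f m n ρ γ) {i : ℕ} (hi : i < m)
    (hne : i ∉ Set.range ρ) : blockRank f (i + 1) n = blockRank f i n := by
  rw [hf.blockRank_rows hi, hf.blockRank_rows hi.le]
  refine Nat.card_congr (Equiv.subtypeEquivRight fun t => ?_)
  have : ρ t ≠ i := fun h => hne ⟨t, h⟩
  omega

theorem of_echelon [Fintype τ] {c : ℕ → τ → F} {u : τ → ℕ → F} (row_lt : ∀ t, ρ t < m)
    (col_lt : ∀ t, γ t < n) (hρ : Function.Injective ρ) (hγ : Function.Injective γ)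
    (c_zero : ∀ i t, i < ρ t → c i t = 0) (c_ne_zero : ∀ t, c (ρ t) t ≠ 0)
    (u_zero : ∀ t j, j < γ t → u t j = 0) (u_ne_zero : ∀ t, u t (γ t) ≠ 0)
    (hf : ∀ i < m, ∀ j < n, f i j = ∑ t, c i t * u t j) : IsPivotFamily f m n ρ γ := by
  classical
  refine ⟨row_lt, col_lt, hρ, hγ, fun a ha b hb => ?_⟩
  let C : Matrix (Fin a) {t // ρ t < a ∧ γ t < b} F := Matrix.of fun i t => c i t
  let U : Matrix {t // ρ t < a ∧ γ t < b} (Fin b) F := Matrix.of fun t j => u t j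
  have hCU : (Matrix.of fun (i : Fin a) (j : Fin b) => f i j) = C * U := by
    ext i j
    simp only [Matrix.of_apply, Matrix.mul_apply, C, U, hf i (by omega) j (by omega)]
    rw [← Finset.sum_subtype (Finset.univ.filter fun t => ρ t < a ∧ γ t < b) (by simp)
      (fun t => c i t * u t j), Finset.sum_filter_of_ne]
    intro t _ ht
    by_contra hlt
    rw [not_and_or, not_lt, not_lt] at hlt
    rcases hlt with hlt | hlt
    · exact ht (by rw [c_zero _ _ (i.2.trans_le hlt), zero_mul])
    · exact ht (by rw [u_zero _ _ (j.2.trans_le hlt), mul_zero])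
  rw [blockRank, hCU, rank_mul_eq_card_of_injective, Nat.card_eq_fintype_card]
  · exact mulVec_injective_of_leading (ρ := fun t => (⟨ρ t.1, t.2.1⟩ : Fin a))
      (fun s t h => Subtype.ext (hρ (Fin.ext_iff.mp h))) (fun i t h => c_zero _ _ h)
      fun t => c_ne_zero _
  · exact mulVec_injective_of_leading (ρ := fun t => (⟨γ t.1, t.2.2⟩ : Fin b))
      (fun s t h => Subtype.ext (hγ (Fin.ext_iff.mp h))) (fun j t h => u_zero _ _ h)
      fun t => u_ne_zero _

open Classical in
theorem of_indicator [Finite τ] (row_lt : ∀ t, ρ t < m) (col_lt : ∀ t, γ t < n)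
    (hρ : Function.Injective ρ) (hγ : Function.Injective γ)
    (hf : ∀ i < m, ∀ j < n, f i j = if ∃ t, ρ t = i ∧ γ t = j then 1 else 0) :
    IsPivotFamily f m n ρ γ := by
  have := Fintype.ofFinite τ
  refine of_echelon (c := fun i t => if ρ t = i then 1 else 0)
    (u := fun t j => if γ t = j then 1 else 0) row_lt col_lt hρ hγ (fun i t h => if_neg h.ne')
    (fun t => by simp) (fun t j h => if_neg h.ne') (fun t => by simp) fun i hi j hj => ?_
  simp only [hf i hi j hj, ← ite_and, mul_ite, mul_one, mul_zero]
  by_cases h : ∃ t, ρ t = i ∧ γ t = j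
  · obtain ⟨t, rfl, rfl⟩ := h
    rw [if_pos ⟨t, rfl, rfl⟩, Finset.sum_eq_single t _ (by simp), if_pos ⟨rfl, rfl⟩]
    exact fun s _ hs => if_neg fun h => hs (hγ h.1)
  · rw [if_neg h]
    exact (Finset.sum_eq_zero fun t _ => if_neg fun ht => h ⟨t, ht.2, ht.1⟩).symm

theorem pivotAt_iff [Finite τ] (hf : IsPivotFamily f m n ρ γ) {i j : ℕ} (hi : i < m)
    (hj : j < n) : PivotAt f i j ↔ ∃ t, ρ t = i ∧ γ t = j := by
  classical
  have := Fintype.ofFinite τ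
  have hcount : ∀ a ≤ m, ∀ b ≤ n, blockRank f a b = ∑ t, if ρ t < a ∧ γ t < b then 1 else 0 := by
    intro a ha b hb
    rw [hf.blockRank_eq a ha b hb, Nat.card_eq_fintype_card, Fintype.card_subtype,
      Finset.card_filter]
  have hdiff : blockRank f (i + 1) (j + 1) + blockRank f i j =
      blockRank f i (j + 1) + blockRank f (i + 1) j +
        ∑ t, if ρ t = i ∧ γ t = j then 1 else 0 := by
    rw [hcount _ hi _ hj, hcount _ hi.le _ hj.le, hcount _ hi.le _ hj, hcount _ hi _ hj.le,
      ← Finset.sum_add_distrib, ← Finset.sum_add_distrib, ← Finset.sum_add_distrib]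
    refine Finset.sum_congr rfl fun t _ => ?_
    split_ifs <;> omega
  rw [PivotAt, hdiff, Nat.add_left_cancel_iff]
  constructor
  · intro h
    obtain ⟨t, -, ht⟩ := Finset.exists_ne_zero_of_sum_ne_zero (h.trans_ne one_ne_zero)
    exact ⟨t, by simpa using ht⟩
  · rintro ⟨t, rfl, rfl⟩
    rw [Finset.sum_eq_single t _ (by simp), if_pos ⟨rfl, rfl⟩]
    exact fun s _ hs => if_neg fun h => hs (hf.row_injective h.1)

theorem span_rows_eq (hf : IsPivotFamily f m n ρ γ) {a : ℕ} (ha : a ≤ m) :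
    Submodule.span F ((fun i (j : Fin n) => f i j) '' Set.Iio a) =
      Submodule.span F ((fun t (j : Fin n) => f (ρ t) j) '' {t | ρ t < a}) := by
  rw [span_image_Iio_eq_of_finrank_succ (S := Set.range ρ)]
  · rw [← Function.comp_def (fun i (j : Fin n) => f i j) ρ, Set.image_comp,
      Set.inter_comm, ← Set.image_preimage_eq_inter_range]
    rfl
  · intro i hi hne
    rw [← blockRank_eq_finrank_span, ← blockRank_eq_finrank_span,
      hf.blockRank_row_succ (hi.trans_le ha) hne]

theorem linearIndependent_rows [Finite τ] (hf : IsPivotFamily f m n ρ γ) :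
    LinearIndependent F (Matrix.of fun t (j : Fin n) => f (ρ t) j).row := by
  have := Fintype.ofFinite τ
  have huniv : {t | ρ t < m} = Set.univ := Set.eq_univ_of_forall hf.row_lt
  rw [linearIndependent_iff_card_eq_finrank_span, ← Nat.card_eq_fintype_card, ← hf.blockRank_full,
    blockRank_eq_finrank_span, hf.span_rows_eq le_rfl, huniv, Set.image_univ]
  rfl

theorem exists_row_combination [Fintype τ] (hf : IsPivotFamily f m n ρ γ) {i : ℕ} (hi : i < m) :
    ∃ w : τ → F, (∀ t, i < ρ t → w t = 0) ∧ ∀ j < n, f i j = ∑ t, w t * f (ρ t) j := by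
  have hmem : (fun j : Fin n => f i j) ∈
      Submodule.span F ((fun t (j : Fin n) => f (ρ t) j) '' {t | ρ t < i + 1}) := by
    rw [← hf.span_rows_eq hi]
    exact Submodule.subset_span ⟨i, Nat.lt_succ_self i, rfl⟩
  obtain ⟨w, hw, hsum⟩ := (Finsupp.mem_span_image_iff_linearCombination F).mp hmem
  refine ⟨w, fun t ht => ?_, fun j hj => ?_⟩
  · by_contra hne
    exact absurd (hw (Finsupp.mem_support_iff.mpr hne)) (by simpa using ht)
  · have h := congrFun hsum ⟨j, hj⟩
    rw [Finsupp.linearCombination_apply, Finsupp.sum_fintype _ _ (by simp)] at h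
    simpa using h.symm

end IsPivotFamily

section Elimination

variable {τ : Type*} [Fintype τ] {f h : ℕ → ℕ → F} {m d w : ℕ} {ρ γ : τ → ℕ}

theorem linearIndependent_row_left_of_mul {ι τ κ : Type*} [Finite ι] [Fintype τ]
    {X : Matrix ι τ F} {Y : Matrix τ κ F} (h : LinearIndependent F (X * Y).row) :
    LinearIndependent F X.row := by
  have := Fintype.ofFinite ι
  rw [← Matrix.vecMul_injective_iff] at h ⊢
  refine Function.Injective.of_comp (f := Y.vecMul) ?_
  simpa only [Function.comp_def, Matrix.vecMul_vecMul] using h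

theorem linearIndependent_row_right_of_mul {τ κ : Type*} [Fintype τ] {X : Matrix τ τ F}
    {Y : Matrix τ κ F} (h : LinearIndependent F (X * Y).row) : LinearIndependent F Y.row := by
  have hX := Matrix.vecMul_injective_iff.mpr (linearIndependent_row_left_of_mul h)
  have hsurj : Function.Surjective X.vecMul :=
    LinearMap.injective_iff_surjective (f := X.vecMulLinear).mp hX
  rw [← Matrix.vecMul_injective_iff] at h ⊢
  refine Function.Injective.of_comp_right (g := X.vecMul) ?_ hsurj
  simpa only [Function.comp_def, Matrix.vecMul_vecMul] using h

/-- The pivot rows determine `X` through `Y`, so the combination that produces the row `i` of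
`X * Y` from the pivot rows produces the row `i` of `X`. -/
theorem IsPivotFamily.exists_combination_of_mul (hf : IsPivotFamily f m d ρ γ)
    {X : Matrix (Fin m) τ F} {Y : Matrix τ (Fin d) F}
    (hXY : ∀ (i : Fin m) (j : Fin d), f i j = (X * Y) i j) (i : Fin m) :
    ∃ w : τ → F, (∀ t, i < ρ t → w t = 0) ∧ (∀ j : Fin d, f i j = ∑ t, w t * f (ρ t) j) ∧
      ∀ t, X i t = ∑ s, w s * X ⟨ρ s, hf.row_lt s⟩ t := by
  obtain ⟨w, hw, hcomb⟩ := hf.exists_row_combination i.2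
  refine ⟨w, hw, fun j => hcomb j j.2, congrFun ?_⟩
  let Xρ : Matrix τ τ F := X.submatrix (fun s => ⟨ρ s, hf.row_lt s⟩) id
  have hpivot : (Matrix.of fun s (j : Fin d) => f (ρ s) j) = Xρ * Y :=
    Matrix.ext fun s j => hXY ⟨ρ s, hf.row_lt s⟩ j
  have hY := linearIndependent_row_right_of_mul (hpivot ▸ hf.linearIndependent_rows)
  refine Matrix.vecMul_injective_iff.mpr hY (?_ : Matrix.vecMul (X i) Y =
    Matrix.vecMul (Matrix.vecMul w Xρ) Y)
  rw [Matrix.vecMul_vecMul, ← hpivot]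
  exact funext fun j => (hXY i j).symm.trans (hcomb j j.2)

theorem IsPivotFamily.blockRank_add_of_combination (hf : IsPivotFamily f m d ρ γ)
    {C : Matrix (Fin m) τ F} (hC : ∀ (i : Fin m) t, i < ρ t → C i t = 0)
    (hleft : ∀ (i : Fin m) (j : Fin d), f i j = ∑ t, C i t * f (ρ t) j)
    (hright : ∀ (i : Fin m) (j : Fin w), f i (d + j) = ∑ t, C i t * f (ρ t) (d + j) + h i j) :
    ∀ a ≤ m, ∀ b ≤ w, blockRank f a (d + b) = blockRank f a d + blockRank h a b := by
  classical
  intro a ha b hb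
  let A : Matrix (Fin a) (Fin d) F := Matrix.of fun i j => f i j
  let B : Matrix (Fin a) (Fin b) F := Matrix.of fun i j => f i (d + j)
  let g : {t // ρ t < a} → Fin a := fun t => ⟨ρ t, t.2⟩
  have hcols : blockRank f a (d + b) = (Matrix.fromCols A B).rank := by
    rw [blockRank, ← Matrix.rank_submatrix _ (Equiv.refl _) (finSumFinEquiv (m := d) (n := b))]
    congr 1
    ext i (j | j) <;> simp [A, B]
  have hsum (i : Fin a) (j : ℕ) : ∑ t, C (i.castLE ha) t * f (ρ t) j =
      ∑ t : {t // ρ t < a}, C (i.castLE ha) t * f (ρ t) j := by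
    rw [← Finset.sum_subtype (Finset.univ.filter fun t => ρ t < a) (by simp)
      (fun t => C (i.castLE ha) t * f (ρ t) j), Finset.sum_filter_of_ne]
    intro t _ ht
    by_contra hlt
    exact ht (by rw [hC _ t (i.2.trans_le (not_lt.mp hlt)), zero_mul])
  rw [hcols, rank_fromCols_eq_card_add_rank (H := Matrix.of fun (i : Fin a) (j : Fin b) => h i j)
    (C := C.submatrix (Fin.castLE ha) Subtype.val) (g := g), hf.blockRank_rows ha,
    Nat.card_eq_fintype_card, blockRank]
  · exact Matrix.ext fun i j => (hleft (i.castLE ha) j).trans (hsum i j)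
  · ext i j
    exact (hright (i.castLE ha) (j.castLE hb)).trans (congrArg (· + h i j) (hsum i _))
  · exact hf.linearIndependent_rows.comp (fun t : {t // ρ t < a} => t.1) Subtype.val_injective

theorem IsPivotFamily.blockRank_add (hf : IsPivotFamily f m d ρ γ)
    {X : Matrix (Fin m) τ F} {Y : Matrix τ (Fin d) F} {E : Matrix τ (Fin w) F}
    (hXY : ∀ (i : Fin m) (j : Fin d), f i j = (X * Y) i j)
    (hE : ∀ (s : τ) (j : Fin w), (X * E) ⟨ρ s, hf.row_lt s⟩ j = f (ρ s) (d + j))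
    (hh : ∀ (i : Fin m) (j : Fin w), h i j = f i (d + j) - (X * E) i j) :
    ∀ a ≤ m, ∀ b ≤ w, blockRank f a (d + b) = blockRank f a d + blockRank h a b := by
  choose C hC hleft hX using hf.exists_combination_of_mul hXY
  refine hf.blockRank_add_of_combination hC hleft fun i j => ?_
  suffices hrow : ∑ s, C i s * f (ρ s) (d + j) = (X * E) i j by
    rw [hrow, hh, add_sub_cancel]
  calc ∑ s, C i s * f (ρ s) (d + j)
      = ∑ s, ∑ t, C i s * X ⟨ρ s, hf.row_lt s⟩ t * E t j :=
        Finset.sum_congr rfl fun s _ => by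
          simp only [← hE s j, Matrix.mul_apply, Finset.mul_sum, mul_assoc]
    _ = (X * E) i j := by
        rw [Finset.sum_comm, Matrix.mul_apply]
        exact Finset.sum_congr rfl fun t _ => by rw [hX i t, Finset.sum_mul]

theorem pivotAt_add_right (hfh : ∀ a ≤ m, ∀ b ≤ w,
    blockRank f a (d + b) = blockRank f a d + blockRank h a b) {i j : ℕ} (hi : i < m)
    (hj : j < w) : PivotAt f i (d + j) ↔ PivotAt h i j := by
  rw [PivotAt, PivotAt, add_assoc d j 1, hfh (i + 1) hi (j + 1) hj, hfh i hi.le j hj.le,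
    hfh i hi.le (j + 1) hj, hfh (i + 1) hi j hj.le]
  omega

end Elimination

end BlockRank

/-- A matrix as a doubly infinite array, with zeros outside, so that `blockRank` applies. -/
def extendZero {R : Type*} [Zero R] {m n : ℕ} (A : Matrix (Fin m) (Fin n) R) : ℕ → ℕ → R :=
  fun i j => if h : i < m ∧ j < n then A ⟨i, h.1⟩ ⟨j, h.2⟩ else 0

theorem extendZero_apply {R : Type*} [Zero R] {m n : ℕ} (A : Matrix (Fin m) (Fin n) R) {i j : ℕ}
    (hi : i < m) (hj : j < n) : extendZero A i j = A ⟨i, hi⟩ ⟨j, hj⟩ := dif_pos ⟨hi, hj⟩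

section RankProfileMatrix

variable {F : Type*} [Field F] {m n : ℕ} {τ : Type*}

theorem leadingRank_eq_blockRank (A : Matrix (Fin m) (Fin n) F) {a b : ℕ} (ha : a ≤ m)
    (hb : b ≤ n) : leadingRank A a b = blockRank (extendZero A) a b := by
  rw [leadingRank, blockRank, ← Matrix.rank_submatrix _ (Fin.castLEquiv ha) (Fin.castLEquiv hb)]
  congr 1
  ext i j
  exact (extendZero_apply A _ _).symm

theorem rank_eq_blockRank (A : Matrix (Fin m) (Fin n) F) :
    A.rank = blockRank (extendZero A) m n :=
  congrArg Matrix.rank (Matrix.ext fun i j => (extendZero_apply A i.2 j.2).symm)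

namespace IsRankProfileMatrix

variable {A R R' : Matrix (Fin m) (Fin n) F}

open Classical in
theorem isPivotFamily_of_apply_eq [Finite τ] (h : IsRankProfileMatrix A R) {ρ : τ → Fin m}
    {γ : τ → Fin n} (hρ : Function.Injective ρ) (hγ : Function.Injective γ)
    (hR : ∀ i j, R i j = if ∃ t, ρ t = i ∧ γ t = j then 1 else 0) :
    IsPivotFamily (extendZero A) m n (fun t => (ρ t : ℕ)) fun t => (γ t : ℕ) := by
  have hpivots : IsPivotFamily (extendZero R) m n (fun t => (ρ t : ℕ)) fun t => (γ t : ℕ) :=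
    .of_indicator (fun t => (ρ t).2) (fun t => (γ t).2) (Fin.val_injective.comp hρ)
      (Fin.val_injective.comp hγ) fun i hi j hj => by
        simp only [extendZero_apply R hi hj, hR, Fin.ext_iff]
  refine { hpivots with blockRank_eq := fun a ha b hb => ?_ }
  rw [← leadingRank_eq_blockRank A ha hb, ← h.leading_eq a b ha hb,
    leadingRank_eq_blockRank R ha hb, hpivots.blockRank_eq a ha b hb]

theorem ne_zero_iff (h : IsRankProfileMatrix A R) (i : Fin m) (j : Fin n) :
    R i j ≠ 0 ↔ PivotAt (extendZero A) i j := by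
  classical
  let row : {p : Fin m × Fin n // R p.1 p.2 ≠ 0} → Fin m := fun p => p.1.1
  let col : {p : Fin m × Fin n // R p.1 p.2 ≠ 0} → Fin n := fun p => p.1.2
  have hrow : Function.Injective row := by
    rintro ⟨⟨i, j⟩, hp⟩ ⟨⟨i', j'⟩, hq⟩ (rfl : i = i')
    obtain rfl := h.distinct_cols _ _ _ hp hq
    rfl
  have hcol : Function.Injective col := by
    rintro ⟨⟨i, j⟩, hp⟩ ⟨⟨i', j'⟩, hq⟩ (rfl : j = j')
    obtain rfl := h.distinct_rows _ _ _ hp hq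
    rfl
  have hpivots := h.isPivotFamily_of_apply_eq hrow hcol fun i j => by
    split_ifs with hex
    · obtain ⟨⟨p, hp⟩, rfl, rfl⟩ := hex
      exact (h.zero_or_one _ _).resolve_left hp
    · by_contra hne
      exact hex ⟨⟨(i, j), hne⟩, rfl, rfl⟩
  rw [hpivots.pivotAt_iff i.2 j.2]
  constructor
  · exact fun hR => ⟨⟨(i, j), hR⟩, rfl, rfl⟩
  · rintro ⟨⟨p, hp⟩, hi, hj⟩
    obtain rfl := Fin.ext hi
    obtain rfl := Fin.ext hj
    exact hp

open Classical in
theorem apply_eq (h : IsRankProfileMatrix A R) (i : Fin m) (j : Fin n) :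
    R i j = if PivotAt (extendZero A) i j then 1 else 0 := by
  split_ifs with hp
  · exact (h.zero_or_one i j).resolve_left ((h.ne_zero_iff i j).mpr hp)
  · exact not_not.mp fun hR => hp ((h.ne_zero_iff i j).mp hR)

theorem unique (h : IsRankProfileMatrix A R) (h' : IsRankProfileMatrix A R') : R' = R := by
  ext i j
  rw [h.apply_eq, h'.apply_eq]

end IsRankProfileMatrix

open Classical in
theorem IsPivotFamily.isRankProfileMatrix [Finite τ] {A R : Matrix (Fin m) (Fin n) F}
    {ρ γ : τ → ℕ} (hA : IsPivotFamily (extendZero A) m n ρ γ)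
    (hR : ∀ (i : Fin m) (j : Fin n), R i j = if ∃ t, ρ t = i ∧ γ t = j then 1 else 0) :
    IsRankProfileMatrix A R := by
  have hpivots : IsPivotFamily (extendZero R) m n ρ γ :=
    .of_indicator hA.row_lt hA.col_lt hA.row_injective hA.col_injective fun i hi j hj => by
      rw [extendZero_apply R hi hj, hR]
  have hne (i : Fin m) (j : Fin n) : R i j ≠ 0 ↔ ∃ t, ρ t = i ∧ γ t = j := by
    simp [hR]
  refine ⟨fun i j => ?_, fun i j j' h h' => ?_, fun i i' j h h' => ?_, ?_, fun a b ha hb => ?_⟩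
  · rw [hR]
    split_ifs <;> simp
  · obtain ⟨t, ht, htj⟩ := (hne i j).mp h
    obtain ⟨s, hs, hsj⟩ := (hne i j').mp h'
    obtain rfl := hA.row_injective (ht.trans hs.symm)
    exact Fin.ext (htj.symm.trans hsj)
  · obtain ⟨t, hti, ht⟩ := (hne i j).mp h
    obtain ⟨s, hsi, hs⟩ := (hne i' j).mp h'
    obtain rfl := hA.col_injective (ht.trans hs.symm)
    exact Fin.ext (hti.symm.trans hsi)
  · have hsupport : {p : Fin m × Fin n | R p.1 p.2 ≠ 0} =
        Set.range fun t => ((⟨ρ t, hA.row_lt t⟩, ⟨γ t, hA.col_lt t⟩) : Fin m × Fin n) := by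
      ext ⟨i, j⟩
      simp [hne, Fin.ext_iff]
    rw [hsupport, rank_eq_blockRank, hA.blockRank_full, ← Nat.card_coe_set_eq]
    exact Nat.card_range_of_injective fun s t hst =>
      hA.row_injective (Fin.ext_iff.mp (Prod.ext_iff.mp hst).1)
  · rw [leadingRank_eq_blockRank R ha hb, leadingRank_eq_blockRank A ha hb,
      hpivots.blockRank_eq a ha b hb, hA.blockRank_eq a ha b hb]

theorem permMatrix_mul_mul_permMatrix_apply (P : Equiv.Perm (Fin m)) (M : Matrix (Fin m) (Fin n) F)
    (Q : Equiv.Perm (Fin n)) (i : Fin m) (j : Fin n) :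
    (P.permMatrix F * M * Q.permMatrix F) i j = M (P i) (Q.symm j) := by
  rw [PEquiv.mul_toMatrix_toPEquiv, PEquiv.toMatrix_toPEquiv_mul]
  rfl

theorem permMatrix_mul_idBlock_mul_permMatrix_apply {r : ℕ} (hm : r ≤ m) (hn : r ≤ n)
    (P : Equiv.Perm (Fin m)) (Q : Equiv.Perm (Fin n)) (i : Fin m) (j : Fin n) :
    (P.permMatrix F * idBlock F m n r * Q.permMatrix F) i j =
      if ∃ t : Fin r, P.symm (t.castLE hm) = i ∧ Q (t.castLE hn) = j then 1 else 0 := by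
  rw [permMatrix_mul_mul_permMatrix_apply, idBlock, Matrix.of_apply]
  refine if_congr ?_ rfl rfl
  simp only [Equiv.symm_apply_eq, ← Equiv.eq_symm_apply Q, Fin.ext_iff, Fin.val_castLE]
  constructor
  · exact fun ⟨hij, hr⟩ => ⟨⟨P i, hr⟩, rfl, hij⟩
  · exact fun ⟨t, hi, hj⟩ => ⟨hi.symm.trans hj, hi ▸ t.2⟩

end RankProfileMatrix

namespace PLUQ

section

variable {m n : ℕ} (f : PLUQ m n)

/-- The row of the `t`-th one of the rank profile matrix that `P` and `Q` reveal. -/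
def pivotRow (t : Fin f.r) : Fin m := f.P.symm (t.castLE f.r_le_rows)

/-- The column of the `t`-th one of the rank profile matrix that `P` and `Q` reveal. -/
def pivotCol (t : Fin f.r) : Fin n := f.Q (t.castLE f.r_le_cols)

theorem pivotRow_injective : Function.Injective f.pivotRow :=
  f.P.symm.injective.comp (Fin.castLE_injective f.r_le_rows)

theorem pivotCol_injective : Function.Injective f.pivotCol :=
  f.Q.injective.comp (Fin.castLE_injective f.r_le_cols)

/-- The rank profile matrix in compact form, as LT-RPM returns it. -/
def pivots : List (ℕ × ℕ) := List.ofFn fun t => ((f.pivotRow t : ℕ), (f.pivotCol t : ℕ))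

theorem nodup_pivots : f.pivots.Nodup :=
  List.nodup_ofFn.mpr fun _ _ h => f.pivotRow_injective (Fin.ext (Prod.ext_iff.mp h).1)

end

namespace Decomposes

variable {F : Type u} [Field F] {m n : ℕ} {f : PLUQ m n} {μ : List F}
  {A : Matrix (Fin m) (Fin n) F}

theorem isPivotFamily (h : f.Decomposes μ A) :
    IsPivotFamily (extendZero A) m n (fun t => (f.pivotRow t : ℕ)) fun t => (f.pivotCol t : ℕ) :=
  h.reveals.isPivotFamily_of_apply_eq f.pivotRow_injective f.pivotCol_injective fun i j => by
    convert permMatrix_mul_idBlock_mul_permMatrix_apply f.r_le_rows f.r_le_cols f.P f.Q i j <;> rfl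

theorem apply_eq (h : f.Decomposes μ A) (i : Fin m) (j : Fin n) :
    A i j = ∑ t, f.L.load μ (f.P i) t * f.U.load μ t (f.Q.symm j) := by
  conv_lhs => rw [h.eq_mul]
  rw [Matrix.mul_assoc (f.P.permMatrix F), permMatrix_mul_mul_permMatrix_apply, Matrix.mul_apply]

/-- The columns of the pivots are independent, so the triangular block of `U` that they select is
invertible. -/
theorem U_diag_ne_zero (h : f.Decomposes μ A) (t : Fin f.r) :
    f.U.load μ t (t.castLE f.r_le_cols) ≠ 0 := by
  let T : Matrix (Fin f.r) (Fin f.r) F := (f.U.load μ).submatrix id (Fin.castLE f.r_le_cols)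
  have hfactor : (Matrix.of fun t (i : Fin m) => extendZero A i (f.pivotCol t)) =
      T.transpose * ((f.L.load μ).submatrix f.P id).transpose := by
    ext t i
    rw [Matrix.of_apply, extendZero_apply A i.2 (f.pivotCol t).2, h.apply_eq, Matrix.mul_apply]
    simp [T, pivotCol, mul_comm]
  have hunit : IsUnit T.transpose := Matrix.linearIndependent_rows_iff_isUnit.mp
    (linearIndependent_row_left_of_mul (hfactor ▸ h.isPivotFamily.swap.linearIndependent_rows))
  have hdet : T.det ≠ 0 := by
    rw [← Matrix.det_transpose]
    exact ((Matrix.isUnit_iff_isUnit_det _).mp hunit).ne_zero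
  have hT : T.IsUpperTriangular := fun i j hij => h.U_lower _ _ hij
  rw [Matrix.det_of_isUpperTriangular hT, Finset.prod_ne_zero_iff] at hdet
  exact hdet t (Finset.mem_univ t)

variable {w : ℕ} {a : ℕ → ℕ → F}

theorem isPivotFamily_of_eq (h : f.Decomposes μ A) (ha : ∀ i j, A i j = a i j) :
    IsPivotFamily a m n (fun t => (f.pivotRow t : ℕ)) fun t => (f.pivotCol t : ℕ) :=
  h.isPivotFamily.congr fun i hi j hj => by rw [extendZero_apply A hi hj, ha]

theorem blockRank_add_right (h : f.Decomposes μ A) (ha : ∀ i j, A i j = a i j)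
    {D : Matrix (Fin f.r) (Fin w) F} {H : Matrix (Fin m) (Fin w) F}
    (hD : ∀ s j, ∑ t, f.L.load μ (s.castLE f.r_le_rows) t * D t j = a (f.pivotRow s) (n + j))
    (hH : ∀ i j, H i j = a i (n + j) - ∑ t, f.L.load μ (f.P i) t * D t j) :
    ∀ p ≤ m, ∀ q ≤ w, blockRank a p (n + q) = blockRank a p n + blockRank (extendZero H) p q := by
  refine (h.isPivotFamily_of_eq ha).blockRank_add (X := (f.L.load μ).submatrix f.P id)
    (Y := (f.U.load μ).submatrix id f.Q.symm) (E := D) (fun i j => ?_) (fun s j => ?_)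
    fun i j => ?_
  · exact (ha i j).symm.trans (h.apply_eq i j)
  · rw [← hD, Matrix.mul_apply]
    simp [pivotRow]
  · rw [extendZero_apply H i.2 j.2, hH]
    rfl

theorem blockRank_add_below (h : f.Decomposes μ A) (ha : ∀ i j, A i j = a i j)
    {E : Matrix (Fin w) (Fin f.r) F} {I : Matrix (Fin w) (Fin n) F}
    (hE : ∀ i s, ∑ t, E i t * f.U.load μ t (s.castLE f.r_le_cols) = a (m + i) (f.pivotCol s))
    (hI : ∀ i j, I i j = a (m + i) j - ∑ t, E i t * f.U.load μ t (f.Q.symm j)) :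
    ∀ p ≤ w, ∀ q ≤ n, blockRank a (m + p) q = blockRank a m q + blockRank (extendZero I) p q := by
  intro p hp q hq
  rw [← blockRank_swap a, ← blockRank_swap a, ← blockRank_swap (extendZero I)]
  refine (h.isPivotFamily_of_eq ha).swap.blockRank_add
    (X := ((f.U.load μ).submatrix id f.Q.symm).transpose)
    (Y := ((f.L.load μ).submatrix f.P id).transpose) (E := E.transpose) (fun j i => ?_)
    (fun s i => ?_) (fun j i => ?_) q hq p hp
  · rw [← ha i j, h.apply_eq, ← Matrix.transpose_mul]
    rfl
  · rw [← hE, ← Matrix.transpose_mul, Matrix.transpose_apply, Matrix.mul_apply]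
    simp [pivotCol]
  · rw [extendZero_apply I i.2 j.2, hI, ← Matrix.transpose_mul]
    rfl

theorem mem_pivots_iff (h : f.Decomposes μ A) (ha : ∀ i j, A i j = a i j) (p : ℕ × ℕ) :
    p ∈ f.pivots ↔ p.1 < m ∧ p.2 < n ∧ PivotAt a p.1 p.2 := by
  obtain ⟨i, j⟩ := p
  have hfamily := h.isPivotFamily_of_eq ha
  simp only [pivots, List.mem_ofFn, Prod.mk.injEq]
  constructor
  · rintro ⟨t, rfl, rfl⟩
    exact ⟨hfamily.row_lt t, hfamily.col_lt t,
      (hfamily.pivotAt_iff (hfamily.row_lt t) (hfamily.col_lt t)).mpr ⟨t, rfl, rfl⟩⟩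
  · exact fun ⟨hi, hj, hij⟩ => (hfamily.pivotAt_iff hi hj).mp hij

end Decomposes

end PLUQ

/-! ## Running programs -/

namespace Prog

theorem getElem?_of_prefix {F : Type u} {μ ν : List F} (h : μ <+: ν) {i : ℕ} {x : F}
    (hx : μ[i]? = some x) : ν[i]? = some x := by
  obtain ⟨τ, rfl⟩ := h
  rw [List.getElem?_append_left (List.getElem?_eq_some_iff.mp hx).1, hx]

variable {k F : Type u} [Field k] [Field F] [Algebra k F] {α β : Type}

theorem exec_bind (p : Prog k α) (f : α → Prog k β) (μ : List F) :
    (p >>= f).exec μ = (f (p.val μ)).exec (p.mem μ) := by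
  change (p.bind f).exec μ = _
  unfold val mem
  induction p generalizing μ with
  | ret _ => rfl
  | lit c _ ih => exact ih _ _
  | op o x y _ ih => exact ih _ _
  | test x _ ih => exact ih _ _

theorem cost_bind (p : Prog k α) (f : α → Prog k β) (μ : List F) :
    (p >>= f).cost μ = p.cost μ + (f (p.val μ)).cost (p.mem μ) := by
  change (p.bind f).cost μ = _
  unfold val mem
  induction p generalizing μ with
  | ret _ => exact (Nat.zero_add _).symm
  | lit c _ ih => exact ih _ _
  | op o x y _ ih =>
    simp only [bind, cost, exec]
    rw [ih]
    omega
  | test x _ ih =>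
    simp only [bind, cost, exec]
    rw [ih]
    omega

theorem prefix_mem (p : Prog k α) (μ : List F) : μ <+: p.mem μ := by
  unfold mem
  induction p generalizing μ with
  | ret _ => exact List.prefix_rfl
  | lit c _ ih => exact (List.prefix_append _ _).trans (ih _ _)
  | op o x y _ ih => exact (List.prefix_append _ _).trans (ih _ _)
  | test x _ ih => exact ih _ _

/-- Hoare triple: the outcome, the final memory and the cost of the run of `p` on `μ` satisfy `Q`.
Runs only extend the memory, so a property of stored values survives later runs. -/
def Runs (p : Prog k α) (μ : List F) (Q : α → List F → ℕ → Prop) : Prop :=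
  Q (p.val μ) (p.mem μ) (p.cost μ)

theorem Runs.mono {p : Prog k α} {μ : List F} {Q Q' : α → List F → ℕ → Prop} (h : p.Runs μ Q)
    (hQ : ∀ a ν c, μ <+: ν → Q a ν c → Q' a ν c) : p.Runs μ Q' :=
  hQ _ _ _ (p.prefix_mem μ) h

theorem runs_pure {a : α} {μ : List F} {Q : α → List F → ℕ → Prop} (h : Q a μ 0) :
    (pure a : Prog k α).Runs μ Q := h

theorem Runs.bind {p : Prog k α} {f : α → Prog k β} {μ : List F} {Q : α → List F → ℕ → Prop}
    {Q' : β → List F → ℕ → Prop} (h : p.Runs μ Q)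
    (hf : ∀ a ν c, μ <+: ν → Q a ν c → (f a).Runs ν fun b ν' c' => Q' b ν' (c + c')) :
    (p >>= f).Runs μ Q' := by
  have := hf _ _ _ (p.prefix_mem μ) h
  unfold Runs at this ⊢
  rw [cost_bind]
  unfold val mem at this ⊢
  rw [exec_bind]
  exact this

theorem runs_const (c : k) (μ : List F) :
    (const c).Runs μ fun a ν t => ν[a]? = some (algebraMap k F c) ∧ t = 0 :=
  ⟨List.getElem?_concat_length, rfl⟩

theorem runs_op (o : FieldOp) {μ : List F} {x y : ℕ} {a b : F} (hx : μ[x]? = some a)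
    (hy : μ[y]? = some b) :
    (op o x y pure : Prog k ℕ).Runs μ fun z ν t => ν[z]? = some (o.eval a b) ∧ t = 1 := by
  have : o.eval a b = o.eval (μ.getD x 0) (μ.getD y 0) := by
    rw [List.getD_eq_getElem?_getD, List.getD_eq_getElem?_getD, hx, hy]
    rfl
  rw [this]
  exact ⟨List.getElem?_concat_length, rfl⟩

/-- Run `p 0, …, p (n - 1)` in turn and collect the results (`default` outside the range). -/
def forRange [Inhabited α] (p : ℕ → Prog k α) : ℕ → Prog k (ℕ → α)
  | 0 => pure default
  | n + 1 => do
    let g ← forRange p n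
    let x ← p n
    pure (Function.update g n x)

theorem runs_forRange [Inhabited α] {p : ℕ → Prog k α} {n : ℕ} {μ : List F} {b : ℝ}
    (Q : ℕ → α → List F → Prop) (hQ : ∀ i a μ ν, μ <+: ν → Q i a μ → Q i a ν)
    (hp : ∀ i < n, ∀ ν, μ <+: ν → (p i).Runs ν fun a ν' c => Q i a ν' ∧ (c : ℝ) ≤ b) :
    (forRange p n).Runs μ fun g ν c => (∀ i < n, Q i (g i) ν) ∧ (c : ℝ) ≤ n * b := by
  induction n with
  | zero => exact runs_pure (by simp)
  | succ n ih =>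
    refine (ih fun i hi => hp i (by omega)).bind fun g ν c hν hg => ?_
    refine (hp n (by omega) ν hν).bind fun x ν' c' hν' hx => runs_pure ⟨fun i hi => ?_, ?_⟩
    · by_cases hin : i = n
      · subst hin
        rw [Function.update_self]
        exact hx.1
      · rw [Function.update_of_ne hin]
        exact hQ _ _ _ _ hν' (hg.1 i (by omega))
    · push_cast
      linarith [hg.2, hx.2]

theorem runs_forRange_forRange [Inhabited α] {p : ℕ → ℕ → Prog k α} {m n : ℕ} {μ : List F}
    {b : ℝ} (Q : ℕ → ℕ → α → List F → Prop)
    (hQ : ∀ i j a μ ν, μ <+: ν → Q i j a μ → Q i j a ν)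
    (hp : ∀ i < m, ∀ j < n, ∀ ν, μ <+: ν →
      (p i j).Runs ν fun a ν' c => Q i j a ν' ∧ (c : ℝ) ≤ b) :
    (forRange (fun i => forRange (p i) n) m).Runs μ fun g ν c =>
      (∀ i < m, ∀ j < n, Q i j (g i j) ν) ∧ (c : ℝ) ≤ m * (n * b) :=
  runs_forRange (fun i (g : ℕ → α) ν => ∀ j < n, Q i j (g j) ν)
    (fun i _ _ _ hν h j hj => hQ i j _ _ _ hν (h j hj)) fun i hi _ hν =>
      runs_forRange (Q i) (hQ i) fun j hj _ hν' => hp i hi j hj _ (hν.trans hν')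

end Prog

/-- The cells with addresses `f i j`, for `i < m` and `j < n`, exist and hold `a i j`. -/
def Stores {F : Type u} (μ : List F) (m n : ℕ) (f : ℕ → ℕ → ℕ) (a : ℕ → ℕ → F) : Prop :=
  ∀ i < m, ∀ j < n, μ[f i j]? = some (a i j)

theorem Stores.mono {F : Type u} {μ ν : List F} {m n : ℕ} {f : ℕ → ℕ → ℕ}
    {a : ℕ → ℕ → F} (h : Stores μ m n f a) (hν : μ <+: ν) : Stores ν m n f a :=
  fun i hi j hj => Prog.getElem?_of_prefix hν (h i hi j hj)

namespace AddrMatrix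

/-- The cells with addresses `X` exist and hold the entries of `A`. -/
def Holds {F : Type u} {m n : ℕ} (X : AddrMatrix m n) (μ : List F)
    (A : Matrix (Fin m) (Fin n) F) : Prop :=
  ∀ i j, μ[X i j]? = some (A i j)

variable {F : Type u} {m n : ℕ} {X : AddrMatrix m n} {μ ν : List F} {A : Matrix (Fin m) (Fin n) F}

theorem Holds.mono (h : X.Holds μ A) (hν : μ <+: ν) : X.Holds ν A :=
  fun i j => Prog.getElem?_of_prefix hν (h i j)

theorem Holds.submatrix {m' n' : ℕ} (h : X.Holds μ A) (ρ : Fin m' → Fin m) (γ : Fin n' → Fin n) :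
    Holds (X.submatrix ρ γ) μ (A.submatrix ρ γ) :=
  fun i j => h (ρ i) (γ j)

theorem holds_iff [Field F] : X.Holds μ A ↔ X.Valid μ ∧ X.load μ = A := by
  constructor
  · refine fun h => ⟨fun i j => (List.getElem?_eq_some_iff.mp (h i j)).1, ?_⟩
    ext i j
    simp [load, List.getD_eq_getElem?_getD, h i j]
  · rintro ⟨h, rfl⟩ i j
    rw [List.getElem?_eq_getElem (h i j)]
    simp [load, List.getD_eq_getElem?_getD, h i j]

theorem Valid.holds_load [Field F] (h : X.Valid μ) : X.Holds μ (X.load μ) :=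
  holds_iff.mpr ⟨h, rfl⟩

end AddrMatrix

/-! ## Products and triangular systems from fast matrix multiplication -/

/-- `mm` multiplies `n × n` matrices in at most `C * n ^ ω` operations, over every field containing
`k`; `MatMulExponent k ω` asks for some such `C` and `mm`. -/
def IsMatMul {k : Type u} [Field k] (ω C : ℝ)
    (mm : ∀ n : ℕ, AddrMatrix n n → AddrMatrix n n → Prog k (AddrMatrix n n)) : Prop :=
  ∀ (F : Type u) [Field F] [Algebra k F] (n : ℕ) (X Y : AddrMatrix n n) (μ : List F),
    X.Valid μ → Y.Valid μ →
      ((mm n X Y).val μ).Valid ((mm n X Y).mem μ) ∧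
      ((mm n X Y).val μ).load ((mm n X Y).mem μ) = X.load μ * Y.load μ ∧
      ((mm n X Y).cost μ : ℝ) ≤ C * (n : ℝ) ^ ω

namespace IsMatMul

variable {k : Type u} [Field k] {ω C : ℝ} {F : Type u} [Field F] [Algebra k F]
  {mm : ∀ n : ℕ, AddrMatrix n n → AddrMatrix n n → Prog k (AddrMatrix n n)}

theorem runs (h : IsMatMul ω C mm) {n : ℕ} {X Y : AddrMatrix n n}
    {x y : Matrix (Fin n) (Fin n) F} {μ : List F} (hX : X.Holds μ x) (hY : Y.Holds μ y) :
    (mm n X Y).Runs μ fun Z ν c => Z.Holds ν (x * y) ∧ (c : ℝ) ≤ C * (n : ℝ) ^ ω := by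
  obtain ⟨hXvalid, rfl⟩ := AddrMatrix.holds_iff.mp hX
  obtain ⟨hYvalid, rfl⟩ := AddrMatrix.holds_iff.mp hY
  obtain ⟨hvalid, hload, hcost⟩ := h F n X Y μ hXvalid hYvalid
  exact ⟨AddrMatrix.holds_iff.mpr ⟨hvalid, hload⟩, hcost⟩

theorem nonneg (h : IsMatMul ω C mm) : 0 ≤ C := by
  have hcost := (h k 1 (fun _ _ => 0) (fun _ _ => 0) [0] (fun _ _ => by simp)
    (fun _ _ => by simp)).2.2
  simp only [Nat.cast_one, Real.one_rpow, mul_one] at hcost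
  exact (Nat.cast_nonneg _).trans hcost

end IsMatMul

section

variable {k : Type u} [Field k]
  (mm : ∀ n : ℕ, AddrMatrix n n → AddrMatrix n n → Prog k (AddrMatrix n n))

/-- The block `(p, q)` of order `r` of the product of an `m × r` and an `r × n` matrix.  Blocks may
stick out of the product; the address `z` of a zero pads the missing entries. -/
def productBlock (m r n : ℕ) (X Y : ℕ → ℕ → ℕ) (z p q : ℕ) : Prog k (ℕ → ℕ → ℕ) := do
  let T ← mm r (fun i j => if p * r + i < m then X (p * r + i) j else z)
    (fun i j => if q * r + j < n then Y i (q * r + j) else z)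
  pure fun i j => if h : i < r ∧ j < r then T ⟨i, h.1⟩ ⟨j, h.2⟩ else z

/-- The product of an `m × r` and an `r × n` matrix, by blocks of order `r`. -/
def blockMul (m r n : ℕ) (X Y : ℕ → ℕ → ℕ) : Prog k (ℕ → ℕ → ℕ) := do
  let z ← Prog.const 0
  let T ← Prog.forRange
    (fun p => Prog.forRange (fun q => productBlock mm m r n X Y z p q) (n / r + 1)) (m / r + 1)
  pure fun i j => T (i / r) (j / r) (i % r) (j % r)

/-- The entrywise difference of two `m × n` matrices. -/
def subEntries (m n : ℕ) (B T : ℕ → ℕ → ℕ) : Prog k (ℕ → ℕ → ℕ) :=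
  Prog.forRange (fun i => Prog.forRange (fun j => Prog.op .sub (B i j) (T i j) pure) n) m

/-- `B - X * Y` for `X` of size `m × r` and `Y` of size `r × n`. -/
def blockSubMul (m r n : ℕ) (B X Y : ℕ → ℕ → ℕ) : Prog k (ℕ → ℕ → ℕ) :=
  if r = 0 then pure B else do
    let T ← blockMul mm m r n X Y
    subEntries m n B T

/-- Forward substitution for `r` equations and `n` right-hand sides, by halving. -/
def triSolve (n r : ℕ) (L B : ℕ → ℕ → ℕ) : Prog k (ℕ → ℕ → ℕ) :=
  if r = 0 then pure B
  else if r = 1 then do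
    let X ← Prog.forRange (fun j => Prog.op .div (B 0 j) (L 0 0) pure) n
    pure fun _ => X
  else do
    let X₁ ← triSolve n (r / 2) L B
    let B' ← blockSubMul mm (r - r / 2) (r / 2) n (fun i j => B (r / 2 + i) j)
      (fun i j => L (r / 2 + i) j) X₁
    let X₂ ← triSolve n (r - r / 2) (fun i j => L (r / 2 + i) (r / 2 + j)) B'
    pure fun i j => if i < r / 2 then X₁ i j else X₂ (i - r / 2) j
termination_by r
decreasing_by all_goals omega

end

section

variable {k : Type u} [Field k] {ω C : ℝ} {F : Type u} [Field F] [Algebra k F]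
  {mm : ∀ n : ℕ, AddrMatrix n n → AddrMatrix n n → Prog k (AddrMatrix n n)}
  {m r n : ℕ} {B X Y T : ℕ → ℕ → ℕ} {b x y t : ℕ → ℕ → F} {μ : List F}

theorem runs_productBlock (h : IsMatMul ω C mm) (hX : Stores μ m r X x) (hY : Stores μ r n Y y)
    {z : ℕ} (hz : μ[z]? = some 0) (p q : ℕ) :
    (productBlock mm m r n X Y z p q).Runs μ fun T ν c =>
      (∀ i < r, ∀ j < r, p * r + i < m → q * r + j < n →
        ν[T i j]? = some (∑ t ∈ Finset.range r, x (p * r + i) t * y t (q * r + j))) ∧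
      (c : ℝ) ≤ C * (r : ℝ) ^ ω := by
  let xp : Matrix (Fin r) (Fin r) F := .of fun i j => if p * r + i < m then x (p * r + i) j else 0
  let yq : Matrix (Fin r) (Fin r) F := .of fun i j => if q * r + j < n then y i (q * r + j) else 0
  refine (h.runs (x := xp) (y := yq) (fun i j => ?_) (fun i j => ?_)).bind
    fun T ν c _ ⟨hT, hc⟩ => Prog.runs_pure ⟨fun i hi j hj him hjn => ?_, by simpa using hc⟩
  · simp only [xp, Matrix.of_apply]
    split_ifs with hi
    exacts [hX _ hi _ j.2, hz]
  · simp only [yq, Matrix.of_apply]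
    split_ifs with hj
    exacts [hY _ i.2 _ hj, hz]
  · beta_reduce
    rw [dif_pos ⟨hi, hj⟩, hT, Matrix.mul_apply, Finset.sum_range]
    simp only [xp, yq, Matrix.of_apply, if_pos him, if_pos hjn]

theorem rpow_eq_mul_self_mul_rpow_sub_two {x : ℝ} (hx : x ≠ 0) (ω : ℝ) :
    x ^ ω = x * x * x ^ (ω - 2) := by
  have hsub := Real.rpow_sub_natCast hx ω 2
  rw [Nat.cast_ofNat] at hsub
  rw [hsub]
  field_simp

theorem natCast_div_succ_mul_le (m r : ℕ) : ((m / r + 1 : ℕ) : ℝ) * r ≤ m + r := by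
  exact_mod_cast show (m / r + 1) * r ≤ m + r by
    rw [add_one_mul]
    exact Nat.add_le_add_right (Nat.div_mul_le_self m r) r

theorem runs_blockMul (h : IsMatMul ω C mm) (hr : 0 < r) (hX : Stores μ m r X x)
    (hY : Stores μ r n Y y) :
    (blockMul mm m r n X Y).Runs μ fun T ν c =>
      Stores ν m n T (fun i j => ∑ t ∈ Finset.range r, x i t * y t j) ∧
      (c : ℝ) ≤ C * (m + r) * (n + r) * (r : ℝ) ^ (ω - 2) := by
  refine (Prog.runs_const 0 μ).bind fun z ν₀ c₀ hν₀ ⟨hz, hc₀⟩ => ?_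
  rw [map_zero] at hz
  refine (Prog.runs_forRange_forRange (fun p q (T : ℕ → ℕ → ℕ) ν =>
    ∀ i < r, ∀ j < r, p * r + i < m → q * r + j < n →
      ν[T i j]? = some (∑ t ∈ Finset.range r, x (p * r + i) t * y t (q * r + j)))
    (fun p q T μ ν hν hT i hi j hj him hjn =>
      Prog.getElem?_of_prefix hν (hT i hi j hj him hjn))
    fun p _ q _ ν hν => runs_productBlock h (hX.mono (hν₀.trans hν)) (hY.mono (hν₀.trans hν))
      (Prog.getElem?_of_prefix hν hz) p q).bind
    fun T ν c _ ⟨hT, hc⟩ => Prog.runs_pure ⟨fun i hi j hj => ?_, ?_⟩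
  · have hij := hT (i / r) (Nat.lt_succ_of_le (Nat.div_le_div_right hi.le)) (j / r)
      (Nat.lt_succ_of_le (Nat.div_le_div_right hj.le)) (i % r) (Nat.mod_lt _ hr) (j % r)
      (Nat.mod_lt _ hr)
    simp only [Nat.div_add_mod'] at hij
    exact hij hi hj
  · have hC := h.nonneg
    have hrows := natCast_div_succ_mul_le m r
    have hcols := natCast_div_succ_mul_le n r
    rw [hc₀, zero_add, add_zero]
    calc (c : ℝ) ≤ _ := hc
      _ = C * (((m / r + 1 : ℕ) : ℝ) * r) * (((n / r + 1 : ℕ) : ℝ) * r) * (r : ℝ) ^ (ω - 2) := by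
        rw [rpow_eq_mul_self_mul_rpow_sub_two (Nat.cast_ne_zero.mpr hr.ne') ω]
        ring
      _ ≤ _ := by gcongr

theorem runs_subEntries (hB : Stores μ m n B b) (hT : Stores μ m n T t) :
    (subEntries m n B T : Prog k _).Runs μ fun D ν c =>
      Stores ν m n D (fun i j => b i j - t i j) ∧ (c : ℝ) ≤ m * n := by
  refine (Prog.runs_forRange_forRange (b := 1) (fun i j (D : ℕ) ν => ν[D]? = some (b i j - t i j))
    (fun i j D μ ν hν hD => Prog.getElem?_of_prefix hν hD) fun i hi j hj ν hν => ?_).mono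
    fun D ν c _ ⟨hD, hc⟩ => ⟨hD, by simpa using hc⟩
  refine (Prog.runs_op .sub (hB.mono hν i hi j hj) (hT.mono hν i hi j hj)).mono ?_
  rintro z ν' c - ⟨hz, rfl⟩
  exact ⟨hz, Nat.cast_one.le⟩

theorem runs_blockSubMul (h : IsMatMul ω C mm) (hω : 2 < ω) (hB : Stores μ m n B b)
    (hX : Stores μ m r X x) (hY : Stores μ r n Y y) :
    (blockSubMul mm m r n B X Y).Runs μ fun D ν c =>
      Stores ν m n D (fun i j => b i j - ∑ t ∈ Finset.range r, x i t * y t j) ∧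
      (c : ℝ) ≤ (C + 1) * (m + r) * (n + r) * (r : ℝ) ^ (ω - 2) := by
  unfold blockSubMul
  split_ifs with hr
  · subst hr
    exact Prog.runs_pure
      ⟨by simpa using hB, by simp [Real.zero_rpow (show ω - 2 ≠ 0 by linarith)]⟩
  · have hrpos := Nat.pos_of_ne_zero hr
    refine (runs_blockMul h hrpos hX hY).bind fun T ν c hν ⟨hT, hc⟩ =>
      (runs_subEntries (hB.mono hν) hT).mono fun D ν' c' _ ⟨hD, hc'⟩ => ⟨hD, ?_⟩
    have hpow : (1 : ℝ) ≤ (r : ℝ) ^ (ω - 2) :=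
      Real.one_le_rpow (by exact_mod_cast hrpos) (by linarith)
    have hsub : (m : ℝ) * n ≤ (m + r) * (n + r) * (r : ℝ) ^ (ω - 2) :=
      (mul_le_mul (by simp) (by simp) (by positivity) (by positivity)).trans
        (le_mul_of_one_le_right (by positivity) hpow)
    push_cast
    linarith [hc, hc']

end

section SplittingCost

theorem rpow_sub_one_eq_mul_rpow_sub_two {x ω : ℝ} (hx : 0 ≤ x) (hω : 2 < ω) :
    x ^ (ω - 1) = x * x ^ (ω - 2) := by
  rw [show ω - 1 = 1 + (ω - 2) by ring, Real.rpow_one_add' hx (by linarith)]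

theorem rpow_add_rpow_le_of_le_mul_add {x y δ ω : ℝ} (hω : 2 < ω) (hx : 0 ≤ x) (hy : 0 ≤ y)
    (hδ : 0 ≤ δ) (hxδ : x ≤ δ * (x + y)) (hyδ : y ≤ δ * (x + y)) :
    x ^ (ω - 1) + y ^ (ω - 1) ≤ δ ^ (ω - 2) * (x + y) ^ (ω - 1) := by
  have he : 0 ≤ ω - 2 := by linarith
  rw [rpow_sub_one_eq_mul_rpow_sub_two hx hω, rpow_sub_one_eq_mul_rpow_sub_two hy hω,
    rpow_sub_one_eq_mul_rpow_sub_two (add_nonneg hx hy) hω]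
  calc x * x ^ (ω - 2) + y * y ^ (ω - 2)
      ≤ x * (δ * (x + y)) ^ (ω - 2) + y * (δ * (x + y)) ^ (ω - 2) :=
        add_le_add (mul_le_mul_of_nonneg_left (Real.rpow_le_rpow hx hxδ he) hx)
          (mul_le_mul_of_nonneg_left (Real.rpow_le_rpow hy hyδ he) hy)
    _ = _ := by
      rw [Real.mul_rpow hδ (add_nonneg hx hy)]
      ring

end SplittingCost

section ForwardSubstitution

variable {F : Type*} [Field F]

/-- One splitting step of forward substitution: `x₁` solves the first `p` equations, and `x₂` the
last `q` ones, from whose right-hand sides the contribution of `x₁` has been subtracted. -/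
theorem sum_lower_mul_append {p q : ℕ} {l : ℕ → ℕ → F} {b x₁ x₂ : ℕ → F}
    (hlow : ∀ i j, i < j → j < p + q → l i j = 0)
    (h₁ : ∀ i < p, ∑ t ∈ Finset.range p, l i t * x₁ t = b i)
    (h₂ : ∀ i < q, ∑ t ∈ Finset.range q, l (p + i) (p + t) * x₂ t =
      b (p + i) - ∑ t ∈ Finset.range p, l (p + i) t * x₁ t) (i : ℕ) (hi : i < p + q) :
    ∑ t ∈ Finset.range (p + q), l i t * (if t < p then x₁ t else x₂ (t - p)) = b i := by
  have hsplit : ∑ t ∈ Finset.range (p + q), l i t * (if t < p then x₁ t else x₂ (t - p)) =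
      ∑ t ∈ Finset.range p, l i t * x₁ t + ∑ t ∈ Finset.range q, l i (p + t) * x₂ t := by
    rw [Finset.sum_range_add]
    congr 1
    · exact Finset.sum_congr rfl fun t ht => by rw [if_pos (Finset.mem_range.mp ht)]
    · exact Finset.sum_congr rfl fun t _ => by rw [if_neg (by omega), Nat.add_sub_cancel_left]
  rw [hsplit]
  by_cases hip : i < p
  · rw [h₁ i hip, Finset.sum_eq_zero, add_zero]
    intro t ht
    rw [hlow i (p + t) (by omega) (by simpa using ht), zero_mul]
  · obtain ⟨s, rfl⟩ := Nat.exists_eq_add_of_le (not_lt.mp hip)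
    rw [h₂ s (by omega)]
    ring

end ForwardSubstitution

section

variable {k : Type u} [Field k] {ω C : ℝ} {F : Type u} [Field F] [Algebra k F]
  {mm : ∀ n : ℕ, AddrMatrix n n → AddrMatrix n n → Prog k (AddrMatrix n n)}

theorem runs_div_row {n z : ℕ} {B : ℕ → ℕ} {b : ℕ → F} {d : F} {μ : List F}
    (hB : ∀ j < n, μ[B j]? = some (b j)) (hz : μ[z]? = some d) :
    (Prog.forRange (fun j => Prog.op .div (B j) z pure) n : Prog k _).Runs μ fun X ν c =>
      (∀ j < n, ν[X j]? = some (b j / d)) ∧ (c : ℝ) ≤ n := by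
  refine (Prog.runs_forRange (b := 1) (fun j (x : ℕ) ν => ν[x]? = some (b j / d))
    (fun j x μ ν hν hx => Prog.getElem?_of_prefix hν hx) fun j hj ν hν => ?_).mono
    fun X ν c _ ⟨hX, hc⟩ => ⟨hX, by simpa using hc⟩
  refine (Prog.runs_op .div (Prog.getElem?_of_prefix hν (hB j hj))
    (Prog.getElem?_of_prefix hν hz)).mono ?_
  rintro x ν' c - ⟨hx, rfl⟩
  exact ⟨hx, Nat.cast_one.le⟩

theorem exists_halves {m : ℕ} (hm : 2 ≤ m) :
    ∃ p q, p = m / 2 ∧ q = m - m / 2 ∧ m = p + q ∧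
      (p : ℝ) ≤ 2 / 3 * (p + q) ∧ (q : ℝ) ≤ 2 / 3 * (p + q) := by
  obtain ⟨p, q, hp, hq, rfl⟩ : ∃ p q, p = m / 2 ∧ q = m - m / 2 ∧ m = p + q :=
    ⟨_, _, rfl, rfl, by omega⟩
  have hp3 : 3 * (p : ℝ) ≤ 2 * (p + q) := by exact_mod_cast show 3 * p ≤ 2 * (p + q) by omega
  have hq3 : 3 * (q : ℝ) ≤ 2 * (p + q) := by exact_mod_cast show 3 * q ≤ 2 * (p + q) by omega
  exact ⟨p, q, hp, hq, rfl, by linarith, by linarith⟩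

/-- The recursive calls cost a fraction `(2 / 3) ^ (ω - 2)` of the bound; `K` is large enough for
the rest to pay for the product. -/
theorem triSolve_cost_le (hω : 2 < ω) (hC : 0 ≤ C) {K : ℝ} (hK0 : 0 ≤ K)
    (hK : 2 * (C + 1) ≤ K * (1 - (2 / 3) ^ (ω - 2))) {n p q c₁ c₂ c₃ : ℝ}
    (hp0 : 0 ≤ p) (hq0 : 0 ≤ q) (hp : p ≤ 2 / 3 * (p + q)) (hq : q ≤ 2 / 3 * (p + q))
    (h₁ : c₁ ≤ K * max p n * p ^ (ω - 1))
    (h₂ : c₂ ≤ (C + 1) * (q + p) * (n + p) * p ^ (ω - 2))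
    (h₃ : c₃ ≤ K * max q n * q ^ (ω - 1)) :
    c₁ + (c₂ + c₃) ≤ K * max (p + q) n * (p + q) ^ (ω - 1) := by
  set N := max (p + q) n
  have hpN : p ≤ N := le_max_of_le_left (by linarith)
  have hqN : q ≤ N := le_max_of_le_left (by linarith)
  have hnN : n ≤ N := le_max_right _ _
  have hN : 0 ≤ N := hp0.trans hpN
  have hrec : c₁ + c₃ ≤ K * N * ((2 / 3) ^ (ω - 2) * (p + q) ^ (ω - 1)) := calc
    c₁ + c₃ ≤ K * N * p ^ (ω - 1) + K * N * q ^ (ω - 1) := by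
      refine add_le_add (h₁.trans ?_) (h₃.trans ?_) <;> gcongr
      exacts [max_le hpN hnN, max_le hqN hnN]
    _ ≤ _ := by
      rw [← mul_add]
      gcongr
      exact rpow_add_rpow_le_of_le_mul_add hω hp0 hq0 (by norm_num) hp hq
  have hmul : c₂ ≤ 2 * (C + 1) * (N * (p + q) ^ (ω - 1)) := calc
    c₂ ≤ (C + 1) * (p + q) * (2 * N) * (p + q) ^ (ω - 2) := by
      refine h₂.trans ?_
      rw [add_comm q p]
      gcongr <;> linarith
    _ = _ := by
      rw [rpow_sub_one_eq_mul_rpow_sub_two (add_nonneg hp0 hq0) hω]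
      ring
  have hpay := mul_le_mul_of_nonneg_right hK
    (mul_nonneg hN (Real.rpow_nonneg (add_nonneg hp0 hq0) (ω - 1)))
  linarith

theorem runs_triSolve (h : IsMatMul ω C mm) (hω : 2 < ω) {K : ℝ} (hK1 : 1 ≤ K)
    (hK : 2 * (C + 1) ≤ K * (1 - (2 / 3) ^ (ω - 2))) (n r : ℕ) {L B : ℕ → ℕ → ℕ}
    {l b : ℕ → ℕ → F} {μ : List F} (hL : Stores μ r r L l) (hB : Stores μ r n B b)
    (hdiag : ∀ i < r, l i i ≠ 0) (hlow : ∀ i j, i < j → j < r → l i j = 0) :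
    (triSolve mm n r L B).Runs μ fun X ν c =>
      ∃ x, Stores ν r n X x ∧
        (∀ i < r, ∀ j < n, ∑ t ∈ Finset.range r, l i t * x t j = b i j) ∧
        (c : ℝ) ≤ K * max (r : ℝ) n * (r : ℝ) ^ (ω - 1) := by
  induction r using Nat.strong_induction_on generalizing L B l b μ with
  | _ r ih =>
  rw [triSolve]
  split_ifs with h0 h1
  · subst h0
    exact Prog.runs_pure
      ⟨b, hB, by simp, by simp [Real.zero_rpow (show ω - 1 ≠ 0 by linarith)]⟩
  · subst h1
    refine (runs_div_row (hB 0 one_pos) (hL 0 one_pos 0 one_pos)).bind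
      fun X ν c _ ⟨hX, hc⟩ => Prog.runs_pure
        ⟨fun _ j => b 0 j / l 0 0, fun _ _ j hj => hX j hj, fun i hi j _ => ?_, ?_⟩
    · rw [Nat.lt_one_iff.mp hi, Finset.sum_range_one, mul_div_cancel₀ _ (hdiag 0 one_pos)]
    · rw [Nat.cast_one, Real.one_rpow, mul_one, add_zero]
      exact (hc.trans (le_max_right _ _)).trans (le_mul_of_one_le_left (by positivity) hK1)
  · obtain ⟨p, q, hp, hq, rfl, hp3, hq3⟩ := exists_halves (show 2 ≤ r by omega)
    rw [← hq, ← hp]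
    refine (ih p (by omega) (fun i hi j hj => hL i (by omega) j (by omega))
      (fun i hi j hj => hB i (by omega) j hj) (fun i hi => hdiag i (by omega))
      (fun i j hij hj => hlow i j hij (by omega))).bind fun X₁ ν₁ c₁ hν₁ ⟨x₁, hX₁, hx₁, hc₁⟩ => ?_
    refine (runs_blockSubMul h hω (m := q) (r := p) (n := n)
      (b := fun i j => b (p + i) j) (x := fun i j => l (p + i) j)
      (fun i hi j hj => hB.mono hν₁ (p + i) (by omega) j hj)
      (fun i hi j hj => hL.mono hν₁ (p + i) (by omega) j (by omega)) hX₁).bind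
      fun B' ν₂ c₂ hν₂ ⟨hB', hc₂⟩ => ?_
    refine (ih q (by omega) (l := fun i j => l (p + i) (p + j))
      (fun i hi j hj => hL.mono (hν₁.trans hν₂) (p + i) (by omega) (p + j) (by omega))
      hB' (fun i hi => hdiag (p + i) (by omega))
      (fun i j hij hj => hlow (p + i) (p + j) (by omega) (by omega))).bind
      fun X₂ ν₃ c₃ hν₃ ⟨x₂, hX₂, hx₂, hc₃⟩ => Prog.runs_pure
        ⟨fun i j => if i < p then x₁ i j else x₂ (i - p) j, fun i hi j hj => ?_,
          fun i hi j hj => sum_lower_mul_append hlow (hx₁ · · j hj) (hx₂ · · j hj) i hi, ?_⟩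
    · beta_reduce
      split_ifs with hip
      · exact hX₁.mono (hν₂.trans hν₃) i hip j hj
      · exact hX₂ (i - p) (by omega) j hj
    · simpa using triSolve_cost_le hω h.nonneg (by linarith) hK p.cast_nonneg q.cast_nonneg
        hp3 hq3 hc₁ hc₂ hc₃

end

/-! ## Elimination by halving the set of rows -/

/-- The sequence `f 0, …, f (p - 1), g 0, g 1, …`. -/
def glue {α : Type*} (p : ℕ) (f g : ℕ → α) : ℕ → α := fun i => if i < p then f i else g (i - p)

theorem glue_of_lt {α : Type*} {p : ℕ} {f g : ℕ → α} {i : ℕ} (h : i < p) : glue p f g i = f i :=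
  if_pos h

theorem glue_add {α : Type*} {p : ℕ} {f g : ℕ → α} (i : ℕ) : glue p f g (p + i) = g i := by
  rw [glue, if_neg (by omega), Nat.add_sub_cancel_left]

theorem forall_lt_add_iff {p q : ℕ} {P : ℕ → Prop} :
    (∀ i < p + q, P i) ↔ (∀ i < p, P i) ∧ ∀ i < q, P (p + i) := by
  refine ⟨fun h => ⟨fun i hi => h i (by omega), fun i hi => h (p + i) (by omega)⟩,
    fun ⟨h₁, h₂⟩ i hi => ?_⟩
  by_cases hip : i < p
  · exact h₁ i hip
  · obtain ⟨j, rfl⟩ := Nat.exists_eq_add_of_le (not_lt.mp hip)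
    exact h₂ j (by omega)

section Stores

variable {F : Type u} {μ : List F} {m n p q : ℕ} {f g : ℕ → ℕ → ℕ} {a b : ℕ → ℕ → F}

theorem Stores.glue_rows (hf : Stores μ p n f a) (hg : Stores μ q n g b) :
    Stores μ (p + q) n (glue p f g) (glue p a b) := by
  refine forall_lt_add_iff.mpr ⟨fun i hi => ?_, fun i hi => ?_⟩
  · simpa only [glue_of_lt hi] using hf i hi
  · simpa only [glue_add] using hg i hi

theorem Stores.glue_cols (hf : Stores μ m p f a) (hg : Stores μ m q g b) :
    Stores μ m (p + q) (fun i => glue p (f i) (g i)) fun i => glue p (a i) (b i) := by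
  refine fun i hi => forall_lt_add_iff.mpr ⟨fun j hj => ?_, fun j hj => ?_⟩
  · simpa only [glue_of_lt hj] using hf i hi j hj
  · simpa only [glue_add] using hg i hi j hj

end Stores

/-- The vectors `v 0, …, v (r - 1)` of length `n` are in echelon form: the first non-zero entry of
`v t` is at position `γ t`, where all later vectors vanish. The positions need not increase. -/
structure IsEchelonFamily {F : Type u} [Field F] (v : ℕ → ℕ → F) (n r : ℕ) (γ : ℕ → ℕ) :
    Prop where
  pivot_lt : ∀ t < r, γ t < n
  pivot_ne_zero : ∀ t < r, v t (γ t) ≠ 0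
  eq_zero_of_lt_pivot : ∀ t < r, ∀ j < γ t, v t j = 0
  eq_zero_at_pivot : ∀ t < r, ∀ s < t, v t (γ s) = 0

namespace IsEchelonFamily

variable {F : Type u} [Field F] {v w : ℕ → ℕ → F} {n p q r s : ℕ} {γ δ : ℕ → ℕ}

theorem zero : IsEchelonFamily v n 0 γ := by
  constructor <;> exact fun t ht => absurd ht t.not_lt_zero

theorem one (hγ : γ 0 < n) (hne : v 0 (γ 0) ≠ 0) (hzero : ∀ j < γ 0, v 0 j = 0) :
    IsEchelonFamily v n 1 γ where
  pivot_lt t ht := by rwa [Nat.lt_one_iff.mp ht]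
  pivot_ne_zero t ht := by rwa [Nat.lt_one_iff.mp ht]
  eq_zero_of_lt_pivot t ht := by rwa [Nat.lt_one_iff.mp ht]
  eq_zero_at_pivot t ht i hi := by omega

theorem pivot_injective (h : IsEchelonFamily v n r γ) :
    Function.Injective fun t : Fin r => γ t := by
  intro s t (hst : γ s = γ t)
  by_contra hne
  rcases lt_or_gt_of_ne hne with hlt | hlt
  · exact h.pivot_ne_zero t t.2 (hst ▸ h.eq_zero_at_pivot t t.2 s hlt)
  · exact h.pivot_ne_zero s s.2 (hst.symm ▸ h.eq_zero_at_pivot s s.2 t hlt)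

theorem length_le (h : IsEchelonFamily v n r γ) : r ≤ n := by
  simpa using Fintype.card_le_of_injective (fun t : Fin r => (⟨γ t, h.pivot_lt t t.2⟩ : Fin n))
    fun _ _ hst => h.pivot_injective (Fin.mk.inj hst)

theorem glue (h : IsEchelonFamily v n r γ) (h' : IsEchelonFamily w n s δ)
    (hw : ∀ t < s, ∀ i < r, w t (γ i) = 0) :
    IsEchelonFamily (glue r v w) n (r + s) (glue r γ δ) := by
  constructor <;> refine forall_lt_add_iff.mpr ⟨fun t ht => ?_, fun t ht => ?_⟩
  · simpa only [glue_of_lt ht] using h.pivot_lt t ht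
  · simpa only [glue_add] using h'.pivot_lt t ht
  · simpa only [glue_of_lt ht] using h.pivot_ne_zero t ht
  · simpa only [glue_add] using h'.pivot_ne_zero t ht
  · simpa only [glue_of_lt ht] using h.eq_zero_of_lt_pivot t ht
  · simpa only [glue_add] using h'.eq_zero_of_lt_pivot t ht
  · intro i hi
    simpa only [glue_of_lt ht, glue_of_lt (hi.trans ht)] using h.eq_zero_at_pivot t ht i hi
  · refine forall_lt_add_iff.mpr ⟨fun i hi => ?_, fun i hi => ?_⟩
    · simpa only [glue_add, glue_of_lt hi] using hw t ht i hi
    · simpa only [glue_add] using h'.eq_zero_at_pivot t ht i hi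

theorem extend (h : IsEchelonFamily v p r γ) (e : ℕ → ℕ → F) :
    IsEchelonFamily (fun t => _root_.glue p (v t) (e t)) (p + q) r γ where
  pivot_lt t ht := (h.pivot_lt t ht).trans_le (Nat.le_add_right p q)
  pivot_ne_zero t ht := by simpa only [glue_of_lt (h.pivot_lt t ht)] using h.pivot_ne_zero t ht
  eq_zero_of_lt_pivot t ht j hj := by
    simpa only [glue_of_lt (hj.trans (h.pivot_lt t ht))] using h.eq_zero_of_lt_pivot t ht j hj
  eq_zero_at_pivot t ht s hs := by
    simpa only [glue_of_lt (h.pivot_lt s (hs.trans ht))] using h.eq_zero_at_pivot t ht s hs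

theorem shift (h : IsEchelonFamily v q r γ) :
    IsEchelonFamily (fun t => _root_.glue p 0 (v t)) (p + q) r fun t => p + γ t where
  pivot_lt t ht := Nat.add_lt_add_left (h.pivot_lt t ht) p
  pivot_ne_zero t ht := by simpa only [glue_add] using h.pivot_ne_zero t ht
  eq_zero_of_lt_pivot t ht := forall_lt_add_iff.mpr
    ⟨fun j hj => glue_of_lt hj, fun j hj => by
      simpa only [glue_add] using h.eq_zero_of_lt_pivot t ht j hj⟩
  eq_zero_at_pivot t ht s hs := by simpa only [glue_add] using h.eq_zero_at_pivot t ht s hs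

end IsEchelonFamily

/-- The `m × n` matrix `a` is the sum of the `r` products (column `c t`) * (row `u t`), where
columns and rows are in echelon form with pivots `ρ` and `γ`; the pivots of the columns are `1`. -/
structure IsEchelonFactorization {F : Type u} [Field F] (a : ℕ → ℕ → F) (m n r : ℕ)
    (ρ γ : ℕ → ℕ) (c u : ℕ → ℕ → F) : Prop where
  cols : IsEchelonFamily c m r ρ
  rows : IsEchelonFamily u n r γ
  col_pivot_eq_one : ∀ t < r, c t (ρ t) = 1
  eq_sum : ∀ i < m, ∀ j < n, a i j = ∑ t ∈ Finset.range r, c t i * u t j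

namespace IsEchelonFactorization

variable {F : Type u} [Field F] {a : ℕ → ℕ → F} {m n r : ℕ} {ρ γ : ℕ → ℕ} {c u : ℕ → ℕ → F}

theorem of_eq_zero (ha : ∀ i < m, ∀ j < n, a i j = 0) :
    IsEchelonFactorization a m n 0 ρ γ c u where
  cols := .zero
  rows := .zero
  col_pivot_eq_one t ht := absurd ht t.not_lt_zero
  eq_sum i hi j hj := by simpa using ha i hi j hj

theorem row_apply_eq_zero (h : IsEchelonFactorization a m n r ρ γ c u) {j : ℕ} (hj : j < n)
    (ha : ∀ i < m, a i j = 0) (t : ℕ) : t < r → u t j = 0 := by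
  induction t using Nat.strong_induction_on with
  | _ t ih =>
    intro ht
    have hsum := h.eq_sum (ρ t) (h.cols.pivot_lt t ht) j hj
    rw [ha _ (h.cols.pivot_lt t ht), Finset.sum_eq_single_of_mem t (Finset.mem_range.mpr ht),
      h.col_pivot_eq_one t ht, one_mul] at hsum
    · exact hsum.symm
    · intro s hs hne
      rw [Finset.mem_range] at hs
      rcases lt_or_gt_of_ne hne with hlt | hlt
      · rw [ih s hlt hs, mul_zero]
      · rw [h.cols.eq_zero_at_pivot s hs t hlt, zero_mul]

/-- `e` expresses the remaining rows in terms of the rows found so far, as far as the pivot columns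
are concerned; so what is left of these rows vanishes there. -/
theorem append {p q s : ℕ} {ρ' γ' : ℕ → ℕ} {c' u' e : ℕ → ℕ → F}
    (h : IsEchelonFactorization a p n r ρ γ c u)
    (he : ∀ i < q, ∀ s < r, ∑ t ∈ Finset.range r, e t i * u t (γ s) = a (p + i) (γ s))
    (h' : IsEchelonFactorization
      (fun i j => a (p + i) j - ∑ t ∈ Finset.range r, e t i * u t j) q n s ρ' γ' c' u') :
    IsEchelonFactorization a (p + q) n (r + s) (glue r ρ fun t => p + ρ' t) (glue r γ γ')
      (glue r (fun t => glue p (c t) (e t)) fun t => glue p 0 (c' t)) (glue r u u') where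
  cols := h.cols.extend e |>.glue h'.cols.shift fun t _ i hi => glue_of_lt (h.cols.pivot_lt i hi)
  rows := h.rows.glue h'.rows fun t ht i hi =>
    h'.row_apply_eq_zero (h.rows.pivot_lt i hi) (fun j hj => by rw [he j hj i hi, sub_self]) t ht
  col_pivot_eq_one := by
    refine forall_lt_add_iff.mpr ⟨fun t ht => ?_, fun t ht => ?_⟩
    · rw [glue_of_lt ht, glue_of_lt ht, glue_of_lt (h.cols.pivot_lt t ht), h.col_pivot_eq_one t ht]
    · rw [glue_add, glue_add, glue_add, h'.col_pivot_eq_one t ht]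
  eq_sum := by
    have hglue (v w : ℕ → ℕ → F) (i j : ℕ) : ∑ t ∈ Finset.range (r + s),
        glue r v w t i * glue r u u' t j =
          (∑ t ∈ Finset.range r, v t i * u t j) + ∑ t ∈ Finset.range s, w t i * u' t j := by
      rw [Finset.sum_range_add]
      refine congrArg₂ _ (Finset.sum_congr rfl fun t ht => ?_) ?_
      · rw [Finset.mem_range] at ht
        rw [glue_of_lt ht, glue_of_lt ht]
      · simp only [glue_add]
    refine forall_lt_add_iff.mpr ⟨fun i hi j hj => ?_, fun i hi j hj => ?_⟩
    · simp only [hglue, glue_of_lt hi, Pi.zero_apply, zero_mul, Finset.sum_const_zero, add_zero]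
      exact h.eq_sum i hi j hj
    · simp only [hglue, glue_add]
      rw [← h'.eq_sum i hi j hj, add_sub_cancel]

end IsEchelonFactorization

/-- Output of the elimination: the number of pivots, their rows and columns, and the addresses of
the columns and of the rows of the factorization. -/
structure EchelonData where
  r : ℕ
  ρ : ℕ → ℕ
  γ : ℕ → ℕ
  C : ℕ → ℕ → ℕ
  U : ℕ → ℕ → ℕ

namespace EchelonData

/-- `f`, read in the memory `μ`, is an echelon factorization of `a`. -/
def Factors {F : Type u} [Field F] (f : EchelonData) (μ : List F) (a : ℕ → ℕ → F) (m n : ℕ) :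
    Prop :=
  ∃ c u, Stores μ f.r m f.C c ∧ Stores μ f.r n f.U u ∧
    IsEchelonFactorization a m n f.r f.ρ f.γ c u

/-- The factorization `f` of the first `p` rows followed by the factorization `g` of what is left of
the other rows; `X` holds their coefficients on the rows of `f`, and the cell `z` holds `0`. -/
def append (f g : EchelonData) (p z : ℕ) (X : ℕ → ℕ → ℕ) : EchelonData where
  r := f.r + g.r
  ρ := glue f.r f.ρ fun t => p + g.ρ t
  γ := glue f.r f.γ g.γ
  C := glue f.r (fun t => glue p (f.C t) (X t)) fun t => glue p (fun _ => z) (g.C t)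
  U := glue f.r f.U g.U

end EchelonData

theorem Prog.runs_test {k F : Type u} [Field k] [Field F] [Algebra k F] {x : ℕ} {a : F}
    {μ : List F} (hx : μ[x]? = some a) :
    (test x pure : Prog k Bool).Runs μ fun b _ t => (b = true ↔ a = 0) ∧ t = 1 := by
  have hget : μ.getD x 0 = a := by rw [List.getD_eq_getElem?_getD, hx, Option.getD_some]
  classical exact ⟨by rw [← hget]; exact decide_eq_true_iff, rfl⟩

section Programs

variable {k : Type u} [Field k]

/-- The first of `n` cells that is not zero. -/
def findNonzero (f : ℕ → ℕ) : ℕ → Prog k (Option ℕ)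
  | 0 => pure none
  | n + 1 => do
    match ← findNonzero f n with
    | some j => pure (some j)
    | none => do
      let b ← Prog.test (f n) pure
      pure (if b then none else some n)

/-- Echelon factorization of a single row. -/
def rowFactor (n : ℕ) (A : ℕ → ℕ → ℕ) : Prog k EchelonData := do
  let o ← findNonzero (A 0) n
  let z ← Prog.const 1
  pure (match o with
    | none => ⟨0, 0, 0, A, A⟩
    | some j => ⟨1, 0, fun _ => j, fun _ _ => z, A⟩)

/-- Echelon factorization of an `m × n` matrix: factor the upper half, eliminate its pivot columns
from the lower half, factor the rest. -/
def echelonFactor (mm : ∀ n : ℕ, AddrMatrix n n → AddrMatrix n n → Prog k (AddrMatrix n n))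
    (n m : ℕ) (A : ℕ → ℕ → ℕ) : Prog k EchelonData :=
  if m = 0 then pure ⟨0, 0, 0, A, A⟩
  else if m = 1 then rowFactor n A
  else do
    let f ← echelonFactor mm n (m / 2) A
    let X ← triSolve mm (m - m / 2) f.r (fun i j => f.U j (f.γ i))
      (fun i j => A (m / 2 + j) (f.γ i))
    let A' ← blockSubMul mm (m - m / 2) f.r n (fun i j => A (m / 2 + i) j) (fun i j => X j i) f.U
    let g ← echelonFactor mm n (m - m / 2) A'
    let z ← Prog.const 0
    pure (f.append g (m / 2) z X)
termination_by m
decreasing_by all_goals omega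

variable {F : Type u} [Field F] [Algebra k F]

theorem runs_findNonzero {f : ℕ → ℕ} {a : ℕ → F} {μ : List F} (n : ℕ)
    (hf : ∀ j < n, μ[f j]? = some (a j)) :
    (findNonzero f n : Prog k (Option ℕ)).Runs μ fun o _ c => c ≤ n ∧
      (o = none → ∀ j < n, a j = 0) ∧ ∀ j ∈ o, j < n ∧ a j ≠ 0 ∧ ∀ i < j, a i = 0 := by
  induction n with
  | zero => exact Prog.runs_pure ⟨le_rfl, by simp, by simp⟩
  | succ n ih =>
    refine (ih fun j hj => hf j (by omega)).bind ?_
    rintro (_ | j) ν c hν ⟨hc, hnone, hsome⟩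
    · refine (Prog.runs_test (Prog.getElem?_of_prefix hν (hf n n.lt_succ_self))).bind ?_
      rintro b ν' c' - ⟨hb, rfl⟩
      refine Prog.runs_pure ⟨by omega, ?_, ?_⟩
      · intro ho
        have hn : a n = 0 := by simpa [hb] using ho
        exact Nat.forall_lt_succ_right.mpr ⟨hnone rfl, hn⟩
      · rintro j hj
        obtain ⟨hn, rfl⟩ : a n ≠ 0 ∧ n = j := by simpa [← hb] using hj
        exact ⟨n.lt_succ_self, hn, hnone rfl⟩
    · obtain ⟨hj, hne, hzero⟩ := hsome j rfl
      refine Prog.runs_pure ⟨by omega, by simp, ?_⟩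
      rintro _ ⟨⟩
      exact ⟨by omega, hne, hzero⟩

theorem runs_rowFactor {A : ℕ → ℕ → ℕ} {a : ℕ → ℕ → F} {μ : List F} {n : ℕ}
    (hA : Stores μ 1 n A a) :
    (rowFactor n A : Prog k EchelonData).Runs μ fun f ν c => f.Factors ν a 1 n ∧ c ≤ n := by
  refine (runs_findNonzero n (hA 0 one_pos)).bind fun o ν c hν ⟨hc, hnone, hsome⟩ => ?_
  refine (Prog.runs_const 1 ν).bind ?_
  rintro z ν' _ hν' ⟨hz, rfl⟩
  rw [map_one] at hz
  refine Prog.runs_pure ⟨?_, hc⟩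
  rcases o with _ | j
  · refine ⟨a, a, fun t ht => absurd ht t.not_lt_zero, fun t ht => absurd ht t.not_lt_zero,
      .of_eq_zero fun i hi => ?_⟩
    rw [Nat.lt_one_iff.mp hi]
    exact hnone rfl
  · obtain ⟨hj, hne, hzero⟩ := hsome j rfl
    refine ⟨fun _ _ => 1, a, fun _ _ _ _ => hz, hA.mono (hν.trans hν'),
      .one one_pos one_ne_zero fun i hi => absurd hi i.not_lt_zero, .one hj hne hzero,
      fun _ _ => rfl, fun i hi l _ => ?_⟩
    rw [Nat.lt_one_iff.mp hi, Finset.sum_range_one, one_mul]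

theorem EchelonData.Factors.append {f g : EchelonData} {p q n z : ℕ} {X : ℕ → ℕ → ℕ}
    {a c u x : ℕ → ℕ → F} {ν : List F} (hC : Stores ν f.r p f.C c) (hU : Stores ν f.r n f.U u)
    (hf : IsEchelonFactorization a p n f.r f.ρ f.γ c u) (hX : Stores ν f.r q X x)
    (hx : ∀ s < f.r, ∀ i < q, ∑ t ∈ Finset.range f.r, u t (f.γ s) * x t i = a (p + i) (f.γ s))
    (hz : ν[z]? = some 0)
    (hg : g.Factors ν (fun i j => a (p + i) j - ∑ t ∈ Finset.range f.r, x t i * u t j) q n) :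
    (f.append g p z X).Factors ν a (p + q) n := by
  obtain ⟨c', u', hC', hU', hg⟩ := hg
  refine ⟨_, _, (hC.glue_cols hX).glue_rows (.glue_cols (fun _ _ _ _ => hz) hC'),
    hU.glue_rows hU', hf.append (e := x) (fun i hi s hs => ?_) hg⟩
  rw [← hx s hs i hi]
  exact Finset.sum_congr rfl fun t _ => mul_comm _ _

/-- Concavity of `x ^ (ω - 2)`. -/
theorem mul_rpow_add_mul_rpow_le {ω p q r s : ℝ} (hω : 2 < ω) (hω3 : ω ≤ 3) (hp : 0 ≤ p)
    (hq : 0 ≤ q) (hpq : 0 < p + q) (hp3 : p ≤ 2 / 3 * (p + q)) (hq3 : q ≤ 2 / 3 * (p + q))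
    (hr : 0 ≤ r) (hs : 0 ≤ s) :
    p * r ^ (ω - 2) + q * s ^ (ω - 2) ≤
      (p + q) * ((2 / 3) ^ (ω - 2) * (r + s) ^ (ω - 2)) := by
  have hmean : p / (p + q) * r + q / (p + q) * s ≤ 2 / 3 * (r + s) := by
    rw [mul_add]
    gcongr ?_ * _ + ?_ * _
    exacts [(div_le_iff₀ hpq).mpr hp3, (div_le_iff₀ hpq).mpr hq3]
  have hjensen := calc
    p / (p + q) * r ^ (ω - 2) + q / (p + q) * s ^ (ω - 2)
      ≤ (p / (p + q) * r + q / (p + q) * s) ^ (ω - 2) :=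
        (Real.concaveOn_rpow (p := ω - 2) (by linarith) (by linarith)).2 hr hs
          (div_nonneg hp hpq.le) (div_nonneg hq hpq.le) (by rw [← add_div, div_self hpq.ne'])
    _ ≤ (2 / 3 * (r + s)) ^ (ω - 2) :=
        Real.rpow_le_rpow (by positivity) hmean (by linarith)
    _ = (2 / 3) ^ (ω - 2) * (r + s) ^ (ω - 2) :=
        Real.mul_rpow (by norm_num) (add_nonneg hr hs)
  refine le_of_eq_of_le ?_ (mul_le_mul_of_nonneg_left hjensen hpq.le)
  field_simp

/-- `K₂` is large enough for the part of the bound that the recursive calls leave over to pay for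
the triangular system and the product. -/
theorem echelonFactor_cost_le {ω C K K₂ : ℝ} (hω : 2 < ω) (hω3 : ω ≤ 3) (hC : 0 ≤ C) (hK : 0 ≤ K)
    (hK₂0 : 0 ≤ K₂) (hK₂ : K + 2 * (C + 1) ≤ K₂ * (1 - (2 / 3) ^ (ω - 2)))
    {p q n r s t₁ t₂ t₃ t₄ : ℝ} (hq : 0 ≤ q) (hpq : 0 < p + q)
    (hp3 : p ≤ 2 / 3 * (p + q)) (hq3 : q ≤ 2 / 3 * (p + q)) (hr : 0 ≤ r) (hs : 0 ≤ s)
    (hrp : r ≤ p) (hrn : r ≤ n)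
    (h₁ : t₁ ≤ p * n + K₂ * p * n * r ^ (ω - 2)) (h₂ : t₂ ≤ K * max r q * r ^ (ω - 1))
    (h₃ : t₃ ≤ (C + 1) * (q + r) * (n + r) * r ^ (ω - 2))
    (h₄ : t₄ ≤ q * n + K₂ * q * n * s ^ (ω - 2)) :
    t₁ + (t₂ + (t₃ + t₄)) ≤ (p + q) * n + K₂ * (p + q) * n * (r + s) ^ (ω - 2) := by
  have hp : 0 ≤ p := hr.trans hrp
  have hn : 0 ≤ n := hr.trans hrn
  have hrs : r ^ (ω - 2) ≤ (r + s) ^ (ω - 2) :=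
    Real.rpow_le_rpow hr (le_add_of_nonneg_right hs) (by linarith)
  have hsolve : t₂ ≤ K * (p + q) * (n * (r + s) ^ (ω - 2)) := by
    rw [rpow_sub_one_eq_mul_rpow_sub_two hr hω] at h₂
    refine h₂.trans ?_
    gcongr
    exact max_le (by linarith) (by linarith)
  have hmul : t₃ ≤ (C + 1) * (p + q) * (2 * n) * (r + s) ^ (ω - 2) := by
    refine h₃.trans ?_
    gcongr ?_ * ?_ * ?_ * ?_ <;> linarith
  have hrec := mul_le_mul_of_nonneg_left
    (mul_rpow_add_mul_rpow_le hω hω3 hp hq hpq hp3 hq3 hr hs) (mul_nonneg hK₂0 hn)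
  have hpay := mul_le_mul_of_nonneg_right hK₂
    (mul_nonneg (mul_nonneg hpq.le hn) (Real.rpow_nonneg (add_nonneg hr hs) (ω - 2)))
  linarith

variable {ω C : ℝ} {mm : ∀ n : ℕ, AddrMatrix n n → AddrMatrix n n → Prog k (AddrMatrix n n)}

theorem runs_echelonFactor (h : IsMatMul ω C mm) (hω : 2 < ω) (hω3 : ω ≤ 3) {K K₂ : ℝ}
    (hK1 : 1 ≤ K) (hK : 2 * (C + 1) ≤ K * (1 - (2 / 3) ^ (ω - 2))) (hK₂0 : 0 ≤ K₂)
    (hK₂ : K + 2 * (C + 1) ≤ K₂ * (1 - (2 / 3) ^ (ω - 2))) (n m : ℕ) {A : ℕ → ℕ → ℕ}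
    {a : ℕ → ℕ → F} {μ : List F} (hA : Stores μ m n A a) :
    (echelonFactor mm n m A).Runs μ fun f ν t =>
      f.Factors ν a m n ∧ (t : ℝ) ≤ m * n + K₂ * m * n * (f.r : ℝ) ^ (ω - 2) := by
  induction m using Nat.strong_induction_on generalizing A a μ with
  | _ m ih =>
  rw [echelonFactor]
  split_ifs with h0 h1
  · subst h0
    exact Prog.runs_pure ⟨⟨a, a, fun t ht => absurd ht t.not_lt_zero,
      fun t ht => absurd ht t.not_lt_zero, .of_eq_zero fun i hi => absurd hi i.not_lt_zero⟩,
      by simp⟩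
  · subst h1
    refine (runs_rowFactor hA).mono fun f ν t _ ⟨hf, ht⟩ => ⟨hf, ?_⟩
    have ht' : (t : ℝ) ≤ n := Nat.cast_le.mpr ht
    have : 0 ≤ K₂ * n * (f.r : ℝ) ^ (ω - 2) := by positivity
    rw [Nat.cast_one]
    linarith
  · obtain ⟨p, q, hp, hq, rfl, hp3, hq3⟩ := exists_halves (show 2 ≤ m by omega)
    rw [← hq, ← hp]
    refine (ih p (by omega) fun i hi => hA i (by omega)).bind
      fun f ν₁ t₁ hν₁ ⟨⟨c, u, hC, hU, hf⟩, ht₁⟩ => ?_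
    refine (runs_triSolve h hω hK1 hK q f.r (l := fun i j => u j (f.γ i))
      (b := fun i j => a (p + j) (f.γ i)) (fun i hi j hj => hU j hj _ (hf.rows.pivot_lt i hi))
      (fun i hi j hj => hA.mono hν₁ (p + j) (by omega) _ (hf.rows.pivot_lt i hi))
      hf.rows.pivot_ne_zero fun i j hij hj => hf.rows.eq_zero_at_pivot j hj i hij).bind
      fun X ν₂ t₂ hν₂ ⟨x, hX, hx, ht₂⟩ => ?_
    refine (runs_blockSubMul h hω (m := q) (r := f.r) (n := n) (b := fun i j => a (p + i) j)
      (x := fun i j => x j i)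
      (fun i hi j hj => hA.mono (hν₁.trans hν₂) (p + i) (by omega) j hj)
      (fun i hi j hj => hX j hj i hi) (hU.mono hν₂)).bind fun A' ν₃ t₃ hν₃ ⟨hA', ht₃⟩ => ?_
    refine (ih q (by omega) hA').bind fun g ν₄ t₄ hν₄ ⟨⟨c', u', hC', hU', hg⟩, ht₄⟩ => ?_
    refine (Prog.runs_const 0 ν₄).bind ?_
    rintro z ν₅ _ hν₅ ⟨hz, rfl⟩
    rw [map_zero] at hz
    have hν₃₅ := hν₃.trans (hν₄.trans hν₅)
    refine Prog.runs_pure ⟨.append (hC.mono (hν₂.trans hν₃₅)) (hU.mono (hν₂.trans hν₃₅)) hf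
      (hX.mono hν₃₅) hx hz ⟨c', u', hC'.mono hν₅, hU'.mono hν₅, hg⟩, ?_⟩
    simpa [EchelonData.append] using echelonFactor_cost_le hω hω3 h.nonneg (by linarith) hK₂0 hK₂
      q.cast_nonneg (by exact_mod_cast show 0 < p + q by omega) hp3 hq3
      f.r.cast_nonneg g.r.cast_nonneg (Nat.cast_le.mpr hf.cols.length_le)
      (Nat.cast_le.mpr hf.rows.length_le) ht₁ ht₂ ht₃ ht₄

end Programs

/-! ## The four subroutines -/

theorem exists_perm_extending {m r : ℕ} (hr : r ≤ m) {ρ : ℕ → ℕ} (hm : ∀ t < r, ρ t < m)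
    (hρ : Function.Injective fun t : Fin r => ρ t) :
    ∃ σ : Equiv.Perm (Fin m), ∀ t : Fin r, (σ (t.castLE hr) : ℕ) = ρ t := by
  classical
  let g : {x : Fin m // x.1 < r} → Fin m := fun x => ⟨ρ x.1, hm _ x.2⟩
  have hg : Function.Injective g := fun x y h => Subtype.ext <| Fin.ext <|
    Fin.mk.inj (@hρ ⟨x.1, x.2⟩ ⟨y.1, y.2⟩ (Fin.mk.inj h))
  let e : {x : Fin m // x.1 < r} ≃ {y : Fin m // y ∈ Set.range g} := Equiv.ofInjective g hg
  exact ⟨e.extendSubtype, fun t => by rw [Equiv.extendSubtype_apply_of_mem e _ t.2]; rfl⟩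

theorem AddrMatrix.Valid.stores {F : Type u} [Field F] {m n : ℕ} {X : AddrMatrix m n} {μ : List F}
    (h : X.Valid μ) : Stores μ m n (extendZero X) (extendZero (X.load μ)) := by
  intro i hi j hj
  rw [extendZero_apply _ hi hj, extendZero_apply _ hi hj]
  exact h.holds_load _ _

section Echelon

variable {F : Type u} [Field F]

theorem IsEchelonFactorization.isPivotFamily {a : ℕ → ℕ → F} {m n r : ℕ} {ρ γ : ℕ → ℕ}
    {c u : ℕ → ℕ → F} (h : IsEchelonFactorization a m n r ρ γ c u) :
    IsPivotFamily a m n (fun t : Fin r => ρ t) fun t => γ t :=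
  .of_echelon (c := fun i t => c t i) (u := fun t => u t)
    (fun t => h.cols.pivot_lt t t.2) (fun t => h.rows.pivot_lt t t.2)
    h.cols.pivot_injective h.rows.pivot_injective
    (fun i t hi => h.cols.eq_zero_of_lt_pivot t t.2 i hi) (fun t => h.cols.pivot_ne_zero t t.2)
    (fun t j hj => h.rows.eq_zero_of_lt_pivot t t.2 j hj) (fun t => h.rows.pivot_ne_zero t t.2)
    fun i hi j hj => by rw [h.eq_sum i hi j hj, Finset.sum_range]

theorem IsEchelonFactorization.rank_eq {m n r : ℕ} {A : Matrix (Fin m) (Fin n) F} {ρ γ : ℕ → ℕ}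
    {c u : ℕ → ℕ → F} (h : IsEchelonFactorization (extendZero A) m n r ρ γ c u) : A.rank = r := by
  rw [rank_eq_blockRank, h.isPivotFamily.blockRank_full, Nat.card_eq_fintype_card,
    Fintype.card_fin]

namespace EchelonData

variable {m n : ℕ} (f : EchelonData)

/-- The factors of an echelon factorization, with rows and columns permuted by `σ` and `τ`. -/
def permute (hm : f.r ≤ m) (hn : f.r ≤ n) (σ : Equiv.Perm (Fin m)) (τ : Equiv.Perm (Fin n)) :
    PLUQ m n where
  r := f.r
  r_le_rows := hm
  r_le_cols := hn
  P := σ.symm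
  Q := τ
  L := fun i t => f.C t (σ i)
  U := fun t j => f.U t (τ j)

open Classical in
/-- The PLUQ decomposition contained in an echelon factorization: the permutations move the pivots
to the front. The value `0` of the other branch is never used. -/
noncomputable def toPLUQ (m n : ℕ) (f : EchelonData) : PLUQ m n :=
  if h : ∃ (hm : f.r ≤ m) (hn : f.r ≤ n) (p : Equiv.Perm (Fin m) × Equiv.Perm (Fin n)),
      (∀ t : Fin f.r, (p.1 (t.castLE hm) : ℕ) = f.ρ t) ∧
      ∀ t : Fin f.r, (p.2 (t.castLE hn) : ℕ) = f.γ t then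
    f.permute h.choose h.choose_spec.choose h.choose_spec.choose_spec.choose.1
      h.choose_spec.choose_spec.choose.2
  else permute ⟨0, 0, 0, 0, 0⟩ m.zero_le n.zero_le 1 1

variable {f} {A : Matrix (Fin m) (Fin n) F} {μ : List F}

theorem Factors.decomposes_permute (h : f.Factors μ (extendZero A) m n) (hm : f.r ≤ m)
    (hn : f.r ≤ n) {σ : Equiv.Perm (Fin m)} {τ : Equiv.Perm (Fin n)}
    (hσ : ∀ t : Fin f.r, (σ (t.castLE hm) : ℕ) = f.ρ t)
    (hτ : ∀ t : Fin f.r, (τ (t.castLE hn) : ℕ) = f.γ t) :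
    (f.permute hm hn σ τ).Decomposes μ A := by
  obtain ⟨c, u, hC, hU, hf⟩ := h
  obtain ⟨hLvalid, hL⟩ := (AddrMatrix.holds_iff (X := (f.permute hm hn σ τ).L)
    (A := Matrix.of fun i t => c t (σ i))).mp fun i t => hC t t.2 _ (σ i).2
  obtain ⟨hUvalid, hU⟩ := (AddrMatrix.holds_iff (X := (f.permute hm hn σ τ).U)
    (A := Matrix.of fun t j => u t (τ j))).mp fun t j => hU t t.2 _ (τ j).2
  have hσ' (i : Fin m) (hi : i.1 < f.r) : (σ i : ℕ) = f.ρ i := hσ ⟨i, hi⟩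
  have hτ' (j : Fin n) (hj : j.1 < f.r) : (τ j : ℕ) = f.γ j := hτ ⟨j, hj⟩
  refine ⟨hLvalid, hUvalid, hf.rank_eq.symm, fun i t hit => ?_, fun i t hit => ?_,
    fun t j hjt => ?_, ?_, ?_⟩
  · rw [hL, Matrix.of_apply, hσ' i (hit ▸ t.2), hit]
    exact hf.col_pivot_eq_one t t.2
  · rw [hL, Matrix.of_apply, hσ' i (hit.trans t.2)]
    exact hf.cols.eq_zero_at_pivot t t.2 i hit
  · rw [hU, Matrix.of_apply, hτ' j (hjt.trans t.2)]
    exact hf.rows.eq_zero_at_pivot t t.2 j hjt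
  · rw [hL, hU]
    ext i j
    have hsum := hf.eq_sum i i.2 j j.2
    rw [extendZero_apply A i.2 j.2, Finset.sum_range] at hsum
    rw [Matrix.mul_assoc (Equiv.Perm.permMatrix F _), permMatrix_mul_mul_permMatrix_apply,
      Matrix.mul_apply]
    change A i j = ∑ t : Fin f.r, c t (σ (σ.symm i)) * u t (τ (τ.symm j))
    simpa only [Equiv.apply_symm_apply] using hsum
  · classical
    change IsRankProfileMatrix A (Equiv.Perm.permMatrix F σ.symm * idBlock F m n f.r *
      Equiv.Perm.permMatrix F τ)
    refine hf.isPivotFamily.isRankProfileMatrix fun i j => ?_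
    simp only [← hσ, ← hτ, Fin.val_inj]
    convert permMatrix_mul_idBlock_mul_permMatrix_apply hm hn σ.symm τ i j
    exact σ.symm_symm.symm

theorem Factors.decomposes (h : f.Factors μ (extendZero A) m n) :
    (f.toPLUQ m n).Decomposes μ A := by
  have hex : ∃ (hm : f.r ≤ m) (hn : f.r ≤ n) (p : Equiv.Perm (Fin m) × Equiv.Perm (Fin n)),
      (∀ t : Fin f.r, (p.1 (t.castLE hm) : ℕ) = f.ρ t) ∧
      ∀ t : Fin f.r, (p.2 (t.castLE hn) : ℕ) = f.γ t := by
    obtain ⟨_, _, _, _, hf⟩ := h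
    obtain ⟨σ, hσ⟩ := exists_perm_extending hf.cols.length_le hf.cols.pivot_lt
      hf.cols.pivot_injective
    obtain ⟨τ, hτ⟩ := exists_perm_extending hf.rows.length_le hf.rows.pivot_lt
      hf.rows.pivot_injective
    exact ⟨hf.cols.length_le, hf.rows.length_le, (σ, τ), hσ, hτ⟩
  rw [toPLUQ, dif_pos hex]
  exact h.decomposes_permute _ _ hex.choose_spec.choose_spec.choose_spec.1
    hex.choose_spec.choose_spec.choose_spec.2

end EchelonData

end Echelon

section FastSubroutines

variable {k : Type u} [Field k]
  (mm : ∀ n : ℕ, AddrMatrix n n → AddrMatrix n n → Prog k (AddrMatrix n n))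

/-- Solution of a lower triangular system, on matrices with bounded indices. -/
def solveLower (r n : ℕ) (L : AddrMatrix r r) (B : AddrMatrix r n) : Prog k (AddrMatrix r n) := do
  let X ← triSolve mm n r (extendZero L) (extendZero B)
  pure fun i j => X i j

/-- The subroutines of the algorithm, built on a matrix product. -/
noncomputable def fastSubroutines : Subroutines k where
  pluq m n A := do
    let f ← echelonFactor mm n m (extendZero A)
    pure (f.toPLUQ m n)
  lowerSolve := solveLower mm
  upperSolve m r C U := do
    let X ← solveLower mm r m U.transpose C.transpose
    pure X.transpose
  subMul m r n B X Y := do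
    let D ← blockSubMul mm m r n (extendZero B) (extendZero X) (extendZero Y)
    pure fun i j => D i j

variable {mm} {ω C K K₂ : ℝ} {F : Type u} [Field F] [Algebra k F]

theorem runs_fast_pluq (h : IsMatMul ω C mm) (hω : 2 < ω) (hω3 : ω ≤ 3) (hK1 : 1 ≤ K)
    (hK : 2 * (C + 1) ≤ K * (1 - (2 / 3) ^ (ω - 2))) (hK₂0 : 0 ≤ K₂)
    (hK₂ : K + 2 * (C + 1) ≤ K₂ * (1 - (2 / 3) ^ (ω - 2)))
    {m n : ℕ} {A : AddrMatrix m n} {μ : List F} (hA : A.Valid μ) :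
    ((fastSubroutines mm).pluq m n A).Runs μ fun f ν c => f.Decomposes ν (A.load μ) ∧
      (c : ℝ) ≤ m * n + K₂ * m * n * ((A.load μ).rank : ℝ) ^ (ω - 2) := by
  refine (runs_echelonFactor h hω hω3 hK1 hK hK₂0 hK₂ n m hA.stores).bind
    fun f ν c _ ⟨hf, hc⟩ => Prog.runs_pure ⟨hf.decomposes, ?_⟩
  obtain ⟨_, _, _, _, hf⟩ := hf
  simpa [hf.rank_eq] using hc

theorem runs_solveLower (h : IsMatMul ω C mm) (hω : 2 < ω) (hK1 : 1 ≤ K)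
    (hK : 2 * (C + 1) ≤ K * (1 - (2 / 3) ^ (ω - 2)))
    {r n : ℕ} {L : AddrMatrix r r} {B : AddrMatrix r n} {μ : List F}
    (hL : L.Valid μ) (hB : B.Valid μ) (hdiag : ∀ i, L.load μ i i ≠ 0)
    (hlow : ∀ i j, i < j → L.load μ i j = 0) :
    (solveLower mm r n L B).Runs μ fun X ν c =>
      (X.Valid ν ∧ X.load ν = (L.load μ)⁻¹ * B.load μ) ∧
      (c : ℝ) ≤ K * max (r : ℝ) n * (r : ℝ) ^ (ω - 1) := by
  refine (runs_triSolve h hω hK1 hK n r hL.stores hB.stores (fun i hi => ?_)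
    fun i j hij hj => ?_).bind fun X ν c _ ⟨x, hX, hx, hc⟩ => ?_
  · rw [extendZero_apply _ hi hi]
    exact hdiag _
  · rw [extendZero_apply _ (hij.trans hj) hj]
    exact hlow _ _ hij
  obtain ⟨hvalid, hload⟩ := (AddrMatrix.holds_iff (X := fun (i : Fin r) (j : Fin n) => X i j)
    (A := Matrix.of fun (i : Fin r) (j : Fin n) => x i j)).mp fun i j => hX i i.2 j j.2
  refine Prog.runs_pure ⟨⟨hvalid, ?_⟩, by simpa using hc⟩
  have hmul : L.load μ * (Matrix.of fun (i : Fin r) (j : Fin n) => x i j) = B.load μ := by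
    ext i j
    have hsum := hx i i.2 j j.2
    rw [extendZero_apply _ i.2 j.2, Finset.sum_range] at hsum
    rw [Matrix.mul_apply, ← hsum]
    exact Finset.sum_congr rfl fun t _ => by rw [extendZero_apply _ i.2 t.2]; rfl
  have hdet : IsUnit (L.load μ).det := by
    rw [Matrix.det_of_isLowerTriangular _ fun i j hij => hlow i j hij, isUnit_iff_ne_zero]
    exact Finset.prod_ne_zero_iff.mpr fun i _ => hdiag i
  rw [hload, ← hmul, Matrix.nonsing_inv_mul_cancel_left _ _ hdet]

theorem runs_fast_upperSolve (h : IsMatMul ω C mm) (hω : 2 < ω) (hK1 : 1 ≤ K)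
    (hK : 2 * (C + 1) ≤ K * (1 - (2 / 3) ^ (ω - 2)))
    {m r : ℕ} {B : AddrMatrix m r} {U : AddrMatrix r r} {μ : List F}
    (hB : B.Valid μ) (hU : U.Valid μ) (hdiag : ∀ i, U.load μ i i ≠ 0)
    (hup : ∀ i j, j < i → U.load μ i j = 0) :
    ((fastSubroutines mm).upperSolve m r B U).Runs μ fun X ν c =>
      (X.Valid ν ∧ X.load ν = B.load μ * (U.load μ)⁻¹) ∧
      (c : ℝ) ≤ K * max (r : ℝ) m * (r : ℝ) ^ (ω - 1) := by
  refine (runs_solveLower h hω hK1 hK (L := U.transpose) (B := B.transpose)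
    (fun i j => hU j i) (fun i j => hB j i) hdiag fun i j hij => hup j i hij).bind
    fun X ν c _ ⟨⟨hvalid, hload⟩, hc⟩ =>
      Prog.runs_pure ⟨⟨fun i j => hvalid j i, ?_⟩, by simpa using hc⟩
  change (X.load ν).transpose = _
  rw [hload]
  change ((U.load μ).transpose⁻¹ * (B.load μ).transpose).transpose = _
  rw [← Matrix.transpose_nonsing_inv, ← Matrix.transpose_mul, Matrix.transpose_transpose]

theorem runs_fast_subMul (h : IsMatMul ω C mm) (hω : 2 < ω) {m r n : ℕ} {B : AddrMatrix m n}
    {X : AddrMatrix m r} {Y : AddrMatrix r n} {μ : List F} (hB : B.Valid μ) (hX : X.Valid μ)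
    (hY : Y.Valid μ) :
    ((fastSubroutines mm).subMul m r n B X Y).Runs μ fun D ν c =>
      (D.Valid ν ∧ D.load ν = B.load μ - X.load μ * Y.load μ) ∧
      (c : ℝ) ≤ (C + 1) * (m + r) * (n + r) * (r : ℝ) ^ (ω - 2) := by
  refine (runs_blockSubMul h hω hB.stores hX.stores hY.stores).bind fun D ν c _ ⟨hD, hc⟩ =>
    Prog.runs_pure ⟨AddrMatrix.holds_iff.mp fun i j => ?_, by simpa using hc⟩
  rw [hD i i.2 j j.2, Matrix.sub_apply, Matrix.mul_apply]
  simp only [extendZero_apply _ i.2 j.2, Finset.sum_range, extendZero_apply _ i.2 (Fin.is_lt _),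
    extendZero_apply _ (Fin.is_lt _) j.2, Fin.eta]

theorem exists_le_mul_one_sub_rpow (hω : 2 < ω) (b : ℝ) :
    ∃ K : ℝ, 1 ≤ K ∧ b ≤ K * (1 - (2 / 3) ^ (ω - 2)) :=
  ⟨max 1 (b / (1 - (2 / 3) ^ (ω - 2))), le_max_left _ _,
    (div_le_iff₀ (sub_pos.mpr (Real.rpow_lt_one (by norm_num) (by norm_num)
      (by linarith)))).mp (le_max_right _ _)⟩

theorem correctOver_fastSubroutines (h : IsMatMul ω C mm) (hω : 2 < ω) (hω3 : ω ≤ 3) :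
    (fastSubroutines mm).CorrectOver F := by
  obtain ⟨K, hK1, hK⟩ := exists_le_mul_one_sub_rpow hω (2 * (C + 1))
  obtain ⟨K₂, hK₂1, hK₂⟩ := exists_le_mul_one_sub_rpow hω (K + 2 * (C + 1))
  exact
    { pluq_spec := fun _ _ _ _ hA =>
        (runs_fast_pluq h hω hω3 hK1 hK (zero_le_one.trans hK₂1) hK₂ hA).1
      lowerSolve_spec := fun _ _ _ _ _ hL hB hdiag hlow =>
        (runs_solveLower h hω hK1 hK hL hB (fun i => hdiag i ▸ one_ne_zero) hlow).1
      upperSolve_spec := fun _ _ _ _ _ hB hU hdiag hup =>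
        (runs_fast_upperSolve h hω hK1 hK hB hU hdiag hup).1
      subMul_spec := fun _ _ _ _ _ _ _ hB hX hY => (runs_fast_subMul h hω hB hX hY).1 }

theorem costOver_fastSubroutines (h : IsMatMul ω C mm) (hω : 2 < ω) (hω3 : ω ≤ 3) (hK1 : 1 ≤ K)
    (hK : 2 * (C + 1) ≤ K * (1 - (2 / 3) ^ (ω - 2))) (hK₂0 : 0 ≤ K₂)
    (hK₂ : K + 2 * (C + 1) ≤ K₂ * (1 - (2 / 3) ^ (ω - 2))) :
    (fastSubroutines mm).CostOver F ω (1 + K + K₂ + C) := by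
  have hC := h.nonneg
  have hpow (r : ℕ) : (r : ℝ) ^ (ω - 2) ≤ max 1 (r : ℝ) ^ (ω - 2) :=
    Real.rpow_le_rpow r.cast_nonneg (le_max_right _ _) (by linarith)
  have hpluq : 1 + K₂ ≤ 1 + K + K₂ + C := by linarith
  have hsubMul : C + 1 ≤ 1 + K + K₂ + C := by linarith
  have hone (r : ℕ) : 1 ≤ max 1 (r : ℝ) ^ (ω - 2) :=
    Real.one_le_rpow (le_max_left _ _) (by linarith)
  constructor
  · intro m n A μ hA
    calc ((((fastSubroutines mm).pluq m n A).cost μ : ℕ) : ℝ)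
        ≤ m * n + K₂ * m * n * ((A.load μ).rank : ℝ) ^ (ω - 2) :=
          (runs_fast_pluq h hω hω3 hK1 hK hK₂0 hK₂ hA).2
      _ ≤ m * n * max 1 ((A.load μ).rank : ℝ) ^ (ω - 2) +
            K₂ * m * n * max 1 ((A.load μ).rank : ℝ) ^ (ω - 2) :=
          add_le_add (le_mul_of_one_le_right (by positivity) (hone _))
            (mul_le_mul_of_nonneg_left (hpow _) (by positivity))
      _ = (1 + K₂) * m * n * max 1 ((A.load μ).rank : ℝ) ^ (ω - 2) := by ring
      _ ≤ (1 + K + K₂ + C) * m * n * max 1 ((A.load μ).rank : ℝ) ^ (ω - 2) := by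
          gcongr
  · intro r n L B μ hL hB hdiag hlow
    refine (runs_solveLower h hω hK1 hK hL hB (fun i => hdiag i ▸ one_ne_zero) hlow).2.trans ?_
    gcongr
    linarith
  · intro m r B U μ hB hU hdiag hup
    refine (runs_fast_upperSolve h hω hK1 hK hB hU hdiag hup).2.trans ?_
    gcongr
    linarith
  · intro m r n B X Y μ hB hX hY
    refine (runs_fast_subMul h hω hB hX hY).2.trans ?_
    gcongr
    exact le_max_right _ _

theorem MatMulExponent.exists_subroutines (hmm : MatMulExponent k ω) (hω : 2 < ω) (hω3 : ω ≤ 3) :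
    ∃ (c : ℝ) (S : Subroutines k), ∀ (F : Type u) [Field F] [Algebra k F],
      S.CorrectOver F ∧ S.CostOver F ω c := by
  obtain ⟨C, mm, h⟩ := hmm
  obtain ⟨K, hK1, hK⟩ := exists_le_mul_one_sub_rpow hω (2 * (C + 1))
  obtain ⟨K₂, hK₂1, hK₂⟩ := exists_le_mul_one_sub_rpow hω (K + 2 * (C + 1))
  exact ⟨1 + K + K₂ + C, fastSubroutines mm, fun F _ _ => ⟨correctOver_fastSubroutines h hω hω3,
    costOver_fastSubroutines h hω hω3 hK1 hK (zero_le_one.trans hK₂1) hK₂⟩⟩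

end FastSubroutines

/-! ## The elimination step of LT-RPM -/

section

variable {F : Type u} [Field F]

/-- What one elimination step achieves for the matrix `[A₁ A₂; A₃ *]` with entries `a`, where `A₁`
has size `m × d`: the list `l` of the pivots of `A₁`, and matrices `H` and `I` that account for the
leading ranks to the right of `A₁` and below `A₁`. -/
structure IsElimination (a : ℕ → ℕ → F) {m d w v : ℕ} (l : List (ℕ × ℕ))
    (H : Matrix (Fin m) (Fin w) F) (I : Matrix (Fin v) (Fin d) F) : Prop where
  nodup : l.Nodup
  mem_iff : ∀ p, p ∈ l ↔ p.1 < m ∧ p.2 < d ∧ PivotAt a p.1 p.2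
  blockRank_right : ∀ p ≤ m, ∀ q ≤ w,
    blockRank a p (d + q) = blockRank a p d + blockRank (extendZero H) p q
  blockRank_below : ∀ p ≤ v, ∀ q ≤ d,
    blockRank a (m + p) q = blockRank a m q + blockRank (extendZero I) p q

namespace IsElimination

variable {a : ℕ → ℕ → F} {m d w v : ℕ} {l : List (ℕ × ℕ)} {H : Matrix (Fin m) (Fin w) F}
  {I : Matrix (Fin v) (Fin d) F}

theorem pivotAt_right (h : IsElimination a l H I) {i j : ℕ} (hi : i < m) (hj : j < w) :
    PivotAt a i (d + j) ↔ PivotAt (extendZero H) i j :=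
  pivotAt_add_right h.blockRank_right hi hj

theorem pivotAt_below (h : IsElimination a l H I) {i j : ℕ} (hi : i < v) (hj : j < d) :
    PivotAt a (m + i) j ↔ PivotAt (extendZero I) i j := by
  rw [← pivotAt_swap, ← pivotAt_swap (f := extendZero I)]
  refine pivotAt_add_right (m := d) (w := v) (fun q hq p hp => ?_) hj hi
  rw [blockRank_swap a, blockRank_swap a, blockRank_swap (extendZero I)]
  exact h.blockRank_below p hp q hq

end IsElimination

end

/-- The `i`-th index after the first `r` ones. -/
def tailIndex {r n : ℕ} (i : Fin (n - r)) : Fin n := ⟨r + i, Nat.add_lt_of_lt_sub' i.2⟩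

theorem tailIndex_sub {r n : ℕ} {i : Fin n} (h : r ≤ i) :
    tailIndex ⟨i - r, Nat.sub_lt_sub_right h i.2⟩ = i :=
  Fin.ext (Nat.add_sub_of_le h)

namespace PLUQ

variable {m d w v : ℕ} (f : PLUQ m d)

/-- The addresses of `P [0; Z]`, where `z` is the address of a zero. -/
def scatterRows (Z : AddrMatrix (m - f.r) w) (z : ℕ) : AddrMatrix m w := fun i j =>
  if h : f.r ≤ f.P i then Z ⟨f.P i - f.r, Nat.sub_lt_sub_right h (f.P i).2⟩ j else z

/-- The addresses of `[0 Z] Q`, where `z` is the address of a zero. -/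
def scatterCols (Z : AddrMatrix v (d - f.r)) (z : ℕ) : AddrMatrix v d := fun i j =>
  if h : f.r ≤ f.Q.symm j then Z i ⟨f.Q.symm j - f.r, Nat.sub_lt_sub_right h (f.Q.symm j).2⟩ else z

variable {f} {F : Type u} [Field F] {μ : List F} {z : ℕ}

theorem holds_scatterRows {Z : AddrMatrix (m - f.r) w} {L : Matrix (Fin m) (Fin f.r) F}
    {D : Matrix (Fin f.r) (Fin w) F} {B : Matrix (Fin m) (Fin w) F}
    (hD : L.submatrix (Fin.castLE f.r_le_rows) id * D = B.submatrix f.pivotRow id)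
    (hZ : Z.Holds μ (B.submatrix (f.P.symm ∘ tailIndex) id - L.submatrix tailIndex id * D))
    (hz : μ[z]? = some 0) :
    (f.scatterRows Z z).Holds μ (B - L.submatrix f.P id * D) := by
  intro i j
  unfold scatterRows
  split_ifs with hi
  · rw [hZ]
    simp [Matrix.mul_apply, tailIndex_sub hi]
  · have hrow := congrFun (congrFun hD ⟨f.P i, not_le.mp hi⟩) j
    have hcast : Fin.castLE f.r_le_rows ⟨f.P i, not_le.mp hi⟩ = f.P i := rfl
    simp only [Matrix.mul_apply, Matrix.submatrix_apply, id_eq, pivotRow, hcast,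
      Equiv.symm_apply_apply] at hrow
    simp [Matrix.mul_apply, hrow, hz]

theorem holds_scatterCols {Z : AddrMatrix v (d - f.r)} {U : Matrix (Fin f.r) (Fin d) F}
    {E : Matrix (Fin v) (Fin f.r) F} {B : Matrix (Fin v) (Fin d) F}
    (hE : E * U.submatrix id (Fin.castLE f.r_le_cols) = B.submatrix id f.pivotCol)
    (hZ : Z.Holds μ (B.submatrix id (f.Q ∘ tailIndex) - E * U.submatrix id tailIndex))
    (hz : μ[z]? = some 0) :
    (f.scatterCols Z z).Holds μ (B - E * U.submatrix id f.Q.symm) := by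
  intro i j
  unfold scatterCols
  split_ifs with hj
  · rw [hZ]
    simp [Matrix.mul_apply, tailIndex_sub hj]
  · have hcol := congrFun (congrFun hE i) ⟨f.Q.symm j, not_le.mp hj⟩
    have hcast : Fin.castLE f.r_le_cols ⟨f.Q.symm j, not_le.mp hj⟩ = f.Q.symm j := rfl
    simp only [Matrix.mul_apply, Matrix.submatrix_apply, id_eq, pivotCol, hcast,
      Equiv.apply_symm_apply] at hcol
    simp [Matrix.mul_apply, hcol, hz]

theorem Decomposes.isElimination {f : PLUQ m d} {A : Matrix (Fin m) (Fin d) F}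
    (h : f.Decomposes μ A) {a : ℕ → ℕ → F} (h₁ : ∀ i j, A i j = a i j)
    {B : Matrix (Fin m) (Fin w) F} (h₂ : ∀ i j, B i j = a i (d + j))
    {C : Matrix (Fin v) (Fin d) F} (h₃ : ∀ i j, C i j = a (m + i) j)
    {D : Matrix (Fin f.r) (Fin w) F} {E : Matrix (Fin v) (Fin f.r) F}
    (hD : (f.L.load μ).submatrix (Fin.castLE f.r_le_rows) id * D = B.submatrix f.pivotRow id)
    (hE : E * (f.U.load μ).submatrix id (Fin.castLE f.r_le_cols) = C.submatrix id f.pivotCol) :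
    IsElimination a f.pivots (B - (f.L.load μ).submatrix f.P id * D)
      (C - E * (f.U.load μ).submatrix id f.Q.symm) where
  nodup := f.nodup_pivots
  mem_iff := h.mem_pivots_iff h₁
  blockRank_right := h.blockRank_add_right h₁
    (fun s j => (congrFun (congrFun hD s) j).trans (h₂ _ _))
    fun i j => congrArg (· - _) (h₂ i j)
  blockRank_below := h.blockRank_add_below h₁
    (fun i s => (congrFun (congrFun hE i) s).trans (h₃ _ _))
    fun i j => congrArg (· - _) (h₃ i j)

end PLUQ

namespace Subroutines

variable {k : Type u} [Field k] (S : Subroutines k)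

/-- The elimination step of LT-RPM on a matrix `[A₁ A₂; A₃ *]`. It returns the list of the pivots
of `A₁` and the matrices `H` and `I`. -/
def eliminate {m d w v : ℕ} (A₁ : AddrMatrix m d) (A₂ : AddrMatrix m w) (A₃ : AddrMatrix v d) :
    Prog k (List (ℕ × ℕ) × AddrMatrix m w × AddrMatrix v d) := do
  let f ← S.pluq m d A₁
  let D ← S.lowerSolve f.r w (f.L.submatrix (Fin.castLE f.r_le_rows) id)
    (A₂.submatrix f.pivotRow id)
  let E ← S.upperSolve v f.r (A₃.submatrix id f.pivotCol)
    (f.U.submatrix id (Fin.castLE f.r_le_cols))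
  let Z ← S.subMul (m - f.r) f.r w (A₂.submatrix (f.P.symm ∘ tailIndex) id)
    (f.L.submatrix tailIndex id) D
  let W ← S.subMul v f.r (d - f.r) (A₃.submatrix id (f.Q ∘ tailIndex)) E
    (f.U.submatrix id tailIndex)
  let z ← Prog.const 0
  pure (f.pivots, f.scatterRows Z z, f.scatterCols W z)

variable {S} {F : Type u} [Field F] [Algebra k F]

theorem CostOver.nonneg {ω c : ℝ} (h : S.CostOver F ω c) : 0 ≤ c := by
  have hcost := (Nat.cast_nonneg (α := ℝ) _).trans
    (h.pluq_cost 1 1 (fun _ _ => 0) [0] fun _ _ => by simp)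
  rw [Nat.cast_one, mul_one, mul_one] at hcost
  exact nonneg_of_mul_nonneg_left hcost (Real.rpow_pos_of_pos (lt_max_of_lt_left one_pos) _)

namespace CorrectOver

variable (hS : S.CorrectOver F) {μ : List F}

include hS

theorem runs_pluq {m n : ℕ} {A : AddrMatrix m n} {A' : Matrix (Fin m) (Fin n) F}
    (hA : A.Holds μ A') :
    (S.pluq m n A).Runs μ fun f ν t => f.Decomposes ν A' ∧
      ∀ ω c, S.CostOver F ω c → (t : ℝ) ≤ c * m * n * max 1 (f.r : ℝ) ^ (ω - 2) := by
  obtain ⟨hvalid, rfl⟩ := AddrMatrix.holds_iff.mp hA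
  have hspec := hS.pluq_spec m n A μ hvalid
  exact ⟨hspec, fun ω c hc => hspec.r_eq_rank ▸ hc.pluq_cost m n A μ hvalid⟩

theorem runs_lowerSolve {r n : ℕ} {L : AddrMatrix r r} {B : AddrMatrix r n}
    {L' : Matrix (Fin r) (Fin r) F} {B' : Matrix (Fin r) (Fin n) F} (hL : L.Holds μ L')
    (hB : B.Holds μ B') (hdiag : ∀ i, L' i i = 1) (hlow : ∀ i j, i < j → L' i j = 0) :
    (S.lowerSolve r n L B).Runs μ fun D ν t => (∃ D', D.Holds ν D' ∧ L' * D' = B') ∧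
      ∀ ω c, S.CostOver F ω c → (t : ℝ) ≤ c * max (r : ℝ) n * (r : ℝ) ^ (ω - 1) := by
  obtain ⟨hLvalid, rfl⟩ := AddrMatrix.holds_iff.mp hL
  obtain ⟨hBvalid, rfl⟩ := AddrMatrix.holds_iff.mp hB
  have hdet : IsUnit (L.load μ).det := by
    rw [Matrix.det_of_isLowerTriangular _ fun i j hij => hlow i j hij]
    simp [hdiag]
  exact ⟨⟨_, AddrMatrix.holds_iff.mpr (hS.lowerSolve_spec r n L B μ hLvalid hBvalid hdiag hlow),
    Matrix.mul_nonsing_inv_cancel_left _ _ hdet⟩,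
    fun ω c hc => hc.lowerSolve_cost r n L B μ hLvalid hBvalid hdiag hlow⟩

theorem runs_upperSolve {m r : ℕ} {C : AddrMatrix m r} {U : AddrMatrix r r}
    {C' : Matrix (Fin m) (Fin r) F} {U' : Matrix (Fin r) (Fin r) F} (hC : C.Holds μ C')
    (hU : U.Holds μ U') (hdiag : ∀ i, U' i i ≠ 0) (hup : ∀ i j, j < i → U' i j = 0) :
    (S.upperSolve m r C U).Runs μ fun E ν t => (∃ E', E.Holds ν E' ∧ E' * U' = C') ∧
      ∀ ω c, S.CostOver F ω c → (t : ℝ) ≤ c * max (r : ℝ) m * (r : ℝ) ^ (ω - 1) := by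
  obtain ⟨hCvalid, rfl⟩ := AddrMatrix.holds_iff.mp hC
  obtain ⟨hUvalid, rfl⟩ := AddrMatrix.holds_iff.mp hU
  have hdet : IsUnit (U.load μ).det := by
    rw [Matrix.det_of_isUpperTriangular fun i j hij => hup i j hij, isUnit_iff_ne_zero]
    exact Finset.prod_ne_zero_iff.mpr fun i _ => hdiag i
  exact ⟨⟨_, AddrMatrix.holds_iff.mpr (hS.upperSolve_spec m r C U μ hCvalid hUvalid hdiag hup),
    Matrix.nonsing_inv_mul_cancel_right _ _ hdet⟩,
    fun ω c hc => hc.upperSolve_cost m r C U μ hCvalid hUvalid hdiag hup⟩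

theorem runs_subMul {m r n : ℕ} {B : AddrMatrix m n} {X : AddrMatrix m r} {Y : AddrMatrix r n}
    {B' : Matrix (Fin m) (Fin n) F} {X' : Matrix (Fin m) (Fin r) F} {Y' : Matrix (Fin r) (Fin n) F}
    (hB : B.Holds μ B') (hX : X.Holds μ X') (hY : Y.Holds μ Y') :
    (S.subMul m r n B X Y).Runs μ fun Z ν t => Z.Holds ν (B' - X' * Y') ∧
      ∀ ω c, S.CostOver F ω c → (t : ℝ) ≤ c * (m + r) * (n + r) * max 1 (r : ℝ) ^ (ω - 2) := by
  obtain ⟨hBvalid, rfl⟩ := AddrMatrix.holds_iff.mp hB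
  obtain ⟨hXvalid, rfl⟩ := AddrMatrix.holds_iff.mp hX
  obtain ⟨hYvalid, rfl⟩ := AddrMatrix.holds_iff.mp hY
  exact ⟨AddrMatrix.holds_iff.mpr (hS.subMul_spec m r n B X Y μ hBvalid hXvalid hYvalid),
    fun ω c hc => hc.subMul_cost m r n B X Y μ hBvalid hXvalid hYvalid⟩

end CorrectOver

theorem eliminate_cost_le {ω c : ℝ} (hω : 2 < ω) (hc : 0 ≤ c) {m d w v r : ℕ} (hrm : r ≤ m)
    (hrd : r ≤ d) {t₁ t₂ t₃ t₄ t₅ : ℕ}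
    (h₁ : (t₁ : ℝ) ≤ c * m * d * max 1 (r : ℝ) ^ (ω - 2))
    (h₂ : (t₂ : ℝ) ≤ c * max (r : ℝ) w * (r : ℝ) ^ (ω - 1))
    (h₃ : (t₃ : ℝ) ≤ c * max (r : ℝ) v * (r : ℝ) ^ (ω - 1))
    (h₄ : (t₄ : ℝ) ≤ c * ((m - r : ℕ) + r) * (w + r) * max 1 (r : ℝ) ^ (ω - 2))
    (h₅ : (t₅ : ℝ) ≤ c * (v + r) * ((d - r : ℕ) + r) * max 1 (r : ℝ) ^ (ω - 2)) :
    (t₁ + t₂ + t₃ + t₄ + t₅ : ℝ) ≤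
      5 * (c * (m + v) * (d + w) * max 1 (r : ℝ) ^ (ω - 2)) := by
  have hpow : (r : ℝ) ^ (ω - 2) ≤ max 1 (r : ℝ) ^ (ω - 2) :=
    Real.rpow_le_rpow r.cast_nonneg (le_max_right _ _) (by linarith)
  have hrm' : (r : ℝ) ≤ m := Nat.cast_le.mpr hrm
  have hrd' : (r : ℝ) ≤ d := Nat.cast_le.mpr hrd
  have hr := r.cast_nonneg (α := ℝ)
  have hw := w.cast_nonneg (α := ℝ)
  have hv := v.cast_nonneg (α := ℝ)
  rw [rpow_sub_one_eq_mul_rpow_sub_two hr hω] at h₂ h₃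
  rw [Nat.cast_sub hrm, sub_add_cancel] at h₄
  rw [Nat.cast_sub hrd, sub_add_cancel] at h₅
  have hX := Real.rpow_nonneg hr (ω - 2)
  generalize (r : ℝ) ^ (ω - 2) = x at *
  generalize max 1 (r : ℝ) ^ (ω - 2) = R at *
  have key {p q y : ℝ} (_ : 0 ≤ p) (_ : p ≤ m + v) (_ : 0 ≤ q) (_ : q ≤ d + w) (_ : 0 ≤ y)
      (_ : y ≤ R) : c * p * q * y ≤ c * (m + v) * (d + w) * R := by gcongr
  have b₁ := key (p := m) (q := d) (by positivity) (by linarith) (by positivity) (by linarith)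
    (hX.trans hpow) le_rfl
  have b₂ := key (p := r) (q := max r w) hr (by linarith) (by positivity)
    (max_le (by linarith) (by linarith)) hX hpow
  have b₃ := key (p := max r v) (q := r) (by positivity) (max_le (by linarith) (by linarith)) hr
    (by linarith) hX hpow
  have b₄ := key (p := m) (q := w + r) (by positivity) (by linarith) (by positivity)
    (by linarith) (hX.trans hpow) le_rfl
  have b₅ := key (p := v + r) (q := d) (by positivity) (by linarith) (by positivity)
    (by linarith) (hX.trans hpow) le_rfl
  linarith

theorem runs_eliminate (hS : S.CorrectOver F) {m d w v : ℕ} {A₁ : AddrMatrix m d}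
    {A₂ : AddrMatrix m w} {A₃ : AddrMatrix v d} {μ : List F} {a : ℕ → ℕ → F}
    (h₁ : A₁.Holds μ (Matrix.of fun i j => a i j))
    (h₂ : A₂.Holds μ (Matrix.of fun i j => a i (d + j)))
    (h₃ : A₃.Holds μ (Matrix.of fun i j => a (m + i) j)) :
    (S.eliminate A₁ A₂ A₃).Runs μ fun x ν t =>
      (∃ H I, x.2.1.Holds ν H ∧ x.2.2.Holds ν I ∧ IsElimination a x.1 H I) ∧
      ∀ ω c, 2 < ω → S.CostOver F ω c →
        (t : ℝ) ≤ 5 * (c * (m + v) * (d + w) * max 1 (blockRank a m d : ℝ) ^ (ω - 2)) := by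
  refine (hS.runs_pluq h₁).bind fun f ν₁ t₁ hν₁ ⟨hf, ht₁⟩ => ?_
  have hL := hf.valid_L.holds_load
  have hU := hf.valid_U.holds_load
  refine (hS.runs_lowerSolve (hL.submatrix (Fin.castLE f.r_le_rows) id)
    ((h₂.mono hν₁).submatrix f.pivotRow id) (fun i => hf.L_diag _ _ rfl)
    fun i j hij => hf.L_upper _ _ hij).bind fun D ν₂ t₂ hν₂ ⟨⟨D', hD, hLD⟩, ht₂⟩ => ?_
  refine (hS.runs_upperSolve ((h₃.mono (hν₁.trans hν₂)).submatrix id f.pivotCol)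
    ((hU.mono hν₂).submatrix id (Fin.castLE f.r_le_cols)) hf.U_diag_ne_zero
    fun i j hij => hf.U_lower _ _ hij).bind fun E ν₃ t₃ hν₃ ⟨⟨E', hE, hEU⟩, ht₃⟩ => ?_
  refine (hS.runs_subMul ((h₂.mono ((hν₁.trans hν₂).trans hν₃)).submatrix
    (f.P.symm ∘ tailIndex) id) ((hL.mono (hν₂.trans hν₃)).submatrix tailIndex id)
    (hD.mono hν₃)).bind fun Z ν₄ t₄ hν₄ ⟨hZ, ht₄⟩ => ?_
  refine (hS.runs_subMul ((h₃.mono (((hν₁.trans hν₂).trans hν₃).trans hν₄)).submatrix id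
    (f.Q ∘ tailIndex)) (hE.mono hν₄) ((hU.mono ((hν₂.trans hν₃).trans hν₄)).submatrix id
    tailIndex)).bind fun W ν₅ t₅ hν₅ ⟨hW, ht₅⟩ => ?_
  refine (Prog.runs_const 0 ν₅).bind fun z ν₆ t₆ hν₆ ⟨hz, ht₆⟩ => Prog.runs_pure ⟨?_, ?_⟩
  · rw [map_zero] at hz
    exact ⟨_, _, PLUQ.holds_scatterRows hLD (hZ.mono (hν₅.trans hν₆)) hz,
      PLUQ.holds_scatterCols hEU (hW.mono hν₆) hz,
      hf.isElimination (fun _ _ => rfl) (fun _ _ => rfl) (fun _ _ => rfl) hLD hEU⟩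
  · intro ω c hω hc
    have hrank : blockRank a m d = f.r := by
      rw [(hf.isPivotFamily_of_eq fun _ _ => rfl).blockRank_full, Nat.card_eq_fintype_card,
        Fintype.card_fin]
    rw [hrank, ht₆]
    push_cast
    linarith [eliminate_cost_le hω hc.nonneg f.r_le_rows f.r_le_cols (ht₁ ω c hc) (ht₂ ω c hc)
      (ht₃ ω c hc) (ht₄ ω c hc) (ht₅ ω c hc)]

end Subroutines

theorem Prog.bind_assoc {k : Type u} {α β γ : Type} (p : Prog k α) (f : α → Prog k β)
    (g : β → Prog k γ) : (p.bind f).bind g = p.bind fun a => (f a).bind g := by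
  induction p with
  | ret a => rfl
  | lit c next ih => exact congrArg (lit c) (funext ih)
  | op o x y next ih => exact congrArg (op o x y) (funext ih)
  | test x next ih => exact congrArg (test x) (funext ih)

/-! ## LT-RPM -/

section

variable {F : Type u} [Field F]

theorem blockRank_le_leftQSOrder {n : ℕ} (A : Matrix (Fin n) (Fin n) F) {p q : ℕ} (hp : 1 ≤ p)
    (hq : 1 ≤ q) (hpq : p + q = n) : blockRank (extendZero A) p q ≤ leftQSOrder A := by
  have hsup := Finset.le_sup (f := fun p => leadingRank A p (n - p))
    (Finset.mem_Icc.mpr ⟨hp, (by omega : p ≤ n - 1)⟩)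
  rwa [leadingRank_eq_blockRank A (by omega) (by omega), show n - p = q by omega] at hsup

theorem leftQSOrder_le {n s : ℕ} (A : Matrix (Fin n) (Fin n) F)
    (h : ∀ p q, 1 ≤ p → 1 ≤ q → p + q = n → blockRank (extendZero A) p q ≤ s) :
    leftQSOrder A ≤ s := by
  refine Finset.sup_le fun p hp => ?_
  rw [Finset.mem_Icc] at hp
  rw [leadingRank_eq_blockRank A (by omega) (by omega)]
  exact h p (n - p) hp.1 (by omega) (by omega)

/-- `l` lists, without repetition, the pivots of `a` above the main antidiagonal of its leading
`n × n` block, that is the ones of the left triangular part of the rank profile matrix. -/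
structure IsLeftPivotList (a : ℕ → ℕ → F) (n : ℕ) (l : List (ℕ × ℕ)) : Prop where
  nodup : l.Nodup
  mem_iff : ∀ p, p ∈ l ↔ p.1 + p.2 + 2 ≤ n ∧ PivotAt a p.1 p.2

/-- The ones of `[R₁ R₂; R₃ 0]`, given those of the three blocks, where `R₁` has size `m × d`. -/
def gluePivots (m d : ℕ) (l₁ l₂ l₃ : List (ℕ × ℕ)) : List (ℕ × ℕ) :=
  l₁ ++ l₂.map (Prod.map id (d + ·)) ++ l₃.map (Prod.map (m + ·) id)

section

variable {m d : ℕ} {l₁ l₂ l₃ : List (ℕ × ℕ)}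

theorem mem_gluePivots {p : ℕ × ℕ} :
    p ∈ gluePivots m d l₁ l₂ l₃ ↔
      p ∈ l₁ ∨ (d ≤ p.2 ∧ (p.1, p.2 - d) ∈ l₂) ∨ (m ≤ p.1 ∧ (p.1 - m, p.2) ∈ l₃) := by
  have hright : p ∈ l₂.map (Prod.map id (d + ·)) ↔ d ≤ p.2 ∧ (p.1, p.2 - d) ∈ l₂ := by
    rw [List.mem_map]
    constructor
    · rintro ⟨q, hq, rfl⟩
      simpa using hq
    · rintro ⟨hd, hp⟩
      exact ⟨_, hp, Prod.ext rfl (Nat.add_sub_of_le hd)⟩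
  have hbelow : p ∈ l₃.map (Prod.map (m + ·) id) ↔ m ≤ p.1 ∧ (p.1 - m, p.2) ∈ l₃ := by
    rw [List.mem_map]
    constructor
    · rintro ⟨q, hq, rfl⟩
      simpa using hq
    · rintro ⟨hm, hp⟩
      exact ⟨_, hp, Prod.ext (Nat.add_sub_of_le hm) rfl⟩
  rw [gluePivots, List.mem_append, List.mem_append, or_assoc, hright, hbelow]

theorem nodup_gluePivots (hl₁ : l₁.Nodup) (hl₂ : l₂.Nodup) (hl₃ : l₃.Nodup)
    (h₁ : ∀ p ∈ l₁, p.1 < m ∧ p.2 < d) (h₂ : ∀ p ∈ l₂, p.1 < m) :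
    (gluePivots m d l₁ l₂ l₃).Nodup := by
  rw [gluePivots, List.nodup_append', List.nodup_append']
  refine ⟨⟨hl₁, hl₂.map (Function.injective_id.prodMap (add_right_injective d)), ?_⟩,
    hl₃.map ((add_right_injective m).prodMap Function.injective_id), ?_⟩
  · intro p hp hp'
    obtain ⟨q, -, rfl⟩ := List.mem_map.mp hp'
    exact (Nat.le_add_right d q.2).not_gt (h₁ _ hp).2
  · intro p hp hp'
    obtain ⟨q, -, rfl⟩ := List.mem_map.mp hp'
    have hrow : m + q.1 < m := by
      rcases List.mem_append.mp hp with hp | hp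
      · exact (h₁ _ hp).1
      · obtain ⟨x, hx, hxq⟩ := List.mem_map.mp hp
        have hfst : x.1 = m + q.1 := congrArg Prod.fst hxq
        exact hfst ▸ h₂ x hx
    exact (Nat.le_add_right m q.1).not_gt hrow

end

namespace IsElimination

variable {m d : ℕ} {l₁ l₂ l₃ : List (ℕ × ℕ)} {H : Matrix (Fin m) (Fin m) F}
  {I : Matrix (Fin d) (Fin d) F}

theorem isLeftPivotList {a : ℕ → ℕ → F} (h : IsElimination a l₁ H I)
    (h₂ : IsLeftPivotList (extendZero H) m l₂) (h₃ : IsLeftPivotList (extendZero I) d l₃) :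
    IsLeftPivotList a (m + d) (gluePivots m d l₁ l₂ l₃) where
  nodup := nodup_gluePivots h.nodup h₂.nodup h₃.nodup
    (fun p hp => (and_assoc.mpr ((h.mem_iff p).mp hp)).1)
    fun p hp => by have := ((h₂.mem_iff p).mp hp).1; omega
  mem_iff p := by
    obtain ⟨i, j⟩ := p
    rw [mem_gluePivots, h.mem_iff, h₂.mem_iff, h₃.mem_iff]
    dsimp only
    rcases lt_or_ge i m with hi | hi
    · rcases lt_or_ge j d with hj | hj
      · simp only [hi, hj, hi.not_ge, hj.not_ge, true_and, false_and, or_false,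
          show i + j + 2 ≤ m + d by omega]
      · obtain ⟨b, rfl⟩ := Nat.exists_eq_add_of_le hj
        simp only [hi.not_ge, hj.not_gt, Nat.add_sub_cancel_left, hj, true_and, false_and,
          and_false, or_false, false_or, show i + (d + b) + 2 ≤ m + d ↔ i + b + 2 ≤ m by omega]
        exact and_congr_right fun hb => (h.pivotAt_right hi (by omega)).symm
    · obtain ⟨b, rfl⟩ := Nat.exists_eq_add_of_le hi
      have hright : ¬ (m + b) + (j - d) + 2 ≤ m := by omega
      simp only [hi.not_gt, Nat.add_sub_cancel_left, hi, hright, true_and, false_and,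
        and_false, false_or, show m + b + j + 2 ≤ m + d ↔ b + j + 2 ≤ d by omega]
      exact and_congr_right fun hb => (h.pivotAt_below (by omega) (by omega)).symm

variable {n : ℕ} {A : Matrix (Fin n) (Fin n) F}

theorem leftQSOrder_right_le (h : IsElimination (extendZero A) l₁ H I) (hn : m + d = n) :
    leftQSOrder H ≤ leftQSOrder A := by
  refine leftQSOrder_le H fun p q hp hq hpq => ?_
  have hle := blockRank_le_leftQSOrder A hp (q := d + q) (by omega) (by omega)
  have hadd := h.blockRank_right p (by omega) q (by omega)
  omega

theorem leftQSOrder_below_le (h : IsElimination (extendZero A) l₁ H I) (hn : m + d = n) :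
    leftQSOrder I ≤ leftQSOrder A := by
  refine leftQSOrder_le I fun p q hp hq hpq => ?_
  have hle := blockRank_le_leftQSOrder A (p := m + p) (by omega) hq (by omega)
  have hadd := h.blockRank_below p (by omega) q (by omega)
  omega

end IsElimination

end

section

variable {k : Type u} [Field k] {S : Subroutines k}

theorem ltRPM_of_le_one {n : ℕ} (hn : n ≤ 1) (A : AddrMatrix n n) : ltRPM S n A = pure [] := by
  rw [ltRPM, dif_pos hn]

theorem ltRPM_eq_eliminate {n : ℕ} (hn : 1 < n) (A : AddrMatrix n n) :
    ltRPM S n A = (do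
      let (l₁, H, I) ← S.eliminate (A.submatrix (Fin.castLE (Nat.sub_le n (n / 2)))
          (Fin.castLE (Nat.div_le_self n 2)))
        (A.submatrix (Fin.castLE (Nat.sub_le n (n / 2))) fun j => ⟨n / 2 + j, by omega⟩)
        (A.submatrix (fun i => ⟨n - n / 2 + i, by omega⟩) (Fin.castLE (Nat.div_le_self n 2)))
      let l₂ ← ltRPM S (n - n / 2) H
      let l₃ ← ltRPM S (n / 2) I
      pure (gluePivots (n - n / 2) (n / 2) l₁ l₂ l₃)) := by
  rw [ltRPM, dif_neg hn.not_ge]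
  unfold Subroutines.eliminate
  simp only [Bind.bind, Prog.bind_assoc]
  rfl

/-- The recursion is balanced: `m ^ 2 + d ^ 2 ≤ 2 / 3 * n ^ 2`, so the elimination costs add up to
a geometric series. -/
theorem ltRPM_cost_le {ω c : ℝ} (hω : 2 < ω) (hc : 0 ≤ c) {m d n : ℕ} (hn : m + d = n)
    (hm : 3 * m ≤ 2 * n) (hd : 3 * d ≤ 2 * n) {r s s₂ s₃ : ℕ} (hr : r ≤ s) (hs₂ : s₂ ≤ s)
    (hs₃ : s₃ ≤ s) {t₁ t₂ t₃ : ℕ}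
    (h₁ : (t₁ : ℝ) ≤ 5 * (c * (m + d) * (d + m) * max 1 (r : ℝ) ^ (ω - 2)))
    (h₂ : (t₂ : ℝ) ≤ 15 * c * (m : ℝ) ^ 2 * max 1 (s₂ : ℝ) ^ (ω - 2))
    (h₃ : (t₃ : ℝ) ≤ 15 * c * (d : ℝ) ^ 2 * max 1 (s₃ : ℝ) ^ (ω - 2)) :
    (t₁ + t₂ + t₃ : ℝ) ≤ 15 * c * (n : ℝ) ^ 2 * max 1 (s : ℝ) ^ (ω - 2) := by
  have hmono {q : ℕ} (hq : q ≤ s) : max 1 (q : ℝ) ^ (ω - 2) ≤ max 1 (s : ℝ) ^ (ω - 2) :=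
    Real.rpow_le_rpow (by positivity) (max_le_max le_rfl (Nat.cast_le.mpr hq)) (by linarith)
  have hn' : (m : ℝ) + d = n := mod_cast hn
  have hm' : 3 * (m : ℝ) ≤ 2 * n := mod_cast hm
  have hd' : 3 * (d : ℝ) ≤ 2 * n := mod_cast hd
  have hsq : 3 * ((m : ℝ) ^ 2 + (d : ℝ) ^ 2) ≤ 2 * (n : ℝ) ^ 2 := by
    nlinarith [mul_le_mul_of_nonneg_left hm' m.cast_nonneg,
      mul_le_mul_of_nonneg_left hd' d.cast_nonneg]
  calc (t₁ + t₂ + t₃ : ℝ)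
      ≤ 5 * (c * (m + d) * (d + m) * max 1 (s : ℝ) ^ (ω - 2)) +
          15 * c * (m : ℝ) ^ 2 * max 1 (s : ℝ) ^ (ω - 2) +
          15 * c * (d : ℝ) ^ 2 * max 1 (s : ℝ) ^ (ω - 2) := by
        gcongr
        · exact h₁.trans (by gcongr 5 * (_ * ?_); exact hmono hr)
        · exact h₂.trans (mul_le_mul_of_nonneg_left (hmono hs₂) (by positivity))
        · exact h₃.trans (mul_le_mul_of_nonneg_left (hmono hs₃) (by positivity))
    _ = 5 * (c * max 1 (s : ℝ) ^ (ω - 2)) *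
          ((n : ℝ) ^ 2 + 3 * ((m : ℝ) ^ 2 + (d : ℝ) ^ 2)) := by
        rw [← hn']
        ring
    _ ≤ 5 * (c * max 1 (s : ℝ) ^ (ω - 2)) * ((n : ℝ) ^ 2 + 2 * (n : ℝ) ^ 2) := by gcongr
    _ = _ := by ring

variable {F : Type u} [Field F] [Algebra k F]

theorem runs_ltRPM (hS : S.CorrectOver F) (n : ℕ) {A : AddrMatrix n n}
    {A' : Matrix (Fin n) (Fin n) F} {μ : List F} (hA : A.Holds μ A') :
    (ltRPM S n A).Runs μ fun l _ t => IsLeftPivotList (extendZero A') n l ∧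
      ∀ ω c, 2 < ω → S.CostOver F ω c →
        (t : ℝ) ≤ 15 * c * (n : ℝ) ^ 2 * max 1 (leftQSOrder A' : ℝ) ^ (ω - 2) := by
  induction n using Nat.strong_induction_on generalizing μ with
  | _ n ih =>
  have hcell (i j : Fin n) : μ[A i j]? = some (extendZero A' i j) := by
    rw [hA, extendZero_apply A' i.2 j.2]
  rcases le_or_gt n 1 with hn | hn
  · rw [ltRPM_of_le_one hn]
    refine Prog.runs_pure ⟨⟨List.nodup_nil, fun p => ?_⟩, fun ω c _ hc => ?_⟩
    · simp only [List.not_mem_nil, false_iff]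
      omega
    · have := hc.nonneg
      rw [Nat.cast_zero]
      positivity
  have hsum : n - n / 2 + n / 2 = n := Nat.sub_add_cancel (Nat.div_le_self n 2)
  rw [ltRPM_eq_eliminate hn]
  refine (Subroutines.runs_eliminate hS (m := n - n / 2) (d := n / 2) (a := extendZero A')
    (fun i j => hcell _ _) (fun i j => hcell _ _) fun i j => hcell _ _).bind ?_
  rintro ⟨l₁, HX, IX⟩ ν₁ t₁ - ⟨⟨H, I, hH, hI, hel⟩, ht₁⟩
  refine (ih _ (by omega) hH).bind fun l₂ ν₂ t₂ hν₂ ⟨hl₂, ht₂⟩ => ?_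
  refine (ih _ (by omega) (hI.mono hν₂)).bind fun l₃ ν₃ t₃ _ ⟨hl₃, ht₃⟩ => ?_
  refine Prog.runs_pure ⟨?_, fun ω c hω hc => ?_⟩
  · have hl := hel.isLeftPivotList hl₂ hl₃
    rwa [hsum] at hl
  · have hcost := ltRPM_cost_le hω hc.nonneg hsum (by omega) (by omega)
      (blockRank_le_leftQSOrder A' (by omega) (by omega) hsum) (hel.leftQSOrder_right_le hsum)
      (hel.leftQSOrder_below_le hsum) (ht₁ ω c hω hc) (ht₂ ω c hω hc) (ht₃ ω c hω hc)
    push_cast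
    linarith

end

/-! ## The scan of QS-order -/

/-- The number of positions of `l` in the leading `p × (n - p)` block. -/
def leadingCount (n : ℕ) (l : List (ℕ × ℕ)) (p : ℕ) : ℕ :=
  l.countP fun x => x.1 < p ∧ x.2 < n - p

/-- The state of the scan in which exactly the rows and columns of the positions in `l` are
marked. -/
def markedState (l : List (ℕ × ℕ)) (s r : ℤ) (steps : ℕ) : ScanState where
  rows i := decide (i ∈ l.map Prod.fst)
  cols j := decide (j ∈ l.map Prod.snd)
  s := s
  r := r
  steps := steps

theorem scanMark_markedState (l : List (ℕ × ℕ)) (s r : ℤ) (t : ℕ) (p : ℕ × ℕ) :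
    scanMark (markedState l s r t) p = markedState (l ++ [p]) s r (t + 2) := by
  simp only [scanMark, markedState, ScanState.mk.injEq, List.map_append, List.mem_append,
    List.map_cons, List.map_nil, List.mem_singleton, and_true]
  constructor <;> ext x <;> rw [Function.update_apply] <;> split_ifs with hx <;> simp [hx]

theorem foldl_scanMark (n : ℕ) (l : List (ℕ × ℕ)) :
    l.foldl scanMark (scanInit n) = markedState l 0 0 (2 * n + 2 + 2 * l.length) := by
  induction l using List.reverseRecOn with
  | nil => simp [scanInit, markedState]
  | append_singleton l p ih =>
    rw [List.foldl_append, List.foldl_cons, List.foldl_nil, ih, scanMark_markedState,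
      List.length_append, List.length_singleton, mul_add_one, add_assoc]

theorem leadingCount_succ {n m : ℕ} {l : List (ℕ × ℕ)} (hlt : ∀ p ∈ l, p.1 + p.2 + 2 ≤ n)
    (hm : m < n - 1) :
    leadingCount n l (m + 1) + (l.map Prod.snd).count (n - 1 - m) =
      leadingCount n l m + (l.map Prod.fst).count m := by
  unfold leadingCount
  induction l with
  | nil => rfl
  | cons p l ih =>
    have ih := ih fun q hq => hlt q (List.mem_cons_of_mem p hq)
    have hp := hlt p List.mem_cons_self
    simp only [List.countP_cons, List.map_cons, List.count_cons, decide_eq_true_eq, beq_iff_eq]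
    split_ifs <;> omega

section

variable {n : ℕ} {l : List (ℕ × ℕ)}

theorem scanStep_markedState (hrow : (l.map Prod.fst).Nodup) (hcol : (l.map Prod.snd).Nodup)
    (hlt : ∀ p ∈ l, p.1 + p.2 + 2 ≤ n) {m : ℕ} (hm : m < n - 1) (s : ℤ) (t : ℕ) :
    scanStep n (markedState l s (leadingCount n l m) t) m =
      markedState l (max s (leadingCount n l (m + 1))) (leadingCount n l (m + 1)) (t + 5) := by
  have hcount := leadingCount_succ hlt hm
  rw [hrow.count, hcol.count] at hcount
  have hr : (if n - 1 - m ∈ l.map Prod.snd then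
      (if m ∈ l.map Prod.fst then (leadingCount n l m : ℤ) + 1 else leadingCount n l m) - 1 else
      if m ∈ l.map Prod.fst then (leadingCount n l m : ℤ) + 1 else leadingCount n l m) =
      leadingCount n l (m + 1) := by
    split_ifs at hcount ⊢ <;> omega
  simp only [scanStep, markedState, decide_eq_true_eq, hr]

theorem scan_eq (hrow : (l.map Prod.fst).Nodup) (hcol : (l.map Prod.snd).Nodup)
    (hlt : ∀ p ∈ l, p.1 + p.2 + 2 ≤ n) :
    scan n l = markedState l ((Finset.Icc 1 (n - 1)).sup (leadingCount n l) : ℕ)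
      (leadingCount n l (n - 1)) (2 * n + 2 + 2 * l.length + 5 * (n - 1)) := by
  suffices hrange : ∀ m ≤ n - 1, (List.range m).foldl (scanStep n) (l.foldl scanMark (scanInit n)) =
      markedState l ((Finset.Icc 1 m).sup (leadingCount n l) : ℕ) (leadingCount n l m)
        (2 * n + 2 + 2 * l.length + 5 * m) from hrange _ le_rfl
  intro m
  induction m with
  | zero =>
    have hzero : leadingCount n l 0 = 0 := by simp [leadingCount]
    simp [foldl_scanMark, hzero]
  | succ m ih =>
    intro hm
    rw [List.range_succ, List.foldl_append, ih (by omega), List.foldl_cons, List.foldl_nil,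
      scanStep_markedState hrow hcol hlt (by omega), ← Nat.cast_max, max_comm,
      ← Finset.insert_Icc_right_eq_Icc_add_one (by omega), Finset.sup_insert]
    rfl

end

namespace IsLeftPivotList

variable {F τ : Type*} [Field F] [Finite τ] {a : ℕ → ℕ → F} {n : ℕ} {l : List (ℕ × ℕ)}
  {ρ γ : τ → ℕ}

theorem lt (hl : IsLeftPivotList a n l) : ∀ p ∈ l, p.1 + p.2 + 2 ≤ n :=
  fun p hp => ((hl.mem_iff p).mp hp).1

theorem mem_iff_exists (hl : IsLeftPivotList a n l) (h : IsPivotFamily a n n ρ γ) {p : ℕ × ℕ} :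
    p ∈ l ↔ p.1 + p.2 + 2 ≤ n ∧ ∃ t, (ρ t, γ t) = p := by
  rw [hl.mem_iff]
  refine and_congr_right fun hp => ?_
  rw [h.pivotAt_iff (by omega) (by omega)]
  simp only [Prod.ext_iff]

theorem nodup_map_fst (hl : IsLeftPivotList a n l) (h : IsPivotFamily a n n ρ γ) :
    (l.map Prod.fst).Nodup := by
  refine hl.nodup.map_on fun p hp q hq hpq => ?_
  obtain ⟨-, t, rfl⟩ := (hl.mem_iff_exists h).mp hp
  obtain ⟨-, t', rfl⟩ := (hl.mem_iff_exists h).mp hq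
  rw [h.row_injective hpq]

theorem nodup_map_snd (hl : IsLeftPivotList a n l) (h : IsPivotFamily a n n ρ γ) :
    (l.map Prod.snd).Nodup := by
  refine hl.nodup.map_on fun p hp q hq hpq => ?_
  obtain ⟨-, t, rfl⟩ := (hl.mem_iff_exists h).mp hp
  obtain ⟨-, t', rfl⟩ := (hl.mem_iff_exists h).mp hq
  rw [h.col_injective hpq]

theorem length_le (hl : IsLeftPivotList a n l) (h : IsPivotFamily a n n ρ γ) : l.length ≤ n := by
  have hsub : l.map Prod.fst ⊆ List.range n := fun i hi => by
    obtain ⟨p, hp, rfl⟩ := List.mem_map.mp hi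
    have := hl.lt p hp
    exact List.mem_range.mpr (by omega)
  simpa using ((hl.nodup_map_fst h).subperm hsub).length_le

theorem leadingCount_eq (hl : IsLeftPivotList a n l) (h : IsPivotFamily a n n ρ γ) {p : ℕ}
    (hp : p ≤ n) : leadingCount n l p = blockRank a p (n - p) := by
  rw [h.blockRank_eq p hp (n - p) (Nat.sub_le n p), leadingCount, List.countP_eq_length_filter,
    ← List.toFinset_card_of_nodup (hl.nodup.filter _), ← Nat.card_eq_finsetCard]
  symm
  refine Nat.card_eq_of_bijective (fun t => ⟨(ρ t.1, γ t.1), ?_⟩) ⟨fun s t hst => ?_, ?_⟩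
  · have := t.2
    simp only [List.mem_toFinset, List.mem_filter, hl.mem_iff_exists h, decide_eq_true_eq]
    exact ⟨⟨by omega, t.1, rfl⟩, this⟩
  · exact Subtype.ext (h.row_injective (congrArg (fun x => x.1.1) hst))
  · rintro ⟨q, hq⟩
    simp only [List.mem_toFinset, List.mem_filter, hl.mem_iff_exists h, decide_eq_true_eq] at hq
    obtain ⟨⟨-, t, rfl⟩, ht⟩ := hq
    exact ⟨⟨t, ht⟩, rfl⟩

theorem scan_s {A : Matrix (Fin n) (Fin n) F} (hl : IsLeftPivotList (extendZero A) n l)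
    (h : IsPivotFamily (extendZero A) n n ρ γ) : (scan n l).s = leftQSOrder A := by
  rw [scan_eq (hl.nodup_map_fst h) (hl.nodup_map_snd h) hl.lt, markedState, leftQSOrder]
  refine congrArg Nat.cast (Finset.sup_congr rfl fun p hp => ?_)
  rw [Finset.mem_Icc] at hp
  rw [hl.leadingCount_eq h (by omega), leadingRank_eq_blockRank A (by omega) (by omega)]

theorem scan_steps_le (hl : IsLeftPivotList a n l) (h : IsPivotFamily a n n ρ γ) :
    (scan n l).steps ≤ 9 * (n + 1) := by
  have := hl.length_le h
  rw [scan_eq (hl.nodup_map_fst h) (hl.nodup_map_snd h) hl.lt, markedState]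
  dsimp only
  omega

theorem isPivotList {A R : Matrix (Fin n) (Fin n) F} (hl : IsLeftPivotList (extendZero A) n l)
    (hR : IsRankProfileMatrix A R) : IsPivotList l (leftPart R) := by
  classical
  refine ⟨hl.nodup, fun p hp => ?_, fun i j => ?_⟩
  · have := hl.lt p hp
    omega
  · rw [leftPart, Matrix.of_apply, hR.apply_eq, ← ite_and]
    refine if_congr ?_ rfl rfl
    rw [hl.mem_iff]
    exact and_congr_left fun _ => by dsimp only; omega

end IsLeftPivotList

section

variable {k F : Type u} [Field k] [Field F] [Algebra k F] {S : Subroutines k} {n : ℕ}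
  {A : AddrMatrix n n} {μ : List F}

theorem isLeftPivotList_ltRPM_val (hS : S.CorrectOver F) (hA : A.Valid μ) :
    IsLeftPivotList (extendZero (A.load μ)) n ((ltRPM S n A).val μ) :=
  (runs_ltRPM hS n hA.holds_load).1

theorem qsOrder_val (S : Subroutines k) (A : AddrMatrix n n) (μ : List F) :
    (qsOrder S n A).val μ =
      ((scan n ((ltRPM S n A).val μ)).s, (scan n ((ltRPM S n A).val μ)).steps) := by
  rw [qsOrder, Prog.val, Prog.exec_bind]
  rfl

theorem qsOrder_cost (S : Subroutines k) (A : AddrMatrix n n) (μ : List F) :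
    (qsOrder S n A).cost μ = (ltRPM S n A).cost μ := by
  rw [qsOrder, Prog.cost_bind]
  rfl

theorem qsOrder_val_fst (hS : S.CorrectOver F) (hA : A.Valid μ) :
    ((qsOrder S n A).val μ).1 = leftQSOrder (A.load μ) := by
  rw [qsOrder_val]
  exact (isLeftPivotList_ltRPM_val hS hA).scan_s (hS.pluq_spec n n A μ hA).isPivotFamily

theorem qsOrder_val_snd_le (hS : S.CorrectOver F) (hA : A.Valid μ) :
    ((qsOrder S n A).val μ).2 ≤ 9 * (n + 1) := by
  rw [qsOrder_val]
  exact (isLeftPivotList_ltRPM_val hS hA).scan_steps_le (hS.pluq_spec n n A μ hA).isPivotFamily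

end

/-! ## Quasiseparable orders -/

section

variable {F : Type u} [Field F] {n : ℕ}

/-- Reversal of `Fin n` maps the first `p` indices onto the last `p` ones. -/
def revSubtypeEquiv {p q : ℕ} (h : p + q = n) :
    {x : Fin n // x.1 < p} ≃ {x : Fin n // q ≤ x.1} :=
  Fin.revPerm.subtypeEquiv fun x => by rw [Fin.revPerm_apply, Fin.val_rev]; omega

theorem antidiag_mul_apply (L : Matrix (Fin n) (Fin n) F) (i j : Fin n) :
    (antidiag F n * L) i j = L (Fin.rev i) j := by
  simp [antidiag, Matrix.mul_apply]

theorem mul_antidiag_apply (U : Matrix (Fin n) (Fin n) F) (i j : Fin n) :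
    (U * antidiag F n) i j = U i (Fin.rev j) := by
  simp [antidiag, Matrix.mul_apply, ← Fin.rev_eq_iff]

theorem leadingRank_antidiag_mul {M L : Matrix (Fin n) (Fin n) F}
    (hL : ∀ i j, j < i → L i j = M i j) {p q : ℕ} (h : p + q = n) :
    leadingRank (antidiag F n * L) p q =
      (M.submatrix (fun x : {x : Fin n // q ≤ x.1} => x.1)
        (fun y : {y : Fin n // y.1 < q} => y.1)).rank := by
  rw [leadingRank, ← Matrix.rank_submatrix (M.submatrix _ _) (revSubtypeEquiv h) (Equiv.refl _)]
  congr 1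
  ext i j
  simp only [Matrix.submatrix_apply, antidiag_mul_apply]
  exact hL _ _ (j.2.trans_le ((revSubtypeEquiv h) i).2)

theorem leadingRank_mul_antidiag {M U : Matrix (Fin n) (Fin n) F}
    (hU : ∀ i j, i < j → U i j = M i j) {p q : ℕ} (h : q + p = n) :
    leadingRank (U * antidiag F n) p q =
      (M.submatrix (fun x : {x : Fin n // x.1 < p} => x.1)
        (fun y : {y : Fin n // p ≤ y.1} => y.1)).rank := by
  rw [leadingRank, ← Matrix.rank_submatrix (M.submatrix _ _) (Equiv.refl _) (revSubtypeEquiv h)]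
  congr 1
  ext i j
  simp only [Matrix.submatrix_apply, mul_antidiag_apply]
  exact hU _ _ (i.2.trans_le ((revSubtypeEquiv h) j).2)

theorem leftQSOrder_antidiag_mul {M L : Matrix (Fin n) (Fin n) F}
    (hL : ∀ i j, j < i → L i j = M i j) : leftQSOrder (antidiag F n * L) = lowerQSOrder M := by
  unfold leftQSOrder lowerQSOrder
  apply le_antisymm <;> refine Finset.sup_le fun p hp => ?_ <;> rw [Finset.mem_Icc] at hp
  · rw [leadingRank_antidiag_mul hL (by omega : p + (n - p) = n)]
    exact Finset.le_sup (f := fun p => (M.submatrix (fun x : {x : Fin n // p ≤ x.1} => x.1)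
      (fun y : {y : Fin n // y.1 < p} => y.1)).rank) (Finset.mem_Icc.mpr (by omega))
  · rw [← leadingRank_antidiag_mul hL (by omega : n - p + p = n)]
    have := Finset.le_sup (f := fun p => leadingRank (antidiag F n * L) p (n - p))
      (Finset.mem_Icc.mpr (by omega : 1 ≤ n - p ∧ n - p ≤ n - 1))
    rwa [show n - (n - p) = p by omega] at this

theorem leftQSOrder_mul_antidiag {M U : Matrix (Fin n) (Fin n) F}
    (hU : ∀ i j, i < j → U i j = M i j) : leftQSOrder (U * antidiag F n) = upperQSOrder M := by
  unfold leftQSOrder upperQSOrder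
  refine Finset.sup_congr rfl fun p hp => ?_
  rw [Finset.mem_Icc] at hp
  exact leadingRank_mul_antidiag hU (by omega)

end

theorem mainTheorem1 {k : Type u} [Field k] {ω : ℝ} (hω2 : 2 < ω) (hω3 : ω ≤ 3)
    (hmm : MatMulExponent k ω) :
    -- correctness of LT-RPM, for every choice of correct subroutines
    (∀ (F : Type u) [Field F] [Algebra k F] (S : Subroutines k), S.CorrectOver F →
      ∀ (n : ℕ) (A : AddrMatrix n n) (μ : List F), A.Valid μ →
        ∃ R : Matrix (Fin n) (Fin n) F,
          IsRankProfileMatrix (A.load μ) R ∧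
          (∀ R', IsRankProfileMatrix (A.load μ) R' → R' = R) ∧
          IsPivotList ((ltRPM S n A).val μ) (leftPart R)) ∧
    -- cost of LT-RPM with subroutines of the standard costs
    (∀ c : ℝ, ∃ C : ℝ, ∀ (F : Type u) [Field F] [Algebra k F] (S : Subroutines k),
      S.CorrectOver F → S.CostOver F ω c →
      ∀ (n : ℕ) (A : AddrMatrix n n) (μ : List F), A.Valid μ →
        ((ltRPM S n A).cost μ : ℝ) ≤
          C * (n : ℝ) ^ 2 * (max 1 (leftQSOrder (A.load μ) : ℝ)) ^ (ω - 2)) ∧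
    -- fast matrix multiplication provides such subroutines
    (∃ (c : ℝ) (S : Subroutines k), ∀ (F : Type u) [Field F] [Algebra k F],
      S.CorrectOver F ∧ S.CostOver F ω c) ∧
    -- QS-order computes the left quasiseparable order, with a scan of linear length and
    -- no further field operations
    (∃ c : ℕ, ∀ (F : Type u) [Field F] [Algebra k F] (S : Subroutines k), S.CorrectOver F →
      ∀ (n : ℕ) (A : AddrMatrix n n) (μ : List F), A.Valid μ →
        ((qsOrder S n A).val μ).1 = (leftQSOrder (A.load μ) : ℤ) ∧
        ((qsOrder S n A).val μ).2 ≤ c * (n + 1) ∧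
        (qsOrder S n A).cost μ = (ltRPM S n A).cost μ) ∧
    -- on `J_n L` and `U J_n` it returns the quasiseparable orders of `M`, and these are also the
    -- left quasiseparable orders of the two inputs, which govern the cost
    (∀ (F : Type u) [Field F] [Algebra k F] (S : Subroutines k), S.CorrectOver F →
      ∀ (n : ℕ) (M L U : Matrix (Fin n) (Fin n) F),
        (∀ i j, j < i → L i j = M i j) → (∀ i j, i < j → L i j = 0) →
        (∀ i j, i < j → U i j = M i j) → (∀ i j, j < i → U i j = 0) →
        ∀ (X Y : AddrMatrix n n) (μ ν : List F), X.Valid μ → Y.Valid ν →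
          X.load μ = antidiag F n * L → Y.load ν = U * antidiag F n →
            ((qsOrder S n X).val μ).1 = (lowerQSOrder M : ℤ) ∧
            ((qsOrder S n Y).val ν).1 = (upperQSOrder M : ℤ) ∧
            leftQSOrder (X.load μ) = lowerQSOrder M ∧
            leftQSOrder (Y.load ν) = upperQSOrder M) := by
  refine ⟨?_, ?_, hmm.exists_subroutines hω2 hω3, ⟨9, ?_⟩, ?_⟩
  · intro F _ _ S hS n A μ hA
    have hR := (hS.pluq_spec n n A μ hA).reveals
    exact ⟨_, hR, fun R' hR' => hR.unique hR', (isLeftPivotList_ltRPM_val hS hA).isPivotList hR⟩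
  · intro c
    exact ⟨15 * c, fun F _ _ S hS hc n A μ hA => (runs_ltRPM hS n hA.holds_load).2 ω c hω2 hc⟩
  · intro F _ _ S hS n A μ hA
    exact ⟨qsOrder_val_fst hS hA, qsOrder_val_snd_le hS hA, qsOrder_cost S A μ⟩
  · intro F _ _ S hS n M L U hL _ hU _ X Y μ ν hX hY lX lY
    have hlower : leftQSOrder (X.load μ) = lowerQSOrder M := by rw [lX, leftQSOrder_antidiag_mul hL]
    have hupper : leftQSOrder (Y.load ν) = upperQSOrder M := by rw [lY, leftQSOrder_mul_antidiag hU]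
    rw [qsOrder_val_fst hS hX, qsOrder_val_fst hS hY, hlower, hupper]
    exact ⟨rfl, rfl, rfl, rfl⟩
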